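/- **Setting.** Let $d\ge 1$, write $x\sim y$ if $x,y\in\mathbb Z^d$ are nearest neighbours, $\Omega=\{y: y\sim 0\}$, $|\Omega|=2d$, $D(x)=|\Omega|^{-1}\mathbf 1\{x\sim 0\}$, and $\hat f(k)=\sum_{x\in\mathbb Z^d}e^{ik\cdot x}f(x)$ for $k\in\mathbb R^d$. A walk $\omega=(\omega_0,\dots,\omega_n)$ is a sequence of successively adjacent vertices, $|\omega|=n$, and $\mathrm{range}(\omega)$ is the set of vertices it visits. Loop erasure removes loops chronologically: if $\tau$ is the first time at which a vertex is visited twice and $\tau^\star$ the first visit to $\omega_\tau$, the self-avoiding polygon $(\omega_{\tau^\star},\dots,\omega_\tau)$ is removed, and this is repeated until the walk is self-avoiding; $n_L^\eta(\omega)$ is the number of times the polygon $\eta$ is removed. Let $\lambda=(\lambda_\eta)$ be nonnegative activities indexed by the self-avoiding polygons $\eta$ (closed walks whose only repeated vertex is the common endpoint), bounded above, and invariant under the isometries of $\mathbb Z^d$ and under changes of the initial vertex and of the orientation of $\eta$. For $z\ge0$ put $$w_{\lambda,z}(\omega)=z^{|\omega|}\prod_\eta\lambda_\eta^{n_L^\eta(\omega)},\quad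 G_{\lambda,z}(x)=\sum_{\omega:0\to x}w_{\lambda,z}(\omega),\quad \chi_\lambda(z)=\sum_xG_{\lambda,z}(x).$$ Let $\mathcal X$ be the set of closed walks $X$ with $|X|\ge1$, $\ell(X)=\mathrm{range}(X)$, $\alpha_X=\exp(w_{\lambda,z}(X)/|X|)-1$, and for $A,B\subset\mathbb Z^d$ $$\mu_{\lambda,z}(A;B)=\sum_{X\in\mathcal X}\mathbf 1\{\ell(X)\cap A\neq\emptyset,\ \ell(X)\cap B=\emptyset\}\frac{w_{\lambda,z}(X)}{|X|},\qquad \mu_{\lambda,z}(A)=\mu_{\lambda,z}(A;\emptyset).$$ Fix $y\sim0$ and let $\alpha_0=\prod_{X\ni 0}(1+\alpha_X)$ and $\alpha=\prod_{X\ni0,\,X\not\ni y}(1+\alpha_X)$, where $X\ni v$ means $v\in\ell(X)$. Let $$c_n(x)=\sum_{\omega:0\to x,\ |\omega|=n}\mathbf 1\{\omega\text{ self-avoiding}\}\prod_{X:\,\ell(X)\cap\mathrm{range}(\omega)\ne\emptyset}(1+\alpha_X).$$ **Coefficients.** A graph on $\{0,\dots,m\}$ is a set of edges $st$ with $0\le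 s<t\le m$. It is connected if $m>1$, every $0<j<m$ satisfies $s<j<t$ for some edge $st$, and $0$ and $m$ are endpoints of edges. A lace is a connected graph that is no longer connected after the removal of any edge; $\mathcal L^{(N)}[0,m]$ is the set of laces with $N$ edges. To a connected graph $\Gamma$ one associates the lace $L_\Gamma$ with edges $s_it_i$ given by $s_1=0$, $t_1=\max\{v:0v\in\Gamma\}$, $t_{i+1}=\max\{v:\exists s<t_i,\ sv\in\Gamma\}$, $s_{i+1}=\min\{s:st_{i+1}\in\Gamma\}$, up to the first $i$ with $t_i=m$. For a lace $L$, $\mathcal C(L)$ is the set of edges $st\notin L$ with $L_{L\cup\{st\}}=L$. A hyperedge on $\{0,\dots,m\}$ is a pair $(J,X)$ with $\emptyset\ne J\subset\{0,\dots,m\}$ and either $X\in\mathcal X$, or $X=\emptyset$ and $|J|=2$; its span is $\{\min J,\max J\}$. For a walk $\omega$ let $F_{\{s,t\},\emptyset}(\omega)=-\mathbf 1\{\omega_s=\omega_t\}$ and, for $X\in\mathcal X$, $$F_{J,X}(\omega)=\prod_{j\in J}\mathbf 1\{\omega_j\in\ell(X)\}\cdot\begin{cases}\alpha_X,&|J|\text{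 odd},\\-\alpha_X/(1+\alpha_X),&|J|\text{ even}.\end{cases}$$ Let $I^\omega(s,t)=1$ if $\omega_s=\omega_t$, and otherwise $$I^\omega(s,t)=1-\prod_{X\in\mathcal X}\Big(1-\tfrac{\alpha_X}{1+\alpha_X}\mathbf 1\{\omega_s,\omega_t\in\ell(X)\}\,\mathbf 1\{\omega_j\notin\ell(X)\text{ for all }s<j<t\}\Big).$$ Put $$\pi^{(N)}_m(x)=z^m\alpha_0^{-1}\sum_{\omega:0\to x,\ |\omega|=m}\ \sum_{L\in\mathcal L^{(N)}[0,m]}\ \prod_{st\in L}I^\omega(s,t)\prod_{\mathrm{span}(J,X)\in\mathcal C(L)}(1+F_{J,X}(\omega))\prod_{0\le j\le m,\ X\in\mathcal X}(1+F_{\{j\},X}(\omega)),$$ $\pi_m=\sum_{N\ge1}(-1)^N\pi_m^{(N)}$ and $\Pi_{\lambda,z}(x)=\sum_{m\ge2}\pi_m(x)$. **Proposition.** (a) Let $z\ge0$ with $\chi_\lambda(z)<\infty$ (for instance $z$ less than the radius of convergence of $\chi_\lambda$). Then: 1. $\mu_{\lambda,z}(\{0\})<\infty$, $\alpha_0=\exp(\mu_{\lambda,z}(\{0\}))$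 and $\alpha=\exp(\mu_{\lambda,z}(\{0\};\{y\}))$. 2. $G_{\lambda,z}(x)=\sum_n z^nc_n(x)$ for all $x$, and for every $k\in\mathbb R^d$, as formal power series in $t$, $$\Big(\sum_{n\ge0}z^n\hat c_n(k)\,t^n\Big)\Big(1-z\alpha|\Omega|\hat D(k)\,t-\sum_{m\ge2}\hat\pi_m(k)\,t^m\Big)=\alpha_0.$$ 3. If $\sum_{m}\sum_x|\pi_m(x)|<\infty$, then for every $k\in\mathbb R^d$ the denominator below is non-zero and $$\hat G_{\lambda,z}(k)=\frac{\alpha_0}{1-z\alpha|\Omega|\hat D(k)-\hat\Pi_{\lambda,z}(k)}.$$ (b) There is $z_0>0$, depending only on $d$ and $\lambda$, such that $\chi_\lambda(z)<\infty$ and $\sum_m\sum_x|\pi_m(x)|<\infty$ for all $0\le z<z_0$; so the identity in 3 holds for all such $z$. -/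

import Mathlib

noncomputable section

namespace LWW

/-! ### Walks on the simple cubic lattice -/

/-- Vertices of `ℤ^d`. -/
abbrev Site (d : ℕ) := Fin d → ℤ

/-- The graph (`ℓ¹`) distance on `ℤ^d`. -/
def dist1 {d : ℕ} (x y : Site d) : ℤ := ∑ i, |x i - y i|

/-- `x ∼ y`: nearest neighbours in `ℤ^d`. -/
def Adj {d : ℕ} (x y : Site d) : Prop := dist1 x y = 1

/-- A walk `(ω₀, …, ωₙ)`: a nonempty list of successively adjacent vertices. -/
structure Walk (d : ℕ) where
  verts : List (Site d)
  ne_nil : verts ≠ []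
  chain : verts.IsChain Adj

namespace Walk

variable {d : ℕ}

/-- The number of steps `|ω|`. -/
def length (ω : Walk d) : ℕ := ω.verts.length - 1

/-- The vertex `ω_j`, for `0 ≤ j ≤ |ω|`. -/
def vert (ω : Walk d) (j : ℕ) : Site d := ω.verts.getD j 0

/-- The set of vertices visited by `ω`. -/
def range (ω : Walk d) : Set (Site d) := {x | x ∈ ω.verts}

def start (ω : Walk d) : Site d := ω.vert 0

def finish (ω : Walk d) : Site d := ω.vert ω.length

/-- `ω` is a loop (closed walk). -/
def Closed (ω : Walk d) : Prop := ω.start = ω.finish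

def SelfAvoiding (ω : Walk d) : Prop :=
  ∀ i j, i ≤ ω.length → j ≤ ω.length → ω.vert i = ω.vert j → i = j

/-- Self-avoiding polygons: the only coincidence is that of the two endpoints. -/
def IsPolygon (ω : Walk d) : Prop :=
  ω.Closed ∧ ∀ i j, i < j → j ≤ ω.length → ω.vert i = ω.vert j → i = 0 ∧ j = ω.length

end Walk

/-- The set of self-avoiding polygons in `ℤ^d` (rooted and oriented). -/
abbrev SAP (d : ℕ) := {η : Walk d // η.IsPolygon}

/-- Walks from `x` to `y`. -/
abbrev WalkBetween {d : ℕ} (x y : Site d) := {ω : Walk d // ω.start = x ∧ ω.finish = y}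

/-- `m`-step walks from `x` to `y`. -/
abbrev WalkOfLength {d : ℕ} (m : ℕ) (x y : Site d) :=
  {ω : Walk d // ω.start = x ∧ ω.finish = y ∧ ω.length = m}

/-! ### Loop erasure -/

section LoopErasure

variable {V : Type*}

/-- The first time at which a vertex is visited for the second time
(meaningful when the list has a repetition). -/
def tau (l : List V) : ℕ := sInf {i | i < l.length ∧ ∃ j < i, l[j]? = l[i]?}

/-- The time of the first visit to the vertex occupied at time `tau`. -/
def tauStar (l : List V) : ℕ := sInf {j | l[j]? = l[tau l]?}

/-- Removal of the first completed loop. -/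
def eraseOne (l : List V) : List V := l.take (tauStar l + 1) ++ l.drop (tau l + 1)

/-- The loop removed by `eraseOne`, that is `(ω_{τ*}, …, ω_τ)`. -/
def removedLoop (l : List V) : List V := (l.drop (tauStar l)).take (tau l - tauStar l + 1)

theorem length_eraseOne_lt (l : List V) (h : ¬ l.Nodup) : (eraseOne l).length < l.length := by
  have hne : {i | i < l.length ∧ ∃ j < i, l[j]? = l[i]?}.Nonempty := by
    by_contra hcon
    rw [Set.not_nonempty_iff_eq_empty] at hcon
    apply h
    rw [List.nodup_iff_getElem?_ne_getElem?]
    intro i j hij hj heq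
    have : j ∈ {i | i < l.length ∧ ∃ j < i, l[j]? = l[i]?} := ⟨hj, i, hij, heq⟩
    rw [hcon] at this
    exact this
  obtain ⟨h1, j, hj, hjeq⟩ := Nat.sInf_mem hne
  change tau l < l.length at h1
  change j < tau l at hj
  have h2 : tauStar l ≤ j := Nat.sInf_le hjeq
  simp only [eraseOne, List.length_append, List.length_take, List.length_drop]
  omega

open scoped Classical in
/-- The loops removed, in order, when single loop erasure is applied until the walk is
self-avoiding. -/
def removedLoops (l : List V) : List (List V) :=
  if h : l.Nodup then [] else removedLoop l :: removedLoops (eraseOne l)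
termination_by l.length
decreasing_by exact length_eraseOne_lt l h

end LoopErasure

section Model

variable {d : ℕ}

/-- The loop vector: the number of times `η` is removed in the loop erasure of `ω`. -/
def loopVector (ω : Walk d) (η : SAP d) : ℕ := (removedLoops ω.verts).count η.1.verts

/-- The weight `z^{|ω|} ∏_η λ_η^{n_L^η(ω)}`; all but finitely many factors are `1`. -/
def weight (lam : SAP d → ℝ) (z : ℝ) (ω : Walk d) : ℝ :=
  z ^ ω.length * ∏ᶠ η : SAP d, lam η ^ loopVector ω η

/-- Invariance of the loop activities under the isometries of `ℤ^d`, and under a change of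
the initial vertex and of the orientation of a polygon. (A closed walk `(v₀, v₁, …, vₙ = v₀)`
is determined as a cyclic object by the cyclic sequence `v₁, …, vₙ`.) -/
def SymmetricActivities (lam : SAP d → ℝ) : Prop :=
  (∀ R : Site d ≃ Site d, (∀ x y, dist1 (R x) (R y) = dist1 x y) →
    ∀ η η' : SAP d, η'.1.verts = η.1.verts.map R → lam η' = lam η) ∧
  ∀ η η' : SAP d,
    (η'.1.verts.tail.IsRotated η.1.verts.tail ∨
      η'.1.verts.tail.IsRotated η.1.verts.tail.reverse) → lam η' = lam η

/-- The susceptibility `χ_λ(z)`, a series of nonnegative terms, is finite. -/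
def FiniteSusceptibility (lam : SAP d → ℝ) (z : ℝ) : Prop :=
  Summable fun ω : {ω : Walk d // ω.start = 0} => weight lam z ω.1

/-- The two-point function `G_{λ,z}(x, y)`. -/
def twoPoint (lam : SAP d → ℝ) (z : ℝ) (x y : Site d) : ℝ :=
  ∑' ω : WalkBetween x y, weight lam z ω.1

/-! ### The gas of closed walks -/

/-- The set `𝒳` of closed walks with at least one step. -/
abbrev Loop (d : ℕ) := {X : Walk d // X.Closed ∧ 1 ≤ X.length}

open scoped Classical in
/-- The summand of the loop measure `μ_{λ,z}(A; B)`. -/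
def loopMeasureTerm (lam : SAP d → ℝ) (z : ℝ) (A B : Set (Site d)) (X : Loop d) : ℝ :=
  if (X.1.range ∩ A).Nonempty ∧ X.1.range ∩ B = ∅ then weight lam z X.1 / X.1.length else 0

/-- The loop measure `μ_{λ,z}(A; B)`. -/
def loopMeasure (lam : SAP d → ℝ) (z : ℝ) (A B : Set (Site d)) : ℝ :=
  ∑' X : Loop d, loopMeasureTerm lam z A B X

/-- `α_X = exp (w_{λ,z}(X) / |X|) - 1`. -/
def act (lam : SAP d → ℝ) (z : ℝ) (X : Loop d) : ℝ :=
  Real.exp (weight lam z X.1 / X.1.length) - 1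

/-- `α₀`, the product of `1 + α_X` over the `X` through the origin. -/
def alphaZero (lam : SAP d → ℝ) (z : ℝ) : ℝ :=
  ∏' X : {X : Loop d // 0 ∈ X.1.range}, (1 + act lam z X.1)

/-- `α`, the product of `1 + α_X` over the `X` through the origin that avoid `y`. -/
def alphaOne (lam : SAP d → ℝ) (z : ℝ) (y : Site d) : ℝ :=
  ∏' X : {X : Loop d // 0 ∈ X.1.range ∧ y ∉ X.1.range}, (1 + act lam z X.1)

open scoped Classical in
/-- `c_n(0, x)`: self-avoiding walks weighted by the loops that they meet. -/
def sawCount (lam : SAP d → ℝ) (z : ℝ) (n : ℕ) (x : Site d) : ℝ :=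
  ∑' ω : WalkOfLength n (0 : Site d) x,
    if ω.1.SelfAvoiding then
      ∏' X : Loop d, (if (X.1.range ∩ ω.1.range).Nonempty then 1 + act lam z X else 1)
    else 0

end Model

/-! ### Laces -/

/-- All edges `st`, `s < t`, on `{0, …, m}`. An edge is represented as the pair `(s, t)`. -/
def edgesOn (m : ℕ) : Finset (ℕ × ℕ) :=
  (Finset.range (m + 1) ×ˢ Finset.range (m + 1)).filter fun e => e.1 < e.2

/-- Lace connectedness of a graph on `{0, …, m}`. -/
def LaceConnected (m : ℕ) (Γ : Finset (ℕ × ℕ)) : Prop :=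
  Γ ⊆ edgesOn m ∧ 1 < m ∧ (∀ j, 0 < j → j < m → ∃ e ∈ Γ, e.1 < j ∧ j < e.2) ∧
    (∃ j, (0, j) ∈ Γ) ∧ ∃ j, (j, m) ∈ Γ

/-- A lace on `{0, …, m}`: a minimally connected graph. -/
def IsLace (m : ℕ) (L : Finset (ℕ × ℕ)) : Prop :=
  LaceConnected m L ∧ ∀ e ∈ L, ¬ LaceConnected m (L.erase e)

open scoped Classical in
/-- The laces on `{0, …, m}` with `N` edges. -/
def laces (N m : ℕ) : Finset (Finset (ℕ × ℕ)) :=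
  (edgesOn m).powerset.filter fun L => IsLace m L ∧ L.card = N

/-- The right endpoints selected by the lace algorithm:
`t₁ = max {v : 0v ∈ Γ}`, `t_{i+1} = max {v : ∃ s < t_i, sv ∈ Γ}` (indexed from zero here). -/
def laceRight (Γ : Finset (ℕ × ℕ)) : ℕ → ℕ
  | 0 => (Γ.filter fun e => e.1 = 0).sup Prod.snd
  | i + 1 => (Γ.filter fun e => e.1 < laceRight Γ i).sup Prod.snd

/-- The left endpoints selected by the lace algorithm:
`s₁ = 0`, `s_{i+1} = min {s : s t_{i+1} ∈ Γ}` (indexed from zero here). -/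
def laceLeft (Γ : Finset (ℕ × ℕ)) : ℕ → ℕ
  | 0 => 0
  | i + 1 => sInf {s | (s, laceRight Γ (i + 1)) ∈ Γ}

/-- The lace associated to a connected graph `Γ` on `{0, …, m}`: the edges `s_i t_i`, up to
the first one with `t_i = m`. (The `t_i` increase strictly until then, so at most `m` edges are
selected.) -/
def laceOf (m : ℕ) (Γ : Finset (ℕ × ℕ)) : Finset (ℕ × ℕ) :=
  ((Finset.range m).filter fun i => ∀ j < i, laceRight Γ j ≠ m).image
    fun i => (laceLeft Γ i, laceRight Γ i)

/-- The edges compatible with the lace `L` on `{0, …, m}`: those outside `L` whose addition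
to `L` does not change the associated lace. -/
def compatible (m : ℕ) (L : Finset (ℕ × ℕ)) : Finset (ℕ × ℕ) :=
  (edgesOn m).filter fun e => e ∉ L ∧ laceOf m (insert e L) = L

/-! ### Hyperedges and lace expansion coefficients -/

section Expansion

variable {d : ℕ}

/-- Pairs `(J, X)` with `X ∈ 𝒳 ∪ {∅}`; `none` stands for `∅`. -/
abbrev HyperPair (d : ℕ) := Finset ℕ × Option (Loop d)

/-- `(J, X)` is a hyperedge on `{0, …, m}`: `J` is a nonempty subset of `{0, …, m}`, with two
elements if `X = ∅` (a timelike hyperedge). -/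
def IsHyperedge (m : ℕ) (h : HyperPair d) : Prop :=
  h.1 ⊆ Finset.range (m + 1) ∧ h.1.Nonempty ∧ (h.2 = none → h.1.card = 2)

/-- The span `(min J, max J)`. -/
def hyperSpan (h : HyperPair d) : ℕ × ℕ := (sInf (h.1 : Set ℕ), sSup (h.1 : Set ℕ))

open scoped Classical in
/-- The hyperedge weights `F_{J,X}(ω)`. -/
def hyperWeight (lam : SAP d → ℝ) (z : ℝ) (ω : Walk d) : HyperPair d → ℝ
  | (J, some X) =>
      (if Odd J.card then act lam z X else -(act lam z X / (1 + act lam z X))) *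
        (if ∀ j ∈ J, ω.vert j ∈ X.1.range then 1 else 0)
  | (J, none) => -(if ∀ s ∈ J, ∀ t ∈ J, ω.vert s = ω.vert t then 1 else 0)

open scoped Classical in
/-- The interaction `I^ω(s, t)` carried by a lace edge `st`. -/
def laceInteraction (lam : SAP d → ℝ) (z : ℝ) (ω : Walk d) (s t : ℕ) : ℝ :=
  if ω.vert s = ω.vert t then 1
  else 1 - ∏' X : Loop d, (1 - act lam z X / (1 + act lam z X) *
    (if ω.vert s ∈ X.1.range ∧ ω.vert t ∈ X.1.range ∧
      (∀ j, s < j → j < t → ω.vert j ∉ X.1.range) then 1 else 0))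

/-- The coefficient `π_m^{(N)}(x)`. There are no laces on `{0, …, m}` if `m < 2`. -/
def piN (lam : SAP d → ℝ) (z : ℝ) (N m : ℕ) (x : Site d) : ℝ :=
  z ^ m * (alphaZero lam z)⁻¹ *
    ∑' ω : WalkOfLength m (0 : Site d) x, ∑ L ∈ laces N m,
      (∏ e ∈ L, laceInteraction lam z ω.1 e.1 e.2) *
      (∏' h : {h : HyperPair d // IsHyperedge m h ∧ hyperSpan h ∈ compatible m L},
        (1 + hyperWeight lam z ω.1 h.1)) *
      ∏' p : Fin (m + 1) × Loop d, (1 + hyperWeight lam z ω.1 ({(p.1 : ℕ)}, some p.2))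

/-- `π_m(x) = ∑_{N ≥ 1} (-1)^N π_m^{(N)}(x)`; a lace on `{0, …, m}` has at most `m` edges. -/
def piCoeff (lam : SAP d → ℝ) (z : ℝ) (m : ℕ) (x : Site d) : ℝ :=
  ∑ N ∈ Finset.Icc 1 m, (-1) ^ N * piN lam z N m x

/-- `Π_{λ,z}(x) = ∑_m π_m(x)`. -/
def bigPi (lam : SAP d → ℝ) (z : ℝ) (x : Site d) : ℝ := ∑' m : ℕ, piCoeff lam z m x

/-- The series defining `Π̂_{λ,z}` converges absolutely. -/
def PiConverges (lam : SAP d → ℝ) (z : ℝ) : Prop :=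
  Summable fun p : ℕ × Site d => |piCoeff lam z p.1 p.2|

/-! ### Fourier transform -/

/-- `f̂(k) = ∑_x e^{i k·x} f(x)`. -/
def latticeFourier (f : Site d → ℝ) (k : Fin d → ℝ) : ℂ :=
  ∑' x : Site d, Complex.exp (Complex.I * ((∑ i, k i * (x i : ℝ) : ℝ) : ℂ)) * (f x : ℂ)

open scoped Classical in
/-- The single step distribution `D(x) = |Ω|⁻¹ 1{x ∼ 0}`, with `|Ω| = 2d`. -/
def stepDist (x : Site d) : ℝ := if Adj x 0 then (2 * (d : ℝ))⁻¹ else 0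

/-- `1 - z α |Ω| D̂(k) - Π̂_{λ,z}(k)`. -/
def laceDenominator (lam : SAP d → ℝ) (z : ℝ) (y : Site d) (k : Fin d → ℝ) : ℂ :=
  1 - z * alphaOne lam z y * (2 * d) * latticeFourier stepDist k - latticeFourier (bigPi lam z) k

end Expansion

end LWW

end

open LWW

/-! There are two independent mechanisms: walks are resummed over their erased loops into a gas of
closed walks, and the resulting weights on self-avoiding walks are treated by a lace expansion.

Resummation. Group the walks in a domain `T` by their loop erasure. A walk from `v` is a string of
first return loops at `v` followed by a part that avoids `v`. At a first return the removed polygon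
depends only on the loop erasure of the excursion (`loopErase_first_return`), so weights factorise,
and the walks with loop erasure `v :: σ` have total weight `z G_T(v)` times that of the walks in `T
\ {v}` with loop erasure `σ`. Here `G_T(v)` is the weight of the closed walks at `v` in `T`,
including the trivial one. For finite `S` this gives `G_S(v) = Z(S \ v) / Z(S)`
(`erasureSum_mul_gasZ`), where `Z` is the partition function of disjoint polygons with activities of
negative sign. The activities ignore the root, so the recursion for `Z` may start at any vertex.
Counting covered vertices gives `z Z' = ∑_u (Z(S) - Z(S \ u))`, so the closed walks in `S` with at
least one step have total weight `-z Z' / Z`. Integrating against `dz / z` turns `w(X)` into `w(X) /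
|X|`: the loop measure of `S` is `-log Z(S)`. Hence `log G_S(v)` is the measure of the loops in `S`
through `v`. Exhausting `T` by finite sets and stripping `σ` vertex by vertex gives
`erasureSum_eq_exp`, from which the formula for `G` in terms of `c_n` follows.

Lace expansion. A closed walk that meets a path has one more visit than it has pairs of consecutive
visits. Thus the weight of a self-avoiding path is `α₀ ^ (n+1) ∏ (1 - I(s,t))` over pairs
(`prod_pairFactor`), and the product vanishes on the other paths. Expanding over graphs, cutting at
the first uncovered point (`prod_edgesOn_eq`) and resumming covering graphs into laces
(`sum_connectedGraphs`) gives a renewal equation. Inclusion-exclusion over interior points shows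
that the hyperedges of span `st` together contribute `1 - I(s,t)` (`prod_setFactor`), which
identifies the kernel with `π_m` for `m ≥ 2`; for `m = 1` it is `zα` on each neighbour. The equation
lives in the group algebra of `ℤ^d`, on which the Fourier transform is an algebra homomorphism,
whence the power series identity. Under absolute convergence it may be evaluated at `t = 1`, and `α₀
≠ 0` excludes zeros of the denominator.

For small `z` the weights are dominated by a geometric series, so `χ < 2`. As `α₀ ≥ 1`, the renewal
equation can then be inverted in `ℓ¹`, which bounds `π`. -/

noncomputable section

namespace LWW

/-! ### Chronological loop erasure of lists -/

section LoopErasureTheory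

variable {V : Type*}

/-- The first completed loop is decided by a prefix, so induction is from the right: a new last
vertex either closes the first loop or only lengthens `r`. This normal form replaces the times `tau`
and `tauStar` from here on. -/
theorem exists_first_loop {l : List V} (h : ¬ l.Nodup) :
    ∃ p x q r, l = p ++ x :: q ++ x :: r ∧ (p ++ x :: q).Nodup := by
  induction l using List.reverseRecOn with
  | nil => simp at h
  | append_singleton l a ih =>
    by_cases hl : l.Nodup
    · have ha : a ∈ l := by
        by_contra ha
        exact h (by rw [List.nodup_append]; simp [hl]; rintro b hb rfl; exact ha hb)
      obtain ⟨p, q, rfl⟩ := List.append_of_mem ha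
      exact ⟨p, a, q, [], by simp, hl⟩
    · obtain ⟨p, x, q, r, rfl, hn⟩ := ih hl
      exact ⟨p, x, q, r ++ [a], by simp, hn⟩

theorem tau_decomp {p q r : List V} {x : V} (h : (p ++ x :: q).Nodup) :
    tau (p ++ x :: q ++ x :: r) = p.length + q.length + 1 := by
  have hlen : (p ++ x :: q).length = p.length + q.length + 1 := by simp; omega
  have hx : (p ++ x :: q ++ x :: r)[p.length + q.length + 1]? = some x := by
    rw [List.getElem?_append_right (by omega), hlen]; simp
  have hx' : (p ++ x :: q ++ x :: r)[p.length]? = some x := by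
    simp
  apply le_antisymm
  · apply Nat.sInf_le
    refine ⟨by simp; omega, p.length, by omega, ?_⟩
    rw [hx, hx']
  · apply le_csInf
    · exact ⟨p.length + q.length + 1, by simp; omega, p.length, by omega, by rw [hx, hx']⟩
    · rintro i ⟨hi, j, hj, hij⟩
      by_contra hlt
      push Not at hlt
      rw [List.getElem?_append_left (l₁ := p ++ x :: q) (by omega),
        List.getElem?_append_left (l₁ := p ++ x :: q) (by omega)] at hij
      exact (List.nodup_iff_getElem?_ne_getElem?.1 h) j i hj (by omega) hij

theorem tauStar_decomp {p q r : List V} {x : V} (h : (p ++ x :: q).Nodup) :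
    tauStar (p ++ x :: q ++ x :: r) = p.length := by
  have hlen : (p ++ x :: q).length = p.length + q.length + 1 := by simp; omega
  have hx : (p ++ x :: q ++ x :: r)[p.length + q.length + 1]? = some x := by
    rw [List.getElem?_append_right (by omega), hlen]; simp
  have hx' : (p ++ x :: q ++ x :: r)[p.length]? = some x := by
    simp
  have hx'' : (p ++ x :: q)[p.length]? = some x := by
    simp
  unfold tauStar
  rw [tau_decomp h, hx]
  apply le_antisymm
  · exact Nat.sInf_le hx'
  · refine le_csInf ⟨_, hx'⟩ fun j hj => ?_
    by_contra hlt
    push Not at hlt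
    rw [Set.mem_ofPred_eq, List.getElem?_append_left (by omega), ← hx''] at hj
    exact (List.nodup_iff_getElem?_ne_getElem?.1 h) j p.length hlt (by omega) hj

theorem eraseOne_decomp {p q r : List V} {x : V} (h : (p ++ x :: q).Nodup) :
    eraseOne (p ++ x :: q ++ x :: r) = p ++ x :: r := by
  unfold eraseOne
  rw [tau_decomp h, tauStar_decomp h]
  have h1 : (p ++ x :: q ++ x :: r).take (p.length + 1) = p ++ [x] := by
    rw [show p ++ x :: q ++ x :: r = (p ++ [x]) ++ (q ++ x :: r) by simp]
    exact List.take_left' (by simp)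
  have h2 : (p ++ x :: q ++ x :: r).drop (p.length + q.length + 1 + 1) = r := by
    rw [show p ++ x :: q ++ x :: r = (p ++ x :: q ++ [x]) ++ r by simp]
    exact List.drop_left' (by simp; omega)
  rw [h1, h2]; simp

theorem removedLoop_decomp {p q r : List V} {x : V} (h : (p ++ x :: q).Nodup) :
    removedLoop (p ++ x :: q ++ x :: r) = x :: q ++ [x] := by
  unfold removedLoop
  rw [tau_decomp h, tauStar_decomp h]
  have h1 : (p ++ x :: q ++ x :: r).drop p.length = (x :: q ++ [x]) ++ r := by
    rw [show p ++ x :: q ++ x :: r = p ++ ((x :: q ++ [x]) ++ r) by simp]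
    exact List.drop_left' rfl
  rw [h1]
  exact List.take_left' (by simp; omega)

theorem not_nodup_decomp {p q r : List V} {x : V} : ¬ (p ++ x :: q ++ x :: r).Nodup := by
  simp [List.nodup_append]

open scoped Classical in
/-- The chronological loop erasure of a walk. -/
def loopErase (l : List V) : List V :=
  if h : l.Nodup then l else loopErase (eraseOne l)
termination_by l.length
decreasing_by exact length_eraseOne_lt l h

theorem loopErase_of_nodup {l : List V} (h : l.Nodup) : loopErase l = l := by
  rw [loopErase, dif_pos h]

theorem removedLoops_of_nodup {l : List V} (h : l.Nodup) : removedLoops l = [] := by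
  rw [removedLoops, dif_pos h]

theorem loopErase_decomp {p q r : List V} {x : V} (h : (p ++ x :: q).Nodup) :
    loopErase (p ++ x :: q ++ x :: r) = loopErase (p ++ x :: r) := by
  rw [loopErase, dif_neg not_nodup_decomp, eraseOne_decomp h]

theorem removedLoops_decomp {p q r : List V} {x : V} (h : (p ++ x :: q).Nodup) :
    removedLoops (p ++ x :: q ++ x :: r) = (x :: q ++ [x]) :: removedLoops (p ++ x :: r) := by
  rw [removedLoops, dif_neg not_nodup_decomp, eraseOne_decomp h, removedLoop_decomp h]

/-- Induction along the removal of the first completed loop. -/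
theorem loop_induction {P : List V → Prop} (hnodup : ∀ l : List V, l.Nodup → P l)
    (hloop : ∀ p x q r, (p ++ x :: q).Nodup → P (p ++ x :: r) → P (p ++ x :: q ++ x :: r))
    (l : List V) : P l := by
  induction hn : l.length using Nat.strong_induction_on generalizing l with
  | _ n ih =>
    by_cases h : l.Nodup
    · exact hnodup l h
    · obtain ⟨p, x, q, r, rfl, hpq⟩ := exists_first_loop h
      exact hloop p x q r hpq (ih _ (by rw [← hn]; simp) _ rfl)

theorem nodup_loopErase (l : List V) : (loopErase l).Nodup := by
  induction l using loop_induction with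
  | hnodup l h => rwa [loopErase_of_nodup h]
  | hloop p x q r h ih => rwa [loopErase_decomp h]

theorem loopErase_subset (l : List V) : loopErase l ⊆ l := by
  induction l using loop_induction with
  | hnodup l h => rw [loopErase_of_nodup h]; exact fun _ h => h
  | hloop p x q r h ih =>
    rw [loopErase_decomp h]
    intro a ha
    replace ha := ih ha
    simp only [List.mem_append, List.mem_cons] at ha ⊢
    tauto

theorem head?_loopErase (l : List V) : (loopErase l).head? = l.head? := by
  induction l using loop_induction with
  | hnodup l h => rw [loopErase_of_nodup h]
  | hloop p x q r h ih =>
    rw [loopErase_decomp h, ih]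
    cases p <;> simp

theorem getLast?_loopErase (l : List V) : (loopErase l).getLast? = l.getLast? := by
  induction l using loop_induction with
  | hnodup l h => rw [loopErase_of_nodup h]
  | hloop p x q r h ih =>
    rw [loopErase_decomp h, ih, List.getLast?_append, List.getLast?_append]
    simp [List.getLast?_cons]

theorem loopErase_eq_nil {l : List V} : loopErase l = [] ↔ l = [] := by
  rw [← List.head?_eq_none_iff, head?_loopErase, List.head?_eq_none_iff]

theorem isChain_loopErase {R : V → V → Prop} {l : List V} (hl : l.IsChain R) :
    (loopErase l).IsChain R := by
  induction l using loop_induction with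
  | hnodup l h => rwa [loopErase_of_nodup h]
  | hloop p x q r h ih =>
    rw [loopErase_decomp h]
    apply ih
    rw [List.append_assoc, List.isChain_append] at hl
    rw [List.isChain_append]
    refine ⟨hl.1, ?_, ?_⟩
    · exact hl.2.1.suffix ⟨x :: q, by simp⟩
    · intro a ha b hb
      exact hl.2.2 a ha b (by simpa using hb)

/-- A first vertex that is never revisited takes part in no loop. -/
theorem loopErase_cons_of_notMem {v : V} {m : List V} (h : v ∉ m) :
    loopErase (v :: m) = v :: loopErase m ∧ removedLoops (v :: m) = removedLoops m := by
  induction m using loop_induction with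
  | hnodup l hl =>
    have : (v :: l).Nodup := List.nodup_cons.2 ⟨h, hl⟩
    simp [loopErase_of_nodup, removedLoops_of_nodup, this, hl]
  | hloop p x q r hpq ih =>
    have h1 : ((v :: p) ++ x :: q).Nodup := by
      rw [List.cons_append, List.nodup_cons]
      exact ⟨fun hv => h (List.mem_append_left _ hv), hpq⟩
    have ih := ih (by simp at h ⊢; tauto)
    have h2 := loopErase_decomp (r := r) h1
    have h3 := removedLoops_decomp (r := r) h1
    have h4 := loopErase_decomp (r := r) hpq
    have h5 := removedLoops_decomp (r := r) hpq
    simp only [List.cons_append] at h2 h3 ih h4 h5 ⊢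
    rw [h2, h3, h4, h5, ih.1, ih.2]
    exact ⟨rfl, rfl⟩

/-- Until the return, `v` is inert and the loops of `m` are removed as if `m` stood alone. The
return then closes a polygon through what is left of `m`, and the process restarts from `v`. All
factorisation of weights rests on this. -/
theorem loopErase_first_return {v : V} {m : List V} (n : List V) (h : v ∉ m) :
    loopErase (v :: m ++ v :: n) = loopErase (v :: n) ∧
    removedLoops (v :: m ++ v :: n) =
      removedLoops m ++ (v :: loopErase m ++ [v]) :: removedLoops (v :: n) := by
  induction m using loop_induction with
  | hnodup l hl =>
    have h1 : ([] ++ v :: l).Nodup := List.nodup_cons.2 ⟨h, hl⟩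
    have h2 := loopErase_decomp (r := n) h1
    have h3 := removedLoops_decomp (r := n) h1
    simp only [List.nil_append] at h2 h3
    rw [h2, h3, loopErase_of_nodup hl, removedLoops_of_nodup hl]
    simp
  | hloop p x q r hpq ih =>
    have h1 : ((v :: p) ++ x :: q).Nodup := by
      rw [List.cons_append, List.nodup_cons]
      exact ⟨fun hv => h (List.mem_append_left _ hv), hpq⟩
    have ih := ih (by simp at h ⊢; tauto)
    have h2 := loopErase_decomp (r := r ++ v :: n) h1
    have h3 := removedLoops_decomp (r := r ++ v :: n) h1
    have h4 := loopErase_decomp (r := r) hpq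
    have h5 := removedLoops_decomp (r := r) hpq
    simp only [List.cons_append, List.append_assoc] at h2 h3 ih h4 h5 ⊢
    rw [h2, h3, h4, h5, ih.1, ih.2]
    exact ⟨rfl, rfl⟩

theorem removedLoops_map {W : Type*} {f : V → W} (hf : Function.Injective f) (l : List V) :
    removedLoops (l.map f) = (removedLoops l).map (List.map f) := by
  induction l using loop_induction with
  | hnodup l h =>
    rw [removedLoops_of_nodup h, removedLoops_of_nodup (h.map hf)]; rfl
  | hloop p x q r h ih =>
    have h1 : (p.map f ++ f x :: q.map f).Nodup := by
      have := h.map hf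
      simpa using this
    have h2 := removedLoops_decomp (r := r.map f) h1
    have h3 : List.map f (p ++ x :: q ++ x :: r) = p.map f ++ f x :: q.map f ++ f x :: r.map f := by
      simp
    rw [h3, h2, removedLoops_decomp h]
    simp only [List.map_append, List.map_cons] at ih
    rw [ih]
    simp

/-- Every removed loop is a closed walk whose only coincidence is that of its endpoints. -/
theorem exists_of_mem_removedLoops {R : V → V → Prop} {l : List V} (hl : l.IsChain R)
    {c : List V} (hc : c ∈ removedLoops l) :
    ∃ x q, c = x :: q ++ [x] ∧ (x :: q).Nodup ∧ c.IsChain R := by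
  induction l using loop_induction with
  | hnodup l h => simp [removedLoops_of_nodup h] at hc
  | hloop p x q r h ih =>
    rw [removedLoops_decomp h, List.mem_cons] at hc
    rcases hc with rfl | hc
    · refine ⟨x, q, rfl, (List.nodup_append.1 h).2.1, ?_⟩
      exact hl.infix ⟨p, r, by simp⟩
    · refine ih ?_ hc
      rw [List.append_assoc, List.isChain_append] at hl
      rw [List.isChain_append]
      refine ⟨hl.1, ?_, ?_⟩
      · exact hl.2.1.suffix ⟨x :: q, by simp⟩
      · intro a ha b hb
        exact hl.2.2 a ha b (by simpa using hb)

/-- Each removal deletes at least one vertex and never empties the list, so a walk loses at most as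
many loops as it has steps. -/
theorem length_removedLoops_lt {l : List V} (hl : l ≠ []) :
    (removedLoops l).length < l.length := by
  induction l using loop_induction with
  | hnodup l h => simpa [removedLoops_of_nodup h, List.length_pos_iff] using hl
  | hloop p x q r h ih =>
    rw [removedLoops_decomp h]
    have := ih (by simp)
    simp only [List.length_append, List.length_cons] at this ⊢
    omega

end LoopErasureTheory

end LWW

end

noncomputable section

namespace LWW

/-! ### Total weight of the walks with a given loop erasure -/

section ErasureSums

open scoped ENNReal NNReal Classical

variable {V : Type*} (R : V → V → Prop) (lam : List V → ℝ≥0) (z : ℝ≥0)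

/-- The product of the activities of the loops removed from `l`. -/
def loopFactor (l : List V) : ℝ≥0 := ((removedLoops l).map lam).prod

/-- The weight of a list, which vanishes unless the list is a walk. -/
def chainWeight (l : List V) : ℝ≥0 :=
  if l.IsChain R ∧ l ≠ [] then z ^ (l.length - 1) * loopFactor lam l else 0

/-- The summand of `erasureSum`. -/
def erasureTerm (T : Set V) (σ l : List V) : ℝ≥0∞ :=
  if loopErase l = σ ∧ ∀ x ∈ l, x ∈ T then (chainWeight R lam z l : ℝ≥0∞) else 0

/-- The total weight of the walks in `T` whose loop erasure is `σ`. -/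
def erasureSum (T : Set V) (σ : List V) : ℝ≥0∞ := ∑' l, erasureTerm R lam z T σ l

/-- The weight carried by the steps from and to `v`, and by the removed polygon, of a walk that
returns to `v` once, when the part between is `σ` after loop erasure. -/
def returnFactor (v : V) (σ : List V) : ℝ≥0 :=
  if (v :: σ ++ [v]).IsChain R then z ^ 2 * lam (v :: σ ++ [v]) else 0

/-- The total weight of the first return loops at `v` in `T`. -/
def returnSum (T : Set V) (v : V) : ℝ≥0∞ :=
  ∑' σ, (returnFactor R lam z v σ : ℝ≥0∞) * erasureSum R lam z (T \ {v}) σ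

/-- Every list containing `v` is cut uniquely at its first occurrence of `v`. -/
theorem tsum_list_split (v : V) (h : List V → ℝ≥0∞) :
    ∑' m, h m = (∑' m, if v ∉ m then h m else 0) +
      ∑' m₁, ∑' m₂, if v ∉ m₁ then h (m₁ ++ v :: m₂) else 0 := by
  have h1 : ∀ m, h m = (if v ∉ m then h m else 0) + (if v ∈ m then h m else 0) := by
    intro m; by_cases hm : v ∈ m <;> simp [hm]
  rw [tsum_congr h1, ENNReal.tsum_add]
  congr 1
  rw [← ENNReal.tsum_prod (f := fun m₁ m₂ => if v ∉ m₁ then h (m₁ ++ v :: m₂) else 0)]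
  let g : {p : List V × List V // v ∉ p.1} → List V := fun p => p.1.1 ++ v :: p.1.2
  have hg : Function.Injective g := by
    rintro ⟨⟨a, b⟩, ha⟩ ⟨⟨a', b'⟩, ha'⟩ hab
    simp only [g] at hab ha ha'
    have := (List.append_eq_append_iff).1 hab
    rcases this with ⟨c, hc, hc'⟩ | ⟨c, hc, hc'⟩
    · cases c with
      | nil => simp at hc hc'; simp [hc, hc']
      | cons x c => simp at hc'; subst hc; simp [hc'.1] at ha'
    · cases c with
      | nil => simp at hc hc'; simp [hc, hc']
      | cons x c => simp at hc'; subst hc; simp [hc'.1] at ha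
  rw [← hg.tsum_eq]
  · rw [← tsum_subtype_eq_of_support_subset (s := {p : List V × List V | v ∉ p.1})]
    · apply tsum_congr
      rintro ⟨p, hp⟩
      have hp' : v ∉ p.1 := hp
      simp [g, hp']
    · intro p hp
      by_contra hcon
      have : v ∈ p.1 := by simpa using hcon
      simp [this] at hp
  · intro m hm
    have hv : v ∈ m := by
      by_contra hv; simp [hv] at hm
    obtain ⟨a, b, rfl, ha⟩ := List.eq_append_cons_of_mem hv
    exact ⟨⟨(a, b), ha⟩, rfl⟩

variable {R lam z}

theorem loopFactor_cons_of_notMem {v : V} {m : List V} (h : v ∉ m) :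
    loopFactor lam (v :: m) = loopFactor lam m := by
  rw [loopFactor, (loopErase_cons_of_notMem h).2, loopFactor]

theorem loopFactor_first_return {v : V} {m : List V} (n : List V) (h : v ∉ m) :
    loopFactor lam (v :: m ++ v :: n) =
      loopFactor lam m * lam (v :: loopErase m ++ [v]) * loopFactor lam (v :: n) := by
  rw [loopFactor, (loopErase_first_return n h).2, loopFactor, loopFactor]
  simp [mul_assoc]

/-- Loop erasure preserves both end vertices, the only ones that have to be adjacent to `v`. -/
theorem chain_return_iff {v : V} {m : List V} (hm : m.IsChain R) :
    (v :: loopErase m ++ [v]).IsChain R ↔ (v :: m ++ [v]).IsChain R := by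
  rw [List.isChain_append, List.isChain_append, List.isChain_cons, List.isChain_cons,
    head?_loopErase, List.getLast?_cons, List.getLast?_cons, getLast?_loopErase]
  rw [List.isChain_cons (l := m)]
  simp only [isChain_loopErase hm, hm, and_true]

theorem erasureTerm_first_return (hR : ∀ v, ¬ R v v) (T : Set V) {v : V} (hv : v ∈ T)
    {m : List V} (n σ : List V) (h : v ∉ m) :
    erasureTerm R lam z T σ (v :: (m ++ v :: n)) =
      (returnFactor R lam z v (loopErase m) : ℝ≥0∞) *
        erasureTerm R lam z (T \ {v}) (loopErase m) m * erasureTerm R lam z T σ (v :: n) := by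
  have h1 := (loopErase_first_return n h).1
  have h2 := loopFactor_first_return (lam := lam) n h
  simp only [List.cons_append] at h1 h2
  -- An immediate return from `v` to `v` is not a step, since `R` is irreflexive; for the rest, `m ≠
  -- []` makes the truncated `m.length - 1` a true count of steps.
  by_cases hn : m = []
  · subst hn
    have : ¬ (v :: ([] ++ v :: n)).IsChain R := by simp [hR]
    simp [erasureTerm, returnFactor, chainWeight, hR, loopErase_of_nodup]
  by_cases hc : (v :: (m ++ v :: n)).IsChain R
  swap
  · have : ¬ ((v :: m ++ [v]).IsChain R ∧ (v :: n).IsChain R ∧ m.IsChain R) := by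
      rintro ⟨ha, hb, -⟩
      apply hc
      have := ha.append_overlap (l₂ := [v]) (l₃ := n) (by simpa using hb) (by simp)
      simpa using this
    have hL : erasureTerm R lam z T σ (v :: (m ++ v :: n)) = 0 := by
      simp [erasureTerm, chainWeight, hc]
    rw [hL]
    by_cases hb : (v :: n).IsChain R
    · by_cases hm : m.IsChain R
      · have : ¬ (v :: loopErase m ++ [v]).IsChain R := by
          rw [chain_return_iff hm]; tauto
        rw [returnFactor, if_neg this]; simp
      · simp [erasureTerm, chainWeight, hm]
    · simp [erasureTerm, chainWeight, hb]
  · have hm : m.IsChain R := hc.infix ⟨[v], v :: n, by simp⟩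
    have hb : (v :: n).IsChain R := hc.suffix ⟨v :: m, by simp⟩
    have ha : (v :: m ++ [v]).IsChain R := hc.infix ⟨[], n, by simp⟩
    have hE : (v :: loopErase m ++ [v]).IsChain R := (chain_return_iff hm).2 ha
    simp only [erasureTerm, chainWeight, returnFactor, hc, hm, hb, hE, h1, h2]
    have h3 : (∀ x ∈ v :: (m ++ v :: n), x ∈ T) ↔
        ((∀ x ∈ m, x ∈ T \ {v}) ∧ ∀ x ∈ v :: n, x ∈ T) := by
      constructor
      · intro H
        refine ⟨fun x hx => ⟨H x (by simp [hx]), ?_⟩, fun x hx => H x (by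
          simp only [List.mem_cons, List.mem_append] at hx ⊢; tauto)⟩
        rintro rfl
        exact h hx
      · rintro ⟨H1, H2⟩ x hx
        simp only [List.mem_cons, List.mem_append] at hx H2
        rcases hx with rfl | hx | hx | hx
        · exact hv
        · exact (H1 x hx).1
        · exact H2 _ (Or.inl hx)
        · exact H2 _ (Or.inr hx)
    simp only [h3]
    by_cases hA : loopErase (v :: n) = σ
    · by_cases hB : ∀ x ∈ m, x ∈ T \ {v}
      · by_cases hC : ∀ x ∈ v :: n, x ∈ T
        · rw [if_pos ⟨hA, hB, hC⟩, if_pos (c := True ∧ ∀ x ∈ m, x ∈ T \ {v}) ⟨trivial, hB⟩,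
            if_pos (c := loopErase (v :: n) = σ ∧ _) ⟨hA, hC⟩]
          obtain ⟨k, hk⟩ : ∃ k, m.length = k + 1 :=
            ⟨m.length - 1, by have := List.length_pos_iff.2 hn; omega⟩
          simp only [List.cons_append, ne_eq, hn, not_false_eq_true, and_self, if_true,
            reduceCtorEq, List.length_cons, List.length_append, hk]
          norm_cast
          rw [show k + 1 + (n.length + 1) + 1 - 1 = k + n.length + 2 by omega,
            Nat.add_sub_cancel, Nat.add_sub_cancel, pow_add, pow_add]
          ring
        · rw [if_neg (by tauto), if_neg (c := loopErase (v :: n) = σ ∧ _) (by tauto), mul_zero]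
      · rw [if_neg (by tauto), if_neg (c := True ∧ _) (by tauto), mul_zero, zero_mul]
    · rw [if_neg (by tauto), if_neg (c := loopErase (v :: n) = σ ∧ _) (by tauto), mul_zero]

/-- Renewal at the first vertex: a walk either never returns to `v`, or what remains after its first
return is again a walk from `v` with the same loop erasure. -/
theorem erasureSum_cons (hR : ∀ v, ¬ R v v) (T : Set V) {v : V} (hv : v ∈ T) (σ : List V) :
    erasureSum R lam z T (v :: σ) =
      (∑' m, if v ∉ m then erasureTerm R lam z T (v :: σ) (v :: m) else 0) +
        returnSum R lam z T v * erasureSum R lam z T (v :: σ) := by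
  have h0 : erasureSum R lam z T (v :: σ) = ∑' m, erasureTerm R lam z T (v :: σ) (v :: m) := by
    rw [erasureSum, ← (List.cons_injective (a := v)).tsum_eq]
    intro l hl
    have : loopErase l = v :: σ := by
      by_contra hne; simp [erasureTerm, hne] at hl
    have hh := head?_loopErase l
    rw [this] at hh
    cases l with
    | nil => simp at hh
    | cons a l => simp at hh; exact ⟨l, by rw [hh]⟩
  conv_lhs => rw [h0, tsum_list_split v]
  congr 1
  rw [returnSum, h0]
  have h1 : ∀ m₁ m₂, (if v ∉ m₁ then erasureTerm R lam z T (v :: σ) (v :: (m₁ ++ v :: m₂)) else 0)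
      = (returnFactor R lam z v (loopErase m₁) : ℝ≥0∞) *
        erasureTerm R lam z (T \ {v}) (loopErase m₁) m₁ *
          erasureTerm R lam z T (v :: σ) (v :: m₂) := by
    intro m₁ m₂
    by_cases h : v ∈ m₁
    · have : ¬ (∀ x ∈ m₁, x ∈ T \ {v}) := fun H => (H v h).2 rfl
      rw [if_neg (by tauto)]
      rw [erasureTerm, if_neg (c := loopErase m₁ = _ ∧ _) (by tauto), mul_zero, zero_mul]
    · rw [if_pos h, erasureTerm_first_return hR T hv _ _ h]
  simp only [h1, ENNReal.tsum_mul_left, ENNReal.tsum_mul_right]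
  congr 1
  -- Sorting the excursions by their loop erasure recovers `returnSum`; each list `m` is counted
  -- only for `σ = loopErase m`.
  simp only [erasureSum, ← ENNReal.tsum_mul_left]
  rw [ENNReal.tsum_comm]
  apply tsum_congr
  intro m
  rw [tsum_eq_single (loopErase m)]
  intro σ' hσ'
  rw [erasureTerm, if_neg (fun H => hσ' H.1.symm), mul_zero]

theorem erasureSum_singleton (hR : ∀ v, ¬ R v v) (T : Set V) {v : V} (hv : v ∈ T) :
    erasureSum R lam z T [v] = 1 + returnSum R lam z T v * erasureSum R lam z T [v] := by
  conv_lhs => rw [erasureSum_cons hR T hv]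
  congr 1
  rw [tsum_eq_single []]
  · simp [erasureTerm, chainWeight, loopErase_of_nodup, loopFactor, removedLoops_of_nodup, hv]
  · intro m hm
    by_cases h : v ∈ m
    · rw [if_neg (by tauto)]
    · rw [if_pos h, erasureTerm, if_neg]
      rw [(loopErase_cons_of_notMem h).1]
      simp [loopErase_eq_nil, hm]

/-- A walk that leaves `v` for good is one step followed by a walk in `T \ {v}`. The step is
admissible because that walk starts at the head of its loop erasure `σ`, which is adjacent to `v`.
-/
theorem erasureSum_cons_of_chain (hR : ∀ v, ¬ R v v) (T : Set V) {v : V} (hv : v ∈ T)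
    {σ : List V} (hσ : σ ≠ []) (hc : (v :: σ).IsChain R) :
    erasureSum R lam z T (v :: σ) = z * erasureSum R lam z (T \ {v}) σ +
      returnSum R lam z T v * erasureSum R lam z T (v :: σ) := by
  conv_lhs => rw [erasureSum_cons hR T hv]
  congr 1
  rw [erasureSum, ← ENNReal.tsum_mul_left]
  apply tsum_congr
  intro m
  by_cases h : v ∈ m
  · have : ¬ (∀ x ∈ m, x ∈ T \ {v}) := fun H => (H v h).2 rfl
    rw [if_neg (by tauto), erasureTerm, if_neg (by tauto), mul_zero]
  rw [if_pos h, erasureTerm, erasureTerm, (loopErase_cons_of_notMem h).1]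
  have h1 : (∀ x ∈ v :: m, x ∈ T) ↔ ∀ x ∈ m, x ∈ T \ {v} := by
    constructor
    · intro H x hx
      refine ⟨H x (by simp [hx]), ?_⟩
      rintro rfl; exact h hx
    · intro H x hx
      rcases List.mem_cons.1 hx with rfl | hx
      · exact hv
      · exact (H x hx).1
  simp only [h1]
  by_cases hA : loopErase m = σ
  swap
  · rw [if_neg (by simp [hA]), if_neg (by simp [hA]), mul_zero]
  by_cases hB : ∀ x ∈ m, x ∈ T \ {v}
  swap
  · rw [if_neg (by tauto), if_neg (by tauto), mul_zero]
  rw [if_pos ⟨by rw [hA], hB⟩, if_pos ⟨hA, hB⟩]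
  have hm : m ≠ [] := fun h0 => hσ (by rw [← hA, h0, loopErase_of_nodup List.nodup_nil])
  have h2 : (v :: m).IsChain R ↔ m.IsChain R := by
    rw [List.isChain_cons, ← head?_loopErase, hA]
    rw [List.isChain_cons] at hc
    exact ⟨fun H => H.2, fun H => ⟨hc.1, H⟩⟩
  unfold chainWeight
  simp only [h2, loopFactor_cons_of_notMem h]
  by_cases hC : m.IsChain R
  · obtain ⟨k, hk⟩ : ∃ k, m.length = k + 1 :=
      ⟨m.length - 1, by have := List.length_pos_iff.2 hm; omega⟩
    simp only [hC, hm, ne_eq, not_false_eq_true, and_self, if_true, reduceCtorEq,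
      List.length_cons, hk, Nat.add_sub_cancel]
    norm_cast
    rw [pow_succ]; ring
  · simp [hC]

theorem erasureSum_mono {T T' : Set V} (h : T ⊆ T') (σ : List V) :
    erasureSum R lam z T σ ≤ erasureSum R lam z T' σ := by
  apply ENNReal.tsum_le_tsum
  intro l
  unfold erasureTerm
  by_cases h1 : loopErase l = σ ∧ ∀ x ∈ l, x ∈ T
  · rw [if_pos h1, if_pos ⟨h1.1, fun x hx => h (h1.2 x hx)⟩]
  · rw [if_neg h1]; exact zero_le

theorem one_le_erasureSum_singleton {T : Set V} {v : V} (hv : v ∈ T) :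
    1 ≤ erasureSum R lam z T [v] := by
  refine le_trans ?_ (ENNReal.le_tsum [v])
  simp [erasureTerm, chainWeight, loopErase_of_nodup, loopFactor, removedLoops_of_nodup, hv]

/-- A solution of `n = a + f * n` is `g * a` when `g = 1 + f * g` is finite. -/
theorem eq_mul_of_renewal {n a f g : ℝ≥0∞} (hn : n ≠ ∞) (hg : g ≠ ∞) (h1 : n = a + f * n)
    (h2 : g = 1 + f * g) : n = g * a := by
  -- All four quantities must be finite before the linear system can be solved in `ℝ`: `f = ∞` would
  -- force `g = ∞`, and `a = ∞` would force `n = ∞`.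
  have hg0 : g ≠ 0 := by
    intro h; rw [h] at h2; simp at h2
  have hf : f ≠ ∞ := by
    rintro rfl
    rw [ENNReal.top_mul hg0] at h2
    simp at h2; exact hg h2
  have ha : a ≠ ∞ := by
    rintro rfl; rw [top_add] at h1; exact hn h1
  lift n to ℝ≥0 using hn
  lift g to ℝ≥0 using hg
  lift f to ℝ≥0 using hf
  lift a to ℝ≥0 using ha
  norm_cast at h1 h2 ⊢
  rw [← NNReal.coe_inj] at h1 h2 ⊢
  push_cast at h1 h2 ⊢
  linear_combination (-(n : ℝ)) * h2 + (g : ℝ) * h1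

/-- Solving the two renewal equations with the common factor `returnSum`. Iterated along `σ`, this
attaches to each vertex the closed walks in the domain not yet used up. -/
theorem erasureSum_cons_eq_mul (hR : ∀ v, ¬ R v v) {T : Set V} {v : V} (hv : v ∈ T)
    {σ : List V} (hσ : σ ≠ []) (hc : (v :: σ).IsChain R)
    (hfin : ∀ τ : List V, erasureSum R lam z T (v :: τ) ≠ ∞) :
    erasureSum R lam z T (v :: σ) =
      z * erasureSum R lam z T [v] * erasureSum R lam z (T \ {v}) σ := by
  rw [eq_mul_of_renewal (hfin _) (hfin _) (erasureSum_cons_of_chain hR T hv hσ hc)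
    (erasureSum_singleton hR T hv)]
  ring

end ErasureSums

end LWW

end

noncomputable section

namespace LWW

/-! ### The hard core gas of polygons in finite volume -/

section PolygonGas

open scoped NNReal Classical Polynomial

variable {V : Type*}

/-- The lists without repetitions of elements of `S`. -/
def nodupLists (S : Finset V) : Finset (List V) :=
  S.powerset.biUnion fun T => T.val.lists.toFinset

theorem mem_nodupLists {S : Finset V} {l : List V} :
    l ∈ nodupLists S ↔ l.Nodup ∧ ∀ x ∈ l, x ∈ S := by
  simp only [nodupLists, Finset.mem_biUnion, Finset.mem_powerset, Multiset.mem_toFinset,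
    Multiset.mem_lists_iff]
  constructor
  · rintro ⟨T, hT, h⟩
    have h' : T.val = (l : Multiset V) := h
    refine ⟨?_, fun x hx => hT ?_⟩
    · have := T.nodup; rw [h'] at this; simpa using this
    · rw [← Finset.mem_val, h']; simpa using hx
  · rintro ⟨h1, h2⟩
    refine ⟨l.toFinset, fun x hx => h2 x (by simpa using hx), ?_⟩
    rw [List.toFinset_val, h1.dedup]; rfl

variable (R : V → V → Prop) (lam : List V → ℝ≥0)

/-- The activity of the polygon with vertices `v, σ₁, …, σₙ`, as a monomial in `z`. -/
def polygonTerm (v : V) (σ : List V) : ℝ[X] :=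
  if (v :: σ ++ [v]).IsChain R then
    Polynomial.C (lam (v :: σ ++ [v]) : ℝ) * Polynomial.X ^ (σ.length + 1) else 0

/-- The partition function of the hard core gas of unrooted polygons in `S`, with activities
`-lam`, as a polynomial in `z`. -/
def gasZ (S : Finset V) : ℝ[X] :=
  if h : S.Nonempty then
    gasZ (S.erase h.choose) - ∑ σ ∈ nodupLists (S.erase h.choose),
      polygonTerm R lam h.choose σ * gasZ (S \ insert h.choose σ.toFinset)
  else 1
termination_by S.card
decreasing_by
  · exact Finset.card_erase_lt_of_mem h.choose_spec
  · apply Finset.card_lt_card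
    rw [Finset.ssubset_iff_of_subset Finset.sdiff_subset]
    exact ⟨h.choose, h.choose_spec, by simp⟩

theorem gasZ_empty : gasZ R lam ∅ = 1 := by
  rw [gasZ, dif_neg (by simp)]

variable {R lam}

/-- Splits a list at the first occurrence of `u` and glues the two parts at `v` in the other
order. -/
def rotateAt (u v : V) (σ : List V) : List V :=
  (σ.dropWhile (fun x => x ≠ u)).tail ++ v :: σ.takeWhile (fun x => x ≠ u)

theorem rotateAt_append {u v : V} {a b : List V} (h : u ∉ a) :
    rotateAt u v (a ++ u :: b) = b ++ v :: a := by
  have h1 : (a ++ u :: b).dropWhile (fun x => x ≠ u) = u :: b := by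
    rw [List.dropWhile_append_of_pos]
    · simp
    · intro x hx; simp; rintro rfl; exact h hx
  have h2 : (a ++ u :: b).takeWhile (fun x => x ≠ u) = a := by
    rw [List.takeWhile_append_of_pos]
    · simp
    · intro x hx; simp; rintro rfl; exact h hx
  rw [rotateAt, h1, h2]; rfl

/-- Both sides state the adjacencies of the same cyclic sequence, cut open at `v` or at `u`. -/
theorem isChain_rotate {u v : V} {a b : List V} :
    (v :: (a ++ u :: b) ++ [v]).IsChain R ↔ (u :: (b ++ v :: a) ++ [u]).IsChain R := by
  have h1 : v :: (a ++ u :: b) ++ [v] = (v :: a) ++ u :: (b ++ [v]) := by simp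
  have h2 : u :: (b ++ v :: a) ++ [u] = (u :: b) ++ v :: (a ++ [u]) := by simp
  rw [h1, h2, List.isChain_split, List.isChain_split (l₁ := u :: b)]
  simp only [List.cons_append]
  tauto

/-- Activities that do not depend on the initial vertex of a polygon. -/
def RotationInvariant (R : V → V → Prop) (lam : List V → ℝ≥0) : Prop :=
  ∀ u v a b, (v :: (a ++ u :: b)).Nodup → (v :: (a ++ u :: b) ++ [v]).IsChain R →
    lam (v :: (a ++ u :: b) ++ [v]) = lam (u :: (b ++ v :: a) ++ [u])

theorem polygonTerm_rotate (hrot : RotationInvariant R lam) {u v : V} {a b : List V}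
    (h : (v :: (a ++ u :: b)).Nodup) :
    polygonTerm R lam v (a ++ u :: b) = polygonTerm R lam u (b ++ v :: a) := by
  unfold polygonTerm
  by_cases hc : (v :: (a ++ u :: b) ++ [v]).IsChain R
  · rw [if_pos hc, if_pos (isChain_rotate.1 hc), hrot u v a b h hc]
    congr 2
    simp; omega
  · rw [if_neg hc, if_neg (fun h' => hc (isChain_rotate.2 h'))]

/-- A polygon through both `u` and `v` may be rooted at either. Re-rooting by `rotateAt` changes
neither its vertex set nor its activity, and is undone by re-rooting back. -/
theorem sum_rotate (hrot : RotationInvariant R lam) {S : Finset V} {u v : V}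
    (huv : u ≠ v) (hv : v ∈ S) (hu : u ∈ S) (f : Finset V → ℝ[X]) :
    ∑ σ ∈ (nodupLists (S.erase v)).filter (fun σ => u ∈ σ),
        polygonTerm R lam v σ * f (insert v σ.toFinset) =
      ∑ σ ∈ (nodupLists (S.erase u)).filter (fun σ => v ∈ σ),
        polygonTerm R lam u σ * f (insert u σ.toFinset) := by
  have key : ∀ u v : V, u ≠ v → v ∈ S → u ∈ S →
      ∀ σ ∈ (nodupLists (S.erase v)).filter (fun σ => u ∈ σ),
      rotateAt u v σ ∈ (nodupLists (S.erase u)).filter (fun σ => v ∈ σ) ∧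
      rotateAt v u (rotateAt u v σ) = σ ∧
      polygonTerm R lam v σ = polygonTerm R lam u (rotateAt u v σ) ∧
      insert v σ.toFinset = insert u (rotateAt u v σ).toFinset := by
    intro u v huv hv hu σ hσ
    rw [Finset.mem_filter, mem_nodupLists] at hσ
    obtain ⟨⟨hn, hS⟩, hmem⟩ := hσ
    obtain ⟨a, b, rfl, ha⟩ := List.eq_append_cons_of_mem hmem
    have hvσ : v ∉ a ++ u :: b := fun h => by simpa using hS v h
    have hnv : (v :: (a ++ u :: b)).Nodup := List.nodup_cons.2 ⟨hvσ, hn⟩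
    have hvb : v ∉ b := fun h => hvσ (by simp [h])
    have hperm : (v :: (a ++ u :: b)).Perm (u :: (b ++ v :: a)) := by
      have h1 : (v :: (a ++ u :: b)).Perm (u :: b ++ v :: a) := by
        rw [← List.cons_append]; exact List.perm_append_comm
      simpa using h1
    rw [rotateAt_append ha, rotateAt_append hvb]
    refine ⟨?_, rfl, polygonTerm_rotate hrot hnv, ?_⟩
    · have h2 := hperm.nodup_iff.1 hnv
      rw [List.nodup_cons] at h2
      rw [Finset.mem_filter, mem_nodupLists]
      refine ⟨⟨h2.2, fun x hx => ?_⟩, by simp⟩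
      rw [Finset.mem_erase]
      refine ⟨fun h => h2.1 (h ▸ hx), ?_⟩
      simp only [List.mem_append, List.mem_cons] at hx
      rcases hx with hx | rfl | hx
      · exact Finset.mem_of_mem_erase (hS x (by simp [hx]))
      · exact hv
      · exact Finset.mem_of_mem_erase (hS x (by simp [hx]))
    · rw [← List.toFinset_cons, ← List.toFinset_cons]
      exact List.toFinset_eq_of_perm _ _ hperm
  refine Finset.sum_bij' (fun σ _ => rotateAt u v σ) (fun σ _ => rotateAt v u σ)
    (fun σ hσ => (key u v huv hv hu σ hσ).1) (fun σ hσ => (key v u huv.symm hu hv σ hσ).1)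
    (fun σ hσ => (key u v huv hv hu σ hσ).2.1) (fun σ hσ => (key v u huv.symm hu hv σ hσ).2.1)
    (fun σ hσ => ?_)
  rw [(key u v huv hv hu σ hσ).2.2.1, (key u v huv hv hu σ hσ).2.2.2]

theorem card_sdiff_insert_lt {S : Finset V} {v : V} (hv : v ∈ S) (T : Finset V) :
    (S \ insert v T).card < S.card := by
  apply Finset.card_lt_card
  rw [Finset.ssubset_iff_of_subset Finset.sdiff_subset]
  exact ⟨v, hv, by simp⟩

theorem filter_notMem_nodupLists {S : Finset V} {u v : V} :
    (nodupLists (S.erase v)).filter (fun σ => u ∉ σ) = nodupLists (S \ {u, v}) := by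
  ext σ
  simp only [Finset.mem_filter, mem_nodupLists, Finset.mem_erase, Finset.mem_sdiff,
    Finset.mem_insert, Finset.mem_singleton]
  constructor
  · rintro ⟨⟨h1, h2⟩, h3⟩
    refine ⟨h1, fun x hx => ⟨(h2 x hx).2, ?_⟩⟩
    rintro (rfl | rfl)
    · exact h3 hx
    · exact (h2 _ hx).1 rfl
  · rintro ⟨h1, h2⟩
    refine ⟨⟨h1, fun x hx => ⟨fun h => (h2 x hx).2 (Or.inr h), (h2 x hx).1⟩⟩, fun h => ?_⟩
    exact (h2 u h).2 (Or.inl rfl)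

/-- The recursion for `gasZ` at `v`, expanded once more at `u`. -/
theorem gasZ_expand {S : Finset V} {u v : V} (huv : u ≠ v) (hv : v ∈ S) (hu : u ∈ S)
    (ih : ∀ S' : Finset V, S'.card < S.card → ∀ w ∈ S', gasZ R lam S' = gasZ R lam (S'.erase w) -
      ∑ σ ∈ nodupLists (S'.erase w), polygonTerm R lam w σ * gasZ R lam (S' \ insert w σ.toFinset)) :
    gasZ R lam (S.erase v) - ∑ σ ∈ nodupLists (S.erase v),
        polygonTerm R lam v σ * gasZ R lam (S \ insert v σ.toFinset) =
      gasZ R lam (S \ {u, v})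
        - ∑ τ ∈ nodupLists (S \ {u, v}), polygonTerm R lam u τ * gasZ R lam ((S \ {u, v}) \ τ.toFinset)
        - ∑ σ ∈ nodupLists (S \ {u, v}), polygonTerm R lam v σ * gasZ R lam ((S \ {u, v}) \ σ.toFinset)
        - ∑ σ ∈ (nodupLists (S.erase v)).filter (fun σ => u ∈ σ),
            polygonTerm R lam v σ * gasZ R lam (S \ insert v σ.toFinset)
        + ∑ σ ∈ nodupLists (S \ {u, v}), ∑ τ ∈ nodupLists ((S \ {u, v}) \ σ.toFinset),
            polygonTerm R lam v σ * (polygonTerm R lam u τ *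
              gasZ R lam ((S \ {u, v}) \ (σ.toFinset ∪ τ.toFinset))) := by
  have e1 : (S.erase v).erase u = S \ {u, v} := by
    ext x; simp only [Finset.mem_erase, Finset.mem_sdiff, Finset.mem_insert,
      Finset.mem_singleton]; tauto
  have h1 := ih (S.erase v) (Finset.card_erase_lt_of_mem hv) u (Finset.mem_erase.2 ⟨huv, hu⟩)
  rw [e1] at h1
  have h2 : ∀ τ : List V, S.erase v \ insert u τ.toFinset = (S \ {u, v}) \ τ.toFinset := by
    intro τ
    ext x; simp only [Finset.mem_erase, Finset.mem_sdiff, Finset.mem_insert,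
      Finset.mem_singleton]; tauto
  simp only [h2] at h1
  -- Polygons through `v` that miss `u` leave `u` in the remaining set, so the recursion applies
  -- there again; those through both vertices are left as they are.
  have h3 : ∀ σ ∈ nodupLists (S \ {u, v}), polygonTerm R lam v σ * gasZ R lam (S \ insert v σ.toFinset)
      = polygonTerm R lam v σ * gasZ R lam ((S \ {u, v}) \ σ.toFinset) -
        ∑ τ ∈ nodupLists ((S \ {u, v}) \ σ.toFinset), polygonTerm R lam v σ * (polygonTerm R lam u τ *
              gasZ R lam ((S \ {u, v}) \ (σ.toFinset ∪ τ.toFinset))) := by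
    intro σ hσ
    have huσ : u ∉ σ := by
      intro h
      have := (mem_nodupLists.1 hσ).2 u h
      simp at this
    rw [ih (S \ insert v σ.toFinset) (card_sdiff_insert_lt hv _) u (by simp [hu, huv, huσ])]
    have e2 : (S \ insert v σ.toFinset).erase u = (S \ {u, v}) \ σ.toFinset := by
      ext x; simp only [Finset.mem_erase, Finset.mem_sdiff, Finset.mem_insert,
        Finset.mem_singleton]; tauto
    have e3 : ∀ τ : List V, (S \ insert v σ.toFinset) \ insert u τ.toFinset =
        (S \ {u, v}) \ (σ.toFinset ∪ τ.toFinset) := by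
      intro τ
      ext x; simp only [Finset.mem_union, Finset.mem_sdiff, Finset.mem_insert,
        Finset.mem_singleton]; tauto
    simp only [e2, e3]
    rw [mul_sub, Finset.mul_sum]
  rw [h1, ← Finset.sum_filter_add_sum_filter_not (nodupLists (S.erase v)) (fun σ => u ∈ σ),
    filter_notMem_nodupLists, Finset.sum_congr rfl h3, Finset.sum_sub_distrib]
  ring

/-- The recursion for `gasZ` holds at every vertex. -/
theorem gasZ_eq (hrot : RotationInvariant R lam) (S : Finset V) {v : V} (hv : v ∈ S) :
    gasZ R lam S = gasZ R lam (S.erase v) - ∑ σ ∈ nodupLists (S.erase v),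
      polygonTerm R lam v σ * gasZ R lam (S \ insert v σ.toFinset) := by
  induction hn : S.card using Nat.strong_induction_on generalizing S v with
  | _ n ih =>
    have ih' : ∀ S' : Finset V, S'.card < S.card → ∀ w ∈ S', gasZ R lam S' =
        gasZ R lam (S'.erase w) - ∑ σ ∈ nodupLists (S'.erase w),
          polygonTerm R lam w σ * gasZ R lam (S' \ insert w σ.toFinset) :=
      fun S' hS' w hw => ih S'.card (hn ▸ hS') S' hw rfl
    have hne : S.Nonempty := ⟨v, hv⟩
    have h0 := gasZ.eq_1 R lam S
    rw [dif_pos hne] at h0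
    have hc := hne.choose_spec
    set c := hne.choose with hc'
    by_cases hcv : c = v
    · rw [h0, hcv]
    -- Expanded at two vertices, the recursions started at `c` and at `v` agree up to the root of
    -- the polygons through both (`sum_rotate`) and the order of two disjoint polygons (`hcomm`).
    rw [h0, gasZ_expand (Ne.symm hcv) hc hv ih', gasZ_expand hcv hv hc ih',
      sum_rotate hrot (Ne.symm hcv) hc hv (fun T => gasZ R lam (S \ T)), Finset.pair_comm v c]
    have hcomm : ∑ σ ∈ nodupLists (S \ {c, v}), ∑ τ ∈ nodupLists ((S \ {c, v}) \ σ.toFinset),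
            polygonTerm R lam c σ * (polygonTerm R lam v τ *
              gasZ R lam ((S \ {c, v}) \ (σ.toFinset ∪ τ.toFinset))) =
        ∑ σ ∈ nodupLists (S \ {c, v}), ∑ τ ∈ nodupLists ((S \ {c, v}) \ σ.toFinset),
            polygonTerm R lam v σ * (polygonTerm R lam c τ *
              gasZ R lam ((S \ {c, v}) \ (σ.toFinset ∪ τ.toFinset))) := by
      rw [Finset.sum_comm' (s' := fun τ => nodupLists ((S \ {c, v}) \ τ.toFinset))
        (t' := nodupLists (S \ {c, v}))]
      · refine Finset.sum_congr rfl fun σ _ => Finset.sum_congr rfl fun τ _ => ?_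
        rw [Finset.union_comm]; ring
      · intro σ τ
        simp only [mem_nodupLists, Finset.mem_sdiff (s := S \ {c, v}), List.mem_toFinset]
        constructor
        · rintro ⟨⟨h1, h2⟩, h3, h4⟩
          exact ⟨⟨h1, fun x hx => ⟨h2 x hx, fun hx' => (h4 x hx').2 hx⟩⟩, h3,
            fun x hx => (h4 x hx).1⟩
        · rintro ⟨⟨h1, h2⟩, h3, h4⟩
          exact ⟨⟨h1, fun x hx => (h2 x hx).1⟩, h3,
            fun x hx => ⟨h4 x hx, fun hx' => (h2 x hx').2 hx⟩⟩
    rw [hcomm]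
    ring

theorem X_mul_derivative_polygonTerm (v : V) (σ : List V) :
    Polynomial.X * (polygonTerm R lam v σ).derivative =
      ((σ.length + 1 : ℕ) : ℝ[X]) * polygonTerm R lam v σ := by
  unfold polygonTerm
  split_ifs
  · rw [Polynomial.derivative_C_mul_X_pow, Nat.add_sub_cancel, pow_succ]
    simp only [map_mul, map_natCast]
    ring
  · simp

/-- The Euler derivative of `gasZ`. -/
theorem X_mul_derivative_gasZ (hrot : RotationInvariant R lam) (S : Finset V) :
    Polynomial.X * (gasZ R lam S).derivative =
      ∑ u ∈ S, (gasZ R lam S - gasZ R lam (S.erase u)) := by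
  -- In terms of configurations this is a double count: the degree in `z` is the number of covered
  -- vertices, and `gasZ S - gasZ (S.erase u)` collects the configurations that cover `u`. The
  -- induction avoids introducing configurations.
  induction hn : S.card using Nat.strong_induction_on generalizing S with
  | _ n ih =>
    rcases S.eq_empty_or_nonempty with rfl | ⟨v, hv⟩
    · simp [gasZ_empty]
    have hcard : ((S.erase v).card : ℝ[X]) = (S.card : ℝ[X]) - 1 := by
      rw [Finset.card_erase_of_mem hv, Nat.cast_sub (Finset.card_pos.2 ⟨v, hv⟩)]; simp
    have h1 := ih (S.erase v).card (hn ▸ Finset.card_erase_lt_of_mem hv) _ rfl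
    rw [Finset.sum_sub_distrib, Finset.sum_const, nsmul_eq_mul, hcard] at h1
    -- The polygon contributes its own number of vertices and the gas outside it the rest, which
    -- together make the factor `S.card`.
    have h2 : ∀ σ ∈ nodupLists (S.erase v), Polynomial.X * (polygonTerm R lam v σ *
        gasZ R lam (S \ insert v σ.toFinset)).derivative =
        (S.card : ℝ[X]) * (polygonTerm R lam v σ * gasZ R lam (S \ insert v σ.toFinset)) -
        ∑ u ∈ S \ insert v σ.toFinset,
          polygonTerm R lam v σ * gasZ R lam ((S \ insert v σ.toFinset).erase u) := by
      intro σ hσ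
      rw [mem_nodupLists] at hσ
      have h3 := ih _ (hn ▸ card_sdiff_insert_lt hv σ.toFinset) _ rfl
      rw [Finset.sum_sub_distrib, Finset.sum_const, nsmul_eq_mul] at h3
      have hsub : insert v σ.toFinset ⊆ S := by
        intro x hx
        rw [Finset.mem_insert, List.mem_toFinset] at hx
        rcases hx with rfl | hx
        · exact hv
        · exact Finset.mem_of_mem_erase (hσ.2 x hx)
      have hvσ : v ∉ σ.toFinset := by
        intro h; simpa using hσ.2 v (by simpa using h)
      have hc : (insert v σ.toFinset).card = σ.length + 1 := by
        rw [Finset.card_insert_of_notMem hvσ, List.toFinset_card_of_nodup hσ.1]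
      have hc2 : ((S \ insert v σ.toFinset).card : ℝ[X]) + ((σ.length + 1 : ℕ) : ℝ[X]) = S.card := by
        rw [← hc, ← Nat.cast_add, Finset.card_sdiff_add_card_eq_card hsub]
      rw [Polynomial.derivative_mul, mul_add, ← mul_assoc, X_mul_derivative_polygonTerm,
        mul_left_comm, h3, ← hc2, ← Finset.mul_sum]
      ring
    have h4 : ∀ u ∈ S.erase v, gasZ R lam (S.erase u) = gasZ R lam ((S.erase v).erase u) -
        ∑ σ ∈ nodupLists ((S.erase u).erase v),
          polygonTerm R lam v σ * gasZ R lam ((S \ insert v σ.toFinset).erase u) := by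
      intro u hu
      rw [Finset.mem_erase] at hu
      rw [gasZ_eq hrot (S.erase u) (v := v) (Finset.mem_erase.2 ⟨hu.1.symm, hv⟩),
        Finset.erase_right_comm]
      simp only [Finset.erase_sdiff_comm]
    -- The same pairs of a polygon through `v` and a vertex off it, summed in the other order.
    have h5 : ∑ u ∈ S.erase v, ∑ σ ∈ nodupLists ((S.erase u).erase v),
          polygonTerm R lam v σ * gasZ R lam ((S \ insert v σ.toFinset).erase u) =
        ∑ σ ∈ nodupLists (S.erase v), ∑ u ∈ S \ insert v σ.toFinset,
          polygonTerm R lam v σ * gasZ R lam ((S \ insert v σ.toFinset).erase u) := by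
      apply Finset.sum_comm'
      intro u σ
      simp only [mem_nodupLists, Finset.mem_erase, Finset.mem_sdiff, Finset.mem_insert,
        List.mem_toFinset]
      constructor
      · rintro ⟨⟨h1, h2⟩, h3, h4⟩
        exact ⟨⟨h2, fun h => h.elim h1 fun h => (h4 u h).2.1 rfl⟩, h3,
          fun x hx => ⟨(h4 x hx).1, (h4 x hx).2.2⟩⟩
      · rintro ⟨⟨h1, h2⟩, h3, h4⟩
        push Not at h2
        exact ⟨⟨h2.1, h1⟩, h3, fun x hx => ⟨(h4 x hx).1, fun h => h2.2 (h ▸ hx), (h4 x hx).2⟩⟩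
    have h6 := gasZ_eq hrot S hv
    have h7 : Polynomial.X * (gasZ R lam S).derivative =
        Polynomial.X * (gasZ R lam (S.erase v)).derivative - ∑ σ ∈ nodupLists (S.erase v),
          Polynomial.X * (polygonTerm R lam v σ *
            gasZ R lam (S \ insert v σ.toFinset)).derivative := by
      rw [h6, Polynomial.derivative_sub, Polynomial.derivative_sum, mul_sub, Finset.mul_sum]
    rw [h7, h1, Finset.sum_congr rfl h2, Finset.sum_sub_distrib, ← Finset.mul_sum, ← h5,
      Finset.sum_sub_distrib, Finset.sum_const, nsmul_eq_mul,
      ← Finset.add_sum_erase S (fun u => gasZ R lam (S.erase u)) hv, Finset.sum_congr rfl h4,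
      Finset.sum_sub_distrib]
    linear_combination (-(S.card : ℝ[X])) * h6

end PolygonGas

end LWW

end

noncomputable section

namespace LWW

/-! ### Closed walks in a finite set as ratios of partition functions -/

section FiniteVolume

open scoped ENNReal NNReal Classical Polynomial

variable {V : Type*} (R : V → V → Prop) (lam : List V → ℝ≥0) (z : ℝ≥0)

/-- The total weight of the walks that start at `v`. -/
def headSum (v : V) : ℝ≥0∞ :=
  ∑' l : List V, if l.head? = some v then (chainWeight R lam z l : ℝ≥0∞) else 0

variable {R lam z}

theorem chainWeight_mono {s : ℝ≥0} (h : s ≤ z) (l : List V) :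
    chainWeight R lam s l ≤ chainWeight R lam z l := by
  unfold chainWeight
  split_ifs
  · gcongr
  · exact le_rfl

theorem headSum_mono {s : ℝ≥0} (h : s ≤ z) (v : V) : headSum R lam s v ≤ headSum R lam z v := by
  apply ENNReal.tsum_le_tsum
  intro l
  split_ifs
  · exact_mod_cast chainWeight_mono h l
  · exact le_rfl

theorem erasureSum_le_headSum (T : Set V) (v : V) (σ : List V) :
    erasureSum R lam z T (v :: σ) ≤ headSum R lam z v := by
  apply ENNReal.tsum_le_tsum
  intro l
  unfold erasureTerm
  by_cases h : loopErase l = v :: σ ∧ ∀ x ∈ l, x ∈ T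
  · rw [if_pos h, if_pos]
    rw [← head?_loopErase, h.1]; rfl
  · rw [if_neg h]; exact zero_le

theorem erasureSum_ne_top (hfin : ∀ v, headSum R lam z v ≠ ∞) (T : Set V) {σ : List V}
    (hσ : σ ≠ []) : erasureSum R lam z T σ ≠ ∞ := by
  cases σ with
  | nil => exact absurd rfl hσ
  | cons v σ => exact ((erasureSum_le_headSum T v σ).trans_lt (hfin v).lt_top).ne

theorem erasureSum_eq_zero {T : Set V} {σ : List V}
    (h : ¬ (σ.IsChain R ∧ σ.Nodup ∧ ∀ x ∈ σ, x ∈ T)) : erasureSum R lam z T σ = 0 := by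
  rw [erasureSum, ENNReal.tsum_eq_zero]
  intro l
  unfold erasureTerm
  split_ifs with h1
  · rw [ENNReal.coe_eq_zero, chainWeight, if_neg]
    rintro ⟨h2, -⟩
    apply h
    rw [← h1.1]
    exact ⟨isChain_loopErase h2, nodup_loopErase l, fun x hx => h1.2 x (loopErase_subset l hx)⟩
  · rfl

/-- Each vertex of `σ` contributes a ratio `Z(S \ v) / Z(S)` for the set left at that stage, and the
ratios telescope. The ratio formula is assumed for all subsets so that this can serve inside the
induction of `erasureSum_mul_gasZ`. -/
theorem erasureSum_mul_gasZ_aux (hR : ∀ v, ¬ R v v) (hfin : ∀ v, headSum R lam z v ≠ ∞)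
    {S : Finset V} (hS : ∀ S' ⊆ S, ∀ v ∈ S', (erasureSum R lam z (S' : Set V) [v]).toReal *
      (gasZ R lam S').eval (z : ℝ) = (gasZ R lam (S'.erase v)).eval (z : ℝ))
    {σ : List V} (hσ : σ ≠ []) (hc : σ.IsChain R) (hσS : σ ∈ nodupLists S) :
    (erasureSum R lam z (S : Set V) σ).toReal * (gasZ R lam S).eval (z : ℝ) =
      (z : ℝ) ^ (σ.length - 1) * (gasZ R lam (S \ σ.toFinset)).eval (z : ℝ) := by
  induction σ generalizing S with
  | nil => exact absurd rfl hσ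
  | cons v σ ih =>
    rw [mem_nodupLists] at hσS
    have hv : v ∈ S := hσS.2 v (by simp)
    by_cases hnil : σ = []
    · subst hnil
      have := hS S subset_rfl v hv
      simpa [Finset.sdiff_singleton_eq_erase] using this
    · have h1 := erasureSum_cons_eq_mul hR (T := (S : Set V)) hv hnil hc
        (fun τ => erasureSum_ne_top hfin _ (by simp)) (lam := lam) (z := z)
      have h2 : (S : Set V) \ {v} = ((S.erase v : Finset V) : Set V) := by simp
      rw [h1, h2, ENNReal.toReal_mul, ENNReal.toReal_mul, ENNReal.coe_toReal]
      have h3 : σ ∈ nodupLists (S.erase v) := by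
        rw [mem_nodupLists]
        have hn := List.nodup_cons.1 hσS.1
        refine ⟨hn.2, fun x hx => Finset.mem_erase.2 ⟨fun h => hn.1 (h ▸ hx), hσS.2 x (by simp [hx])⟩⟩
      have h4 := ih (S := S.erase v) (fun S' hS' => hS S' (hS'.trans (Finset.erase_subset _ _)))
        hnil hc.tail h3
      have h5 := hS S subset_rfl v hv
      have h6 : S.erase v \ σ.toFinset = S \ (v :: σ).toFinset := by
        ext x; simp only [Finset.mem_sdiff, Finset.mem_erase, List.mem_toFinset, List.mem_cons]
        tauto
      rw [h6] at h4
      obtain ⟨k, hk⟩ : ∃ k, σ.length = k + 1 :=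
        ⟨σ.length - 1, by have := List.length_pos_iff.2 hnil; omega⟩
      rw [hk, Nat.add_sub_cancel] at h4
      rw [List.length_cons, hk, Nat.add_sub_cancel, pow_succ]
      linear_combination (z : ℝ) * (erasureSum R lam z ((S.erase v : Finset V) : Set V) σ).toReal * h5
        + (z : ℝ) * h4

theorem returnSum_eq_sum (S : Finset V) (v : V) :
    returnSum R lam z (S : Set V) v = ∑ σ ∈ nodupLists (S.erase v),
      (returnFactor R lam z v σ : ℝ≥0∞) * erasureSum R lam z ((S.erase v : Finset V) : Set V) σ := by
  have h2 : (S : Set V) \ {v} = ((S.erase v : Finset V) : Set V) := by simp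
  rw [returnSum, h2, tsum_eq_sum]
  intro σ hσ
  rw [erasureSum_eq_zero, mul_zero]
  rw [mem_nodupLists] at hσ
  rintro ⟨-, h3, h4⟩
  exact hσ ⟨h3, fun x hx => by simpa [and_comm] using h4 x hx⟩

/-- The closed walks at `v` in a finite set, as a ratio of partition functions. -/
theorem erasureSum_mul_gasZ (hR : ∀ v, ¬ R v v) (hrot : RotationInvariant R lam)
    (hfin : ∀ v, headSum R lam z v ≠ ∞) (S : Finset V) :
    0 < (gasZ R lam S).eval (z : ℝ) ∧ ∀ v ∈ S, (erasureSum R lam z (S : Set V) [v]).toReal *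
      (gasZ R lam S).eval (z : ℝ) = (gasZ R lam (S.erase v)).eval (z : ℝ) := by
  induction hn : S.card using Nat.strong_induction_on generalizing S with
  | _ n ih =>
    have main : ∀ v ∈ S, (erasureSum R lam z (S : Set V) [v]).toReal *
      (gasZ R lam S).eval (z : ℝ) = (gasZ R lam (S.erase v)).eval (z : ℝ) := by
      intro v hv
      have hlt : ∀ S' ⊆ S.erase v, S'.card < n := fun S' hS' =>
        hn ▸ (Finset.card_le_card hS').trans_lt (Finset.card_erase_lt_of_mem hv)
      have hg := erasureSum_singleton hR (S : Set V) (v := v) hv (lam := lam) (z := z)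
      have hgfin : erasureSum R lam z (S : Set V) [v] ≠ ∞ := erasureSum_ne_top hfin _ (by simp)
      have hret : returnSum R lam z (S : Set V) v ≠ ∞ := by
        intro h
        rw [h, ENNReal.top_mul] at hg
        · exact hgfin (by rw [hg]; simp)
        · intro h0; rw [h0] at hg; simp at hg
      have hg' := congrArg ENNReal.toReal hg
      rw [ENNReal.toReal_add (by simp) (ENNReal.mul_ne_top hret hgfin), ENNReal.toReal_mul,
        ENNReal.toReal_one] at hg'
      have hpos := (ih _ (hlt _ subset_rfl) (S.erase v) rfl).1
      have hZ := congrArg (Polynomial.eval (z : ℝ)) (gasZ_eq hrot S hv)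
      rw [Polynomial.eval_sub, Polynomial.eval_finsetSum] at hZ
      -- An excursion with loop erasure `σ` carries the telescoped ratio `Z(S \ (v, σ)) / Z(S \ v)`.
      -- The return sum `F` therefore satisfies `F Z(S \ v) = Z(S \ v) - Z(S)`, and `G = 1 + F G`
      -- gives `G Z(S) = Z(S \ v)`.
      have hF : (returnSum R lam z (S : Set V) v).toReal * (gasZ R lam (S.erase v)).eval (z : ℝ) =
          ∑ σ ∈ nodupLists (S.erase v), (polygonTerm R lam v σ *
            gasZ R lam (S \ insert v σ.toFinset)).eval (z : ℝ) := by
        rw [returnSum_eq_sum, ENNReal.toReal_sum, Finset.sum_mul]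
        · refine Finset.sum_congr rfl fun σ hσ => ?_
          rw [ENNReal.toReal_mul, Polynomial.eval_mul, returnFactor, polygonTerm]
          by_cases hc : (v :: σ ++ [v]).IsChain R
          · have hnil : σ ≠ [] := by
              rintro rfl; simp [hR] at hc
            have hσc : σ.IsChain R := hc.infix ⟨[v], [v], by simp⟩
            have h1 := erasureSum_mul_gasZ_aux hR hfin (S := S.erase v)
              (fun S' hS' => (ih _ (hlt S' hS') S' rfl).2) hnil hσc hσ
            have h6 : S.erase v \ σ.toFinset = S \ insert v σ.toFinset := by
              ext x; simp only [Finset.mem_sdiff, Finset.mem_erase, List.mem_toFinset,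
                Finset.mem_insert]
              tauto
            rw [h6] at h1
            obtain ⟨k, hk⟩ : ∃ k, σ.length = k + 1 :=
              ⟨σ.length - 1, by have := List.length_pos_iff.2 hnil; omega⟩
            rw [hk, Nat.add_sub_cancel] at h1
            rw [if_pos hc, if_pos hc, hk, mul_assoc, h1, ENNReal.coe_toReal]
            simp only [NNReal.coe_mul, NNReal.coe_pow, Polynomial.eval_mul, Polynomial.eval_C,
              Polynomial.eval_pow, Polynomial.eval_X]
            ring
          · rw [if_neg hc, if_neg hc]; simp
        · intro σ hσ
          by_cases hnil : σ = []
          · subst hnil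
            simp [returnFactor, hR]
          · exact ENNReal.mul_ne_top (by simp) (erasureSum_ne_top hfin _ hnil)
      rw [hZ, ← hF]
      linear_combination (gasZ R lam (S.erase v)).eval (z : ℝ) * hg'
    refine ⟨?_, main⟩
    rcases S.eq_empty_or_nonempty with rfl | ⟨v, hv⟩
    · simp [gasZ_empty]
    · have h1 := main v hv
      have h2 := (ih _ (hn ▸ Finset.card_erase_lt_of_mem hv) (S.erase v) rfl).1
      rw [← h1] at h2
      exact pos_of_mul_pos_right h2 ENNReal.toReal_nonneg

/-- A self-avoiding list whose two ends coincide has one element, and loop erasure preserves the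
ends. -/
theorem loopErase_eq_singleton_iff {l : List V} {u : V} :
    loopErase l = [u] ↔ l.head? = some u ∧ l.getLast? = some u := by
  constructor
  · intro h
    rw [← head?_loopErase, ← getLast?_loopErase, h]; simp
  · rintro ⟨h1, h2⟩
    rw [← head?_loopErase] at h1
    rw [← getLast?_loopErase] at h2
    have hn := nodup_loopErase l
    generalize loopErase l = σ at *
    cases σ with
    | nil => simp at h1
    | cons a σ =>
      simp only [List.head?_cons, Option.some.injEq] at h1
      subst h1
      cases σ with
      | nil => rfl
      | cons b τ =>
        rw [List.getLast?_cons_cons] at h2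
        exact absurd (List.mem_of_getLast? h2) (List.nodup_cons.1 hn).1

variable (R lam z)

/-- The list is a closed walk, with at least one step, in `T`. -/
def IsLoopIn (T : Set V) (l : List V) : Prop :=
  2 ≤ l.length ∧ l.head? = l.getLast? ∧ ∀ x ∈ l, x ∈ T

/-- The weights of the closed walks in `T`. -/
def loopWeight (T : Set V) (l : List V) : ℝ≥0 :=
  if IsLoopIn T l then chainWeight R lam z l else 0

variable {R lam z}

/-- Every closed walk is counted once, at its base point; `S.card` accounts for the trivial walks,
which are not in `loopWeight`. -/
theorem sum_erasureSum_singleton (S : Finset V) :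
    ∑ u ∈ S, erasureSum R lam z (S : Set V) [u] =
      ∑' l, (loopWeight R lam z (S : Set V) l : ℝ≥0∞) + S.card := by
  have h1 : (S.card : ℝ≥0∞) = ∑ u ∈ S, ∑' l : List V, if l = [u] then 1 else 0 := by
    simp [tsum_ite_eq]
  rw [h1]
  simp only [erasureSum]
  rw [← Summable.tsum_finsetSum (fun _ _ => ENNReal.summable),
    ← Summable.tsum_finsetSum (fun _ _ => ENNReal.summable), ← ENNReal.tsum_add]
  apply tsum_congr
  intro l
  rcases l with _ | ⟨a, l⟩
  · simp [erasureTerm, loopWeight, IsLoopIn, loopErase_of_nodup]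
  rcases l with _ | ⟨b, l⟩
  · simp only [erasureTerm, loopErase_of_nodup (List.nodup_singleton a), loopWeight, IsLoopIn,
      chainWeight, loopFactor, removedLoops_of_nodup (List.nodup_singleton a)]
    by_cases ha : a ∈ S <;> simp [ha, Finset.sum_ite_eq]
  · have h2 : ∀ u ∈ S, erasureTerm R lam z (S : Set V) [u] (a :: b :: l) =
        if u = a then (loopWeight R lam z (S : Set V) (a :: b :: l) : ℝ≥0∞) else 0 := by
      intro u hu
      simp only [erasureTerm, loopErase_eq_singleton_iff, loopWeight]
      by_cases hua : u = a
      · subst hua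
        rw [if_pos rfl]
        by_cases h : (u :: b :: l).getLast? = some u ∧ ∀ x ∈ u :: b :: l, x ∈ (S : Set V)
        · rw [if_pos ⟨⟨rfl, h.1⟩, h.2⟩, if_pos ⟨by simp, h.1.symm, h.2⟩]
        · rw [if_neg (by tauto), if_neg (fun H => h ⟨H.2.1.symm, H.2.2⟩)]; rfl
      · rw [if_neg (by simp; intro h; exact absurd h.symm hua), if_neg hua]
    rw [Finset.sum_congr rfl h2]
    simp only [Finset.sum_ite_eq', List.cons.injEq, reduceCtorEq, and_false, if_false,
      Finset.sum_const_zero, add_zero]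
    split_ifs with ha
    · rfl
    · rw [loopWeight, if_neg]
      · rfl
      · rintro ⟨-, -, h⟩
        exact ha (by simpa using h a (by simp))

end FiniteVolume

end LWW

end

noncomputable section

namespace LWW

/-! ### The loop measure as minus the logarithm of the partition function -/

section LoopMeasureExponential

open scoped ENNReal NNReal Classical Polynomial
open MeasureTheory

variable {V : Type*} {R : V → V → Prop} {lam : List V → ℝ≥0} {z : ℝ≥0}

variable (R lam) in
/-- The coefficient of `z ^ |l|` in the weight of a closed walk in `T`. -/
def loopCoeff (T : Set V) (l : List V) : ℝ≥0 :=
  if IsLoopIn T l ∧ l.IsChain R then loopFactor lam l else 0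

theorem loopWeight_eq (T : Set V) (l : List V) :
    loopWeight R lam z T l = z ^ (l.length - 1) * loopCoeff R lam T l := by
  unfold loopWeight loopCoeff chainWeight
  by_cases h : IsLoopIn T l
  · have hl : l ≠ [] := by rintro rfl; simp [IsLoopIn] at h
    by_cases hc : l.IsChain R <;> simp [h, hc, hl]
  · simp [h]

theorem two_le_length_of_loopCoeff_ne_zero {T : Set V} {l : List V}
    (h : loopCoeff R lam T l ≠ 0) : 2 ≤ l.length := by
  by_contra hlt
  exact h (if_neg fun H => hlt H.1.1)

/-- The sum is `∑_u (G_S(u) - 1)` with `G_S(u) = Z(S \ u) / Z(S)`, and the Euler formula for `Z`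
evaluates the numerator. -/
theorem hasSum_loopWeight (hR : ∀ v, ¬ R v v) (hrot : RotationInvariant R lam)
    (hfin : ∀ v, headSum R lam z v ≠ ∞) (S : Finset V) :
    HasSum (fun l => (loopWeight R lam z (S : Set V) l : ℝ))
      (-(z * (gasZ R lam S).derivative.eval (z : ℝ)) / (gasZ R lam S).eval (z : ℝ)) := by
  obtain ⟨hpos, hg⟩ := erasureSum_mul_gasZ hR hrot hfin S
  have h1 := sum_erasureSum_singleton (R := R) (lam := lam) (z := z) S
  have hne : ∑ u ∈ S, erasureSum R lam z (S : Set V) [u] ≠ ∞ :=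
    ENNReal.sum_ne_top.2 fun u _ => erasureSum_ne_top hfin _ (by simp)
  have hne' : ∑' l, (loopWeight R lam z (S : Set V) l : ℝ≥0∞) ≠ ∞ := by
    intro h; rw [h] at h1; exact hne (by rw [h1]; simp)
  have hs : Summable (loopWeight R lam z (S : Set V)) := ENNReal.tsum_coe_ne_top_iff_summable.1 hne'
  have hs' : Summable (fun l => (loopWeight R lam z (S : Set V) l : ℝ)) := NNReal.summable_coe.2 hs
  have h2 := congrArg ENNReal.toReal h1
  rw [ENNReal.toReal_add hne' (by simp), ENNReal.toReal_sum
    (fun u _ => erasureSum_ne_top hfin _ (by simp)), ENNReal.tsum_toReal_eq (by simp)] at h2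
  simp only [ENNReal.coe_toReal, ENNReal.toReal_natCast] at h2
  have h3 : ∑' l, (loopWeight R lam z (S : Set V) l : ℝ) =
      -(z * (gasZ R lam S).derivative.eval (z : ℝ)) / (gasZ R lam S).eval (z : ℝ) := by
    have h4 := congrArg (Polynomial.eval (z : ℝ)) (X_mul_derivative_gasZ hrot S)
    rw [Polynomial.eval_mul, Polynomial.eval_X, Polynomial.eval_finsetSum] at h4
    rw [h4, eq_div_iff hpos.ne', ← add_sub_cancel_right (∑' l, _) (S.card : ℝ), ← h2, sub_mul,
      Finset.sum_mul]
    rw [Finset.sum_congr rfl (fun u hu => hg u hu)]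
    simp only [Polynomial.eval_sub, Finset.sum_sub_distrib, Finset.sum_const, nsmul_eq_mul]
    ring
  rw [← h3]
  exact hs'.hasSum

/-- Only the empty configuration survives at `z = 0`. This fixes the constant of integration in `log
Z`. -/
theorem gasZ_eval_zero (hrot : RotationInvariant R lam) (S : Finset V) :
    (gasZ R lam S).eval 0 = 1 := by
  induction S using Finset.strongInduction with
  | H S ih =>
    rcases S.eq_empty_or_nonempty with rfl | ⟨v, hv⟩
    · simp [gasZ_empty]
    · have h : ∀ σ : List V, (polygonTerm R lam v σ).eval 0 = 0 := by
        intro σ; unfold polygonTerm; split_ifs <;> simp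
      rw [gasZ_eq hrot S hv, Polynomial.eval_sub, Polynomial.eval_finsetSum,
        ih _ (Finset.erase_ssubset hv)]
      simp [h]

variable [Countable V]

/-- In finite volume the loop measure is the logarithm of the partition function. -/
theorem hasSum_loopWeight_div (hR : ∀ v, ¬ R v v) (hrot : RotationInvariant R lam)
    (hfin : ∀ v, headSum R lam z v ≠ ∞) (S : Finset V) :
    HasSum (fun l => (loopWeight R lam z (S : Set V) l : ℝ) / (l.length - 1 : ℕ))
      (-Real.log ((gasZ R lam S).eval (z : ℝ))) := by
  have hfin' : ∀ s : ℝ≥0, s ≤ z → ∀ v, headSum R lam s v ≠ ∞ := fun s hs v =>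
    ((headSum_mono hs v).trans_lt (hfin v).lt_top).ne
  have hpos : ∀ s : ℝ, 0 ≤ s → s ≤ z → 0 < (gasZ R lam S).eval s := fun s h0 hs =>
    (erasureSum_mul_gasZ hR hrot (z := ⟨s, h0⟩) (hfin' _ hs) S).1
  -- Division by `s` turns `s ^ |X|` into `s ^ (|X| - 1)`, whose exponent is `l.length - 2`; no
  -- truncation occurs where the coefficient is nonzero.
  have key : ∀ s : ℝ, 0 < s → s ≤ z → HasSum
      (fun l : List V => (loopCoeff R lam (S : Set V) l : ℝ) * s ^ (l.length - 2))
      (-(gasZ R lam S).derivative.eval s / (gasZ R lam S).eval s) := by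
    intro s h0 hs
    lift s to ℝ≥0 using h0.le
    have h1 := (hasSum_loopWeight hR hrot (z := s) (hfin' s hs) S).mul_left (s : ℝ)⁻¹
    have e1 : (fun l : List V => (loopCoeff R lam (S : Set V) l : ℝ) * (s : ℝ) ^ (l.length - 2)) =
        fun l => (s : ℝ)⁻¹ * (loopWeight R lam s (S : Set V) l : ℝ) := by
      ext l
      rw [loopWeight_eq]
      by_cases hl : loopCoeff R lam (S : Set V) l = 0
      · simp [hl]
      · obtain ⟨k, hk⟩ : ∃ k, l.length = k + 2 :=
          ⟨l.length - 2, by have := two_le_length_of_loopCoeff_ne_zero hl; omega⟩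
        rw [hk, Nat.add_sub_cancel, show k + 2 - 1 = k + 1 by omega, NNReal.coe_mul,
          NNReal.coe_pow]
        rw [pow_succ]
        field_simp
    have e2 : -(gasZ R lam S).derivative.eval (s : ℝ) / (gasZ R lam S).eval (s : ℝ) =
        (s : ℝ)⁻¹ * (-(s * (gasZ R lam S).derivative.eval (s : ℝ)) /
          (gasZ R lam S).eval (s : ℝ)) := by
      field_simp
    rw [e1, e2]
    exact h1
  -- The terms increase with `s`, so their values at `s = z` form a summable bound for dominated
  -- convergence.
  have hint : HasSum (fun l : List V => ∫ s in (0 : ℝ)..z,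
      (loopCoeff R lam (S : Set V) l : ℝ) * s ^ (l.length - 2))
      (∫ s in (0 : ℝ)..z, -(gasZ R lam S).derivative.eval s / (gasZ R lam S).eval s) := by
    refine intervalIntegral.hasSum_integral_of_dominated_convergence
      (fun l _ => (loopCoeff R lam (S : Set V) l : ℝ) * (z : ℝ) ^ (l.length - 2)) ?_ ?_ ?_ ?_ ?_
    · intro l
      exact (by fun_prop : Continuous fun s : ℝ =>
        (loopCoeff R lam (S : Set V) l : ℝ) * s ^ (l.length - 2)).aestronglyMeasurable
    · intro l
      refine Filter.Eventually.of_forall fun s hs => ?_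
      rw [Set.uIoc_of_le z.coe_nonneg] at hs
      rw [Real.norm_of_nonneg (by have := hs.1.le; positivity)]
      have := hs.1.le
      have := hs.2
      gcongr
    · refine Filter.Eventually.of_forall fun s hs => ?_
      rw [Set.uIoc_of_le z.coe_nonneg] at hs
      exact (key z (hs.1.trans_le hs.2) le_rfl).summable
    · exact intervalIntegrable_const
    · refine Filter.Eventually.of_forall fun s hs => ?_
      rw [Set.uIoc_of_le z.coe_nonneg] at hs
      exact key s hs.1 hs.2
  have h0 := gasZ_eval_zero hrot S
  have hFTC : (∫ s in (0 : ℝ)..z, -(gasZ R lam S).derivative.eval s / (gasZ R lam S).eval s) =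
      -Real.log ((gasZ R lam S).eval (z : ℝ)) := by
    have hderiv : ∀ s ∈ Set.uIcc (0 : ℝ) z, HasDerivAt
        (fun s => -Real.log ((gasZ R lam S).eval s))
        (-(gasZ R lam S).derivative.eval s / (gasZ R lam S).eval s) s := by
      intro s hs
      rw [Set.uIcc_of_le z.coe_nonneg] at hs
      have := (((gasZ R lam S).hasDerivAt s).log (hpos s hs.1 hs.2).ne').neg
      rw [neg_div]
      exact this
    rw [intervalIntegral.integral_eq_sub_of_hasDerivAt hderiv]
    · rw [h0]; simp
    · apply ContinuousOn.intervalIntegrable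
      apply ContinuousOn.div
      · exact (Polynomial.continuous _).neg.continuousOn
      · exact (Polynomial.continuous _).continuousOn
      · intro s hs
        rw [Set.uIcc_of_le z.coe_nonneg] at hs
        exact (hpos s hs.1 hs.2).ne'
  rw [hFTC] at hint
  convert hint using 1
  ext l
  rw [loopWeight_eq, intervalIntegral.integral_const_mul, integral_pow]
  by_cases hl : loopCoeff R lam (S : Set V) l = 0
  · simp [hl]
  · obtain ⟨k, hk⟩ : ∃ k, l.length = k + 2 :=
      ⟨l.length - 2, by have := two_le_length_of_loopCoeff_ne_zero hl; omega⟩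
    rw [hk, Nat.add_sub_cancel, show k + 2 - 1 = k + 1 by omega]
    push_cast
    simp
    ring

end LoopMeasureExponential

end LWW

end

noncomputable section

namespace LWW

/-! ### Passage to infinite domains -/

section InfiniteVolume

open scoped ENNReal NNReal Classical

variable {V : Type*} {R : V → V → Prop} {lam : List V → ℝ≥0} {z : ℝ≥0}

variable (R lam z) in
/-- The summand of the loop measure of the closed walks in `T` that meet `σ`. -/
def loopMass (T : Set V) (σ l : List V) : ℝ :=
  if ∃ x ∈ σ, x ∈ l then (loopWeight R lam z T l : ℝ) / (l.length - 1 : ℕ) else 0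

theorem loopMass_nonneg (T : Set V) (σ l : List V) : 0 ≤ loopMass R lam z T σ l := by
  unfold loopMass; split_ifs <;> positivity

theorem loopMass_mono {T T' : Set V} (h : T ⊆ T') (σ l : List V) :
    loopMass R lam z T σ l ≤ loopMass R lam z T' σ l := by
  unfold loopMass
  split_ifs
  · gcongr
    unfold loopWeight
    by_cases h1 : IsLoopIn T l
    · rw [if_pos h1, if_pos ⟨h1.1, h1.2.1, fun x hx => h (h1.2.2 x hx)⟩]
    · rw [if_neg h1]; exact zero_le
  · exact le_rfl

/-- Split the loops that meet `v :: σ` by whether they visit `v`; those that do not are the loops of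
`T \ {v}` that meet `σ`. -/
theorem loopMass_cons {T : Set V} (v : V) (σ l : List V) :
    loopMass R lam z T (v :: σ) l =
      loopMass R lam z T [v] l + loopMass R lam z (T \ {v}) σ l := by
  unfold loopMass loopWeight
  by_cases hv : v ∈ l
  · have h1 : ¬ IsLoopIn (T \ {v}) l := fun h => (h.2.2 v hv).2 rfl
    simp [hv, h1]
  · have h1 : IsLoopIn (T \ {v}) l ↔ IsLoopIn T l := by
      refine and_congr_right fun _ => and_congr_right fun _ => ?_
      refine ⟨fun h x hx => (h x hx).1, fun h x hx => ⟨h x hx, ?_⟩⟩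
      rintro rfl; exact hv hx
    simp [hv, h1]

theorem one_le_toReal_erasureSum (hfin : ∀ v, headSum R lam z v ≠ ∞) {T : Set V} {v : V}
    (hv : v ∈ T) : 1 ≤ (erasureSum R lam z T [v]).toReal := by
  have := ENNReal.toReal_mono (erasureSum_ne_top hfin T (by simp))
    (one_le_erasureSum_singleton hv (R := R) (lam := lam) (z := z))
  simpa using this

variable [Countable V]

/-- The loops in `S` through `v` are those in `S` minus those in `S.erase v`, so their mass is a
difference of two logarithms of `Z`. -/
theorem hasSum_loopMass_finset (hR : ∀ v, ¬ R v v) (hrot : RotationInvariant R lam)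
    (hfin : ∀ v, headSum R lam z v ≠ ∞) (S : Finset V) {v : V} (hv : v ∈ S) :
    HasSum (loopMass R lam z (S : Set V) [v])
      (Real.log (erasureSum R lam z (S : Set V) [v]).toReal) := by
  have h1 := (hasSum_loopWeight_div hR hrot hfin S).sub
    (hasSum_loopWeight_div hR hrot hfin (S.erase v))
  obtain ⟨hpos, hg⟩ := erasureSum_mul_gasZ hR hrot hfin S
  have hpos' := (erasureSum_mul_gasZ hR hrot hfin (S.erase v)).1
  have h2 : (erasureSum R lam z (S : Set V) [v]).toReal =
      (gasZ R lam (S.erase v)).eval (z : ℝ) / (gasZ R lam S).eval (z : ℝ) := by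
    rw [eq_div_iff hpos.ne', hg v hv]
  rw [h2, Real.log_div hpos'.ne' hpos.ne']
  have h3 : loopMass R lam z (S : Set V) [v] = fun l =>
      (loopWeight R lam z (S : Set V) l : ℝ) / (l.length - 1 : ℕ) -
        (loopWeight R lam z ((S.erase v : Finset V) : Set V) l : ℝ) / (l.length - 1 : ℕ) := by
    ext l
    have e : ((S.erase v : Finset V) : Set V) = (S : Set V) \ {v} := by simp
    rw [e]
    unfold loopMass loopWeight
    by_cases hvl : v ∈ l
    · have h1 : ¬ IsLoopIn ((S : Set V) \ {v}) l := fun h => (h.2.2 v hvl).2 rfl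
      simp [hvl, h1]
    · have h1 : IsLoopIn ((S : Set V) \ {v}) l ↔ IsLoopIn (S : Set V) l := by
        refine and_congr_right fun _ => and_congr_right fun _ => ?_
        refine ⟨fun h x hx => (h x hx).1, fun h x hx => ⟨h x hx, ?_⟩⟩
        rintro rfl; exact hvl hx
      simp [hvl, h1]
  rw [h3, ← neg_sub_neg]
  exact h1

/-- The closed walks at `v` in `T` are the exponential of the loop measure. -/
theorem erasureSum_singleton_eq_exp (hR : ∀ v, ¬ R v v) (hrot : RotationInvariant R lam)
    (hfin : ∀ v, headSum R lam z v ≠ ∞) {T : Set V} {v : V} (hv : v ∈ T) :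
    Summable (loopMass R lam z T [v]) ∧
      (erasureSum R lam z T [v]).toReal = Real.exp (∑' l, loopMass R lam z T [v] l) := by
  -- A finite family of lists sees only finitely many vertices of `T`. With monotonicity in the
  -- domain, this carries both inequalities over from finite sets.
  have hvol : ∀ A : Finset (List V), ∃ S : Finset V, v ∈ S ∧ (S : Set V) ⊆ T ∧
      ∀ l ∈ A, (∀ x ∈ l, x ∈ T) → ∀ x ∈ l, x ∈ S := by
    intro A
    refine ⟨insert v ((A.biUnion List.toFinset).filter (· ∈ T)), by simp, ?_, ?_⟩
    · intro x hx
      simp only [Finset.coe_insert, Finset.coe_filter, Set.mem_insert_iff] at hx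
      rcases hx with rfl | hx
      · exact hv
      · exact hx.2
    · intro l hl hT x hx
      simp only [Finset.mem_insert, Finset.mem_filter, Finset.mem_biUnion, List.mem_toFinset]
      exact Or.inr ⟨⟨l, hl, hx⟩, hT x hx⟩
  have hpos : ∀ T' : Set V, v ∈ T' → 0 < (erasureSum R lam z T' [v]).toReal := fun T' hv' =>
    zero_lt_one.trans_le (one_le_toReal_erasureSum hfin hv')
  -- This single bound yields both the summability and one half of the equality.
  have hpartial : ∀ A : Finset (List V), ∑ l ∈ A, loopMass R lam z T [v] l ≤
      Real.log (erasureSum R lam z T [v]).toReal := by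
    intro A
    obtain ⟨S, hvS, hST, hA⟩ := hvol A
    have h1 := hasSum_loopMass_finset hR hrot hfin S hvS
    calc ∑ l ∈ A, loopMass R lam z T [v] l ≤ ∑ l ∈ A, loopMass R lam z (S : Set V) [v] l := by
          refine Finset.sum_le_sum fun l hl => ?_
          unfold loopMass
          split_ifs
          · gcongr
            unfold loopWeight
            by_cases h1 : IsLoopIn T l
            · rw [if_pos h1, if_pos ⟨h1.1, h1.2.1, hA l hl h1.2.2⟩]
            · rw [if_neg h1]; exact zero_le
          · exact le_rfl
      _ ≤ Real.log (erasureSum R lam z (S : Set V) [v]).toReal :=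
          sum_le_hasSum A (fun l _ => loopMass_nonneg _ _ l) h1
      _ ≤ _ := by
          apply Real.log_le_log (hpos _ hvS)
          exact ENNReal.toReal_mono (erasureSum_ne_top hfin T (by simp)) (erasureSum_mono hST _)
  have hsum : Summable (loopMass R lam z T [v]) :=
    summable_of_sum_le (fun l => loopMass_nonneg _ _ l) hpartial
  refine ⟨hsum, le_antisymm ?_ ?_⟩
  · rw [← ENNReal.ofReal_le_ofReal_iff (Real.exp_nonneg _),
      ENNReal.ofReal_toReal (erasureSum_ne_top hfin T (by simp)), erasureSum,
      ENNReal.tsum_eq_iSup_sum]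
    refine iSup_le fun A => ?_
    obtain ⟨S, hvS, hST, hA⟩ := hvol A
    have h1 := hasSum_loopMass_finset hR hrot hfin S hvS
    calc ∑ l ∈ A, erasureTerm R lam z T [v] l
        ≤ ∑ l ∈ A, erasureTerm R lam z (S : Set V) [v] l := by
          refine Finset.sum_le_sum fun l hl => ?_
          unfold erasureTerm
          by_cases h1 : loopErase l = [v] ∧ ∀ x ∈ l, x ∈ T
          · rw [if_pos h1, if_pos ⟨h1.1, hA l hl h1.2⟩]
          · rw [if_neg h1]; exact zero_le
      _ ≤ erasureSum R lam z (S : Set V) [v] := ENNReal.sum_le_tsum A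
      _ = ENNReal.ofReal (erasureSum R lam z (S : Set V) [v]).toReal :=
          (ENNReal.ofReal_toReal (erasureSum_ne_top hfin _ (by simp))).symm
      _ ≤ _ := by
          apply ENNReal.ofReal_le_ofReal
          rw [← Real.log_le_iff_le_exp (hpos _ hvS), ← h1.tsum_eq]
          exact h1.summable.tsum_le_tsum (loopMass_mono hST _) hsum
  · rw [← Real.le_log_iff_exp_le (hpos T hv)]
    exact hsum.tsum_le_of_sum_le hpartial

/-- The walks in `T` with loop erasure `σ` in terms of the loop measure. -/
theorem erasureSum_eq_exp (hR : ∀ v, ¬ R v v) (hrot : RotationInvariant R lam)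
    (hfin : ∀ v, headSum R lam z v ≠ ∞) {T : Set V} {σ : List V} (hσ : σ ≠ [])
    (hc : σ.IsChain R) (hn : σ.Nodup) (hT : ∀ x ∈ σ, x ∈ T) :
    Summable (loopMass R lam z T σ) ∧ (erasureSum R lam z T σ).toReal =
      (z : ℝ) ^ (σ.length - 1) * Real.exp (∑' l, loopMass R lam z T σ l) := by
  induction σ generalizing T with
  | nil => exact absurd rfl hσ
  | cons v σ ih =>
    have hv : v ∈ T := hT v (by simp)
    have h1 := erasureSum_singleton_eq_exp hR hrot hfin hv
    by_cases hnil : σ = []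
    · subst hnil
      simpa using h1
    · have hn' := List.nodup_cons.1 hn
      have h2 := ih (T := T \ {v}) hnil hc.tail hn'.2
        (fun x hx => ⟨hT x (by simp [hx]), fun h => hn'.1 (h ▸ hx)⟩)
      have h3 : loopMass R lam z T (v :: σ) = fun l =>
        loopMass R lam z T [v] l + loopMass R lam z (T \ {v}) σ l := funext (loopMass_cons v σ)
      rw [h3, h1.1.tsum_add h2.1, Real.exp_add, ← h1.2, erasureSum_cons_eq_mul hR hv hnil hc
        (fun τ => erasureSum_ne_top hfin _ (by simp)), ENNReal.toReal_mul, ENNReal.toReal_mul,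
        h2.2, ENNReal.coe_toReal]
      refine ⟨h1.1.add h2.1, ?_⟩
      obtain ⟨k, hk⟩ : ∃ k, σ.length = k + 1 :=
        ⟨σ.length - 1, by have := List.length_pos_iff.2 hnil; omega⟩
      rw [List.length_cons, hk, Nat.add_sub_cancel, Nat.add_sub_cancel, pow_succ]
      ring

end InfiniteVolume

end LWW

end

noncomputable section

namespace LWW

/-! ### Walks and activities as lists -/

section Bridge

open scoped ENNReal NNReal Classical

variable {d : ℕ}

theorem Walk.ext_verts {ω ω' : Walk d} (h : ω.verts = ω'.verts) : ω = ω' := by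
  cases ω; cases ω'; simpa using h

theorem Walk.length_verts (ω : Walk d) : ω.verts.length = ω.length + 1 := by
  have := List.length_pos_iff.2 ω.ne_nil
  unfold Walk.length; omega

theorem Walk.vert_eq_getElem (ω : Walk d) {j : ℕ} (h : j < ω.verts.length) :
    ω.vert j = ω.verts[j] := by
  simp [Walk.vert, h]

theorem Walk.getElem?_verts (ω : Walk d) {j : ℕ} (h : j ≤ ω.length) :
    ω.verts[j]? = some (ω.vert j) := by
  have h' : j < ω.verts.length := by rw [ω.length_verts]; omega
  rw [ω.vert_eq_getElem h', List.getElem?_eq_getElem h']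

theorem Walk.head?_verts (ω : Walk d) : ω.verts.head? = some ω.start := by
  rw [List.head?_eq_getElem?, ω.getElem?_verts (Nat.zero_le _)]; rfl

theorem Walk.getLast?_verts (ω : Walk d) : ω.verts.getLast? = some ω.finish := by
  rw [List.getLast?_eq_getElem?, ω.length_verts, Nat.add_sub_cancel, ω.getElem?_verts le_rfl]; rfl

theorem Walk.selfAvoiding_iff_nodup (ω : Walk d) : ω.SelfAvoiding ↔ ω.verts.Nodup := by
  rw [List.nodup_iff_getElem?_ne_getElem?, Walk.SelfAvoiding]
  constructor
  · intro h i j hij hj heq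
    rw [ω.length_verts] at hj
    rw [ω.getElem?_verts (by omega), ω.getElem?_verts (by omega), Option.some.injEq] at heq
    exact hij.ne (h i j (by omega) (by omega) heq)
  · intro h i j hi hj heq
    rcases lt_trichotomy i j with hij | hij | hij
    · refine absurd ?_ (h i j hij (by rw [ω.length_verts]; omega))
      rw [ω.getElem?_verts hi, ω.getElem?_verts hj, heq]
    · exact hij
    · refine absurd ?_ (h j i hij (by rw [ω.length_verts]; omega))
      rw [ω.getElem?_verts hi, ω.getElem?_verts hj, heq]

theorem not_adj_self (v : Site d) : ¬ Adj v v := by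
  simp [Adj, dist1]

/-- The polygon with vertices `x, q₁, …, qₙ`. -/
def mkPolygon (x : Site d) (q : List (Site d)) (hn : (x :: q).Nodup)
    (hc : (x :: q ++ [x]).IsChain Adj) : SAP d :=
  ⟨⟨x :: q ++ [x], by simp, hc⟩, by
    have hget : ∀ i, i ≤ q.length → (x :: q ++ [x]).getD i 0 = (x :: q).getD i 0 := by
      intro i hi
      rw [List.getD_append _ _ _ _ (by simp; omega)]
    have hlast : (x :: q ++ [x]).getD (q.length + 1) 0 = x := by
      rw [List.getD_append_right _ _ _ _ (by simp)]; simp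
    have hinj : ∀ i j, i < j → j ≤ q.length → (x :: q).getD i 0 ≠ (x :: q).getD j 0 := by
      intro i j hij hj
      rw [List.getD_eq_getElem _ _ (by simp; omega), List.getD_eq_getElem _ _ (by simp; omega)]
      intro h
      exact hij.ne ((List.Nodup.getElem_inj_iff hn).1 h)
    have hlen : (x :: q ++ [x]).length - 1 = q.length + 1 := by simp
    constructor
    · simp only [Walk.Closed, Walk.start, Walk.finish, Walk.length, Walk.vert, hlen, hlast]
      simp
    · intro i j hij hj heq
      simp only [Walk.length, Walk.vert, hlen] at hj heq ⊢
      rcases Nat.lt_or_ge q.length j with hlt | hle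
      · have : j = q.length + 1 := by omega
        subst this
        refine ⟨?_, rfl⟩
        rw [hlast, hget i (by omega)] at heq
        by_contra hi
        exact hinj 0 i (by omega) (by omega) (by simpa using heq.symm)
      · rw [hget i (by omega), hget j hle] at heq
        exact absurd heq (hinj i j hij hle)⟩

/-- The activities as a function of lists. -/
def lamList (lam : SAP d → ℝ) (l : List (Site d)) : ℝ≥0 :=
  -- The value off polygons does not enter the weight of any walk; the choice `1` keeps `lamList`
  -- below the constant `K ≥ 1` of `weight_le`.
  if h : ∃ η : SAP d, η.1.verts = l then (lam h.choose).toNNReal else 1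

theorem lamList_verts (lam : SAP d → ℝ) (η : SAP d) :
    lamList lam η.1.verts = (lam η).toNNReal := by
  have h : ∃ η' : SAP d, η'.1.verts = η.1.verts := ⟨η, rfl⟩
  rw [lamList, dif_pos h]
  congr 2
  exact Subtype.ext (Walk.ext_verts h.choose_spec)

/-- All removed loops of a walk are polygons, so the product over polygons with multiplicities is
the product along the list of removed loops. -/
theorem weight_eq_chainWeight {lam : SAP d → ℝ} (hnonneg : ∀ η, 0 ≤ lam η) (z : ℝ≥0)
    (ω : Walk d) : weight lam z ω = (chainWeight Adj (lamList lam) z ω.verts : ℝ) := by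
  obtain ⟨L, hL⟩ : ∃ L : List (SAP d), L.map (fun η => η.1.verts) = removedLoops ω.verts := by
    have h : ∀ c ∈ removedLoops ω.verts, ∃ η : SAP d, η.1.verts = c := by
      intro c hc
      obtain ⟨x, q, rfl, hn, hch⟩ := exists_of_mem_removedLoops ω.chain hc
      exact ⟨mkPolygon x q hn hch, rfl⟩
    generalize removedLoops ω.verts = M at h
    induction M with
    | nil => exact ⟨[], rfl⟩
    | cons c M ih =>
      obtain ⟨η, hη⟩ := h c (by simp)
      obtain ⟨L, hL⟩ := ih (fun c hc => h c (by simp [hc]))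
      exact ⟨η :: L, by simp [hη, hL]⟩
  have hinj : Function.Injective (fun η : SAP d => η.1.verts) := fun η η' h =>
    Subtype.ext (Walk.ext_verts h)
  have hcount : ∀ η : SAP d, loopVector ω η = L.count η := by
    intro η
    rw [loopVector, ← hL]
    exact List.count_map_of_injective L (fun η : SAP d => η.1.verts) hinj η
  rw [weight, chainWeight, if_pos ⟨ω.chain, ω.ne_nil⟩, loopFactor, ← hL]
  simp only [hcount, NNReal.coe_mul, NNReal.coe_pow]
  congr 1
  rw [finprod_eq_prod_of_mulSupport_subset (s := L.toFinset) (fun η => lam η ^ L.count η)]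
  · have h1 : ((L.map (fun η => η.1.verts)).map (lamList lam)).map (fun r : ℝ≥0 => (r : ℝ)) =
        L.map lam := by
      rw [List.map_map, List.map_map]
      refine List.map_congr_left fun η _ => ?_
      simp [lamList_verts, hnonneg η]
    rw [NNReal.coe_list_prod, h1]
    rw [Finset.prod_list_map_count]
    refine Finset.prod_congr rfl fun η _ => ?_
    congr 1
    -- The two counts differ only in their `BEq` instances on `SAP d`.
    refine List.countP_congr fun η' _ => ?_
    exact (beq_iff_eq (α := SAP d)).trans
      (@beq_iff_eq (SAP d) instBEqOfDecidableEq inferInstance η' η).symm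
  · intro η hη
    by_contra hcon
    have : L.count η = 0 := List.count_eq_zero.2 (by simpa using hcon)
    simp [this] at hη

theorem lamList_rotationInvariant {lam : SAP d → ℝ} (hsymm : SymmetricActivities lam) :
    RotationInvariant Adj (lamList lam) := by
  intro u v a b hn hc
  have hperm : (v :: (a ++ u :: b)).Perm (u :: (b ++ v :: a)) := by
    have h1 : (v :: (a ++ u :: b)).Perm (u :: b ++ v :: a) := by
      rw [← List.cons_append]; exact List.perm_append_comm
    simpa using h1
  have hn' := hperm.nodup_iff.1 hn
  have hc' := isChain_rotate.1 hc
  have h := hsymm.2 (mkPolygon v _ hn hc) (mkPolygon u _ hn' hc') (Or.inl ?_)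
  · have h1 := lamList_verts lam (mkPolygon v _ hn hc)
    have h2 := lamList_verts lam (mkPolygon u _ hn' hc')
    rw [h, ← h1] at h2
    exact h2.symm
  · change (b ++ v :: a ++ [u]).IsRotated (a ++ u :: b ++ [v])
    refine ⟨b.length + 1, ?_⟩
    rw [show b ++ v :: a ++ [u] = (b ++ [v]) ++ (a ++ [u]) by simp,
      show b.length + 1 = (b ++ [v]).length by simp, List.rotate_append_length_eq]
    simp

/-- Lattice isometries. -/
def IsIsometry (f : Site d ≃ Site d) : Prop := ∀ x y, dist1 (f x) (f y) = dist1 x y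

theorem IsIsometry.adj_iff {f : Site d ≃ Site d} (hf : IsIsometry f) (x y : Site d) :
    Adj (f x) (f y) ↔ Adj x y := by
  rw [Adj, hf, Adj]

theorem isChain_map_isometry {f : Site d ≃ Site d} (hf : IsIsometry f) (l : List (Site d)) :
    (l.map f).IsChain Adj ↔ l.IsChain Adj := by
  rw [List.isChain_map]
  simp only [hf.adj_iff]

/-- Loop erasure commutes with injective maps, so the removed polygons are the images of the old
ones and carry the same activities. -/
theorem chainWeight_map_isometry {lam : SAP d → ℝ} (hsymm : SymmetricActivities lam) (z : ℝ≥0)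
    {f : Site d ≃ Site d} (hf : IsIsometry f) (l : List (Site d)) :
    chainWeight Adj (lamList lam) z (l.map f) = chainWeight Adj (lamList lam) z l := by
  unfold chainWeight
  by_cases hc : l.IsChain Adj
  · have hc' := (isChain_map_isometry hf l).2 hc
    have h : loopFactor (lamList lam) (l.map f) = loopFactor (lamList lam) l := by
      rw [loopFactor, removedLoops_map f.injective, loopFactor, List.map_map]
      congr 1
      refine List.map_congr_left fun c hcm => ?_
      obtain ⟨x, q, rfl, hn, hch⟩ := exists_of_mem_removedLoops hc hcm
      have hn' : (f x :: q.map f).Nodup := by simpa using hn.map f.injective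
      have hch' : (f x :: q.map f ++ [f x]).IsChain Adj := by
        have := (isChain_map_isometry hf _).2 hch
        simpa using this
      have h1 := lamList_verts lam (mkPolygon x q hn hch)
      have h2 := lamList_verts lam (mkPolygon (f x) (q.map f) hn' hch')
      have h3 := hsymm.1 f hf (mkPolygon x q hn hch) (mkPolygon (f x) (q.map f) hn' hch')
        (by simp [mkPolygon])
      rw [h3, ← h1] at h2
      simpa [mkPolygon] using h2
    simp [hc, hc', h]
  · have hc' : ¬ (l.map f).IsChain Adj := fun h => hc ((isChain_map_isometry hf l).1 h)
    simp [hc, hc']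

theorem isIsometry_translate (v : Site d) : IsIsometry (Equiv.addRight v) := by
  intro x y; simp [dist1]

/-- Translation moves the starting point to the origin, where the sum is the susceptibility. -/
theorem headSum_ne_top {lam : SAP d → ℝ} (hnonneg : ∀ η, 0 ≤ lam η)
    (hsymm : SymmetricActivities lam) {z : ℝ≥0} (h : FiniteSusceptibility lam z) (v : Site d) :
    headSum Adj (lamList lam) z v ≠ ∞ := by
  have h1 : headSum Adj (lamList lam) z v = headSum Adj (lamList lam) z 0 := by
    have hinj : Function.Injective (List.map (Equiv.addRight v : Site d ≃ Site d)) :=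
      List.map_injective_iff.2 (Equiv.injective _)
    unfold headSum
    rw [← hinj.tsum_eq]
    · apply tsum_congr
      intro l
      rw [chainWeight_map_isometry hsymm z (isIsometry_translate v)]
      have : (l.map (Equiv.addRight v : Site d ≃ Site d)).head? = some v ↔ l.head? = some 0 := by
        cases l <;> simp
      by_cases hh : l.head? = some 0
      · rw [if_pos (this.2 hh), if_pos hh]
      · rw [if_neg (fun H => hh (this.1 H)), if_neg hh]
    · intro l _
      refine ⟨l.map (Equiv.addRight v : Site d ≃ Site d).symm, ?_⟩
      simp
  rw [h1]
  have h2 : headSum Adj (lamList lam) z 0 = ∑' ω : {ω : Walk d // ω.start = 0},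
      ENNReal.ofReal (weight lam z ω.1) := by
    have hinj : Function.Injective (fun ω : {ω : Walk d // ω.start = 0} => ω.1.verts) :=
      fun ω ω' h => Subtype.ext (Walk.ext_verts h)
    unfold headSum
    rw [← hinj.tsum_eq]
    · apply tsum_congr
      intro ω
      rw [weight_eq_chainWeight hnonneg, if_pos (by rw [ω.1.head?_verts, ω.2]),
        ENNReal.ofReal_coe_nnreal]
    · intro l hl
      simp only [Function.mem_support, ne_eq, ite_eq_right_iff, Classical.not_imp] at hl
      have hcw : l.IsChain Adj ∧ l ≠ [] := by
        by_contra hcon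
        exact hl.2 (by rw [chainWeight, if_neg hcon]; rfl)
      refine ⟨⟨⟨l, hcw.2, hcw.1⟩, ?_⟩, rfl⟩
      have := Walk.head?_verts ⟨l, hcw.2, hcw.1⟩
      rw [hl.1] at this
      simpa using this.symm
  rw [h2]
  exact h.tsum_ofReal_ne_top

end Bridge

end LWW

end

noncomputable section

namespace LWW

/-! ### The gas of closed walks and the two-point function -/

section LoopGas

open scoped ENNReal NNReal Classical

variable {d : ℕ} {lam : SAP d → ℝ} {z : ℝ≥0}

/-- The mass `w(X) / |X|` of a closed walk. -/
def loopNu (lam : SAP d → ℝ) (z : ℝ) (X : Loop d) : ℝ := weight lam z X.1 / X.1.length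

/-- The closed walks that visit `v`. -/
def through (v : Site d) : Set (Loop d) := {X | v ∈ X.1.range}

/-- With `one_sub_act_div`, this makes each factor an exponential of `± loopNu`, so infinite
products reduce to sums of nonnegative masses. -/
theorem one_add_act (lam : SAP d → ℝ) (z : ℝ) (X : Loop d) :
    1 + act lam z X = Real.exp (loopNu lam z X) := by
  rw [act, loopNu]; ring

theorem one_sub_act_div (lam : SAP d → ℝ) (z : ℝ) (X : Loop d) :
    1 - act lam z X / (1 + act lam z X) = Real.exp (-loopNu lam z X) := by
  rw [one_add_act, Real.exp_neg]
  have := Real.exp_pos (loopNu lam z X)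
  have h : act lam z X = Real.exp (loopNu lam z X) - 1 := by rw [← one_add_act]; ring
  rw [h]; field_simp; ring

theorem weight_nonneg (hnonneg : ∀ η, 0 ≤ lam η) (z : ℝ≥0) (ω : Walk d) : 0 ≤ weight lam z ω := by
  rw [weight_eq_chainWeight hnonneg]; positivity

theorem loopNu_nonneg (hnonneg : ∀ η, 0 ≤ lam η) (z : ℝ≥0) (X : Loop d) : 0 ≤ loopNu lam z X :=
  div_nonneg (weight_nonneg hnonneg z _) (Nat.cast_nonneg _)

theorem isLoopIn_verts (T : Set (Site d)) (X : Loop d) :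
    IsLoopIn T X.1.verts ↔ ∀ x ∈ X.1.range, x ∈ T := by
  have h1 : X.1.verts.head? = X.1.verts.getLast? := by
    rw [X.1.head?_verts, X.1.getLast?_verts]
    exact congrArg some X.2.1
  have h2 : 2 ≤ X.1.verts.length := by rw [X.1.length_verts]; have := X.2.2; omega
  exact ⟨fun h => h.2.2, fun h => ⟨h2, h1, h⟩⟩

/-- The closed walks that meet `σ` and stay in `T`. -/
def loopsMeeting (T : Set (Site d)) (σ : List (Site d)) : Set (Loop d) :=
  {X | (∃ x ∈ σ, x ∈ X.1.range) ∧ ∀ x ∈ X.1.range, x ∈ T}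

theorem loopMass_verts (hnonneg : ∀ η, 0 ≤ lam η) (T : Set (Site d)) (σ : List (Site d))
    (X : Loop d) : loopMass Adj (lamList lam) z T σ X.1.verts =
      (loopsMeeting T σ).indicator (loopNu lam z) X := by
  have hlen : X.1.verts.length - 1 = X.1.length := rfl
  rw [loopMass, loopWeight, hlen]
  by_cases h1 : ∃ x ∈ σ, x ∈ X.1.verts
  · by_cases h2 : ∀ x ∈ X.1.range, x ∈ T
    · have h3 : X ∈ loopsMeeting T σ := ⟨h1, h2⟩
      rw [if_pos h1, if_pos ((isLoopIn_verts T X).2 h2), Set.indicator_of_mem h3, loopNu,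
        weight_eq_chainWeight hnonneg]
    · have h3 : X ∉ loopsMeeting T σ := fun h => h2 h.2
      rw [if_pos h1, if_neg (fun h => h2 ((isLoopIn_verts T X).1 h)), Set.indicator_of_notMem h3]
      simp
  · have h3 : X ∉ loopsMeeting T σ := fun h => h1 h.1
    rw [if_neg h1, Set.indicator_of_notMem h3]

theorem loopVerts_injective : Function.Injective (fun X : Loop d => X.1.verts) :=
  fun _ _ h => Subtype.ext (Walk.ext_verts h)

/-- Only genuine closed walks carry mass, which lets sums over all lists become sums over `Loop d`.
-/
theorem loopMass_eq_zero (lam : List (Site d) → ℝ≥0) (T : Set (Site d)) (σ : List (Site d)) :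
    ∀ l ∉ Set.range (fun X : Loop d => X.1.verts), loopMass Adj lam z T σ l = 0 := by
  intro l hl
  rw [loopMass, loopWeight_eq]
  suffices h : loopCoeff Adj lam T l = 0 by simp [h]
  rw [loopCoeff, if_neg]
  rintro ⟨h1, h2⟩
  have hne : l ≠ [] := by rintro rfl; simp [IsLoopIn] at h1
  apply hl
  have hs := Walk.head?_verts ⟨l, hne, h2⟩
  have hf := Walk.getLast?_verts ⟨l, hne, h2⟩
  refine ⟨⟨⟨l, hne, h2⟩, ?_, ?_⟩, rfl⟩
  · have := h1.2.1
    rw [hs, hf] at this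
    exact Option.some.inj this
  · have := h1.1
    simp only [Walk.length]; omega

/-- The loop measure of the closed walks that meet `σ` and stay in `T`. -/
theorem summable_loopsMeeting (hnonneg : ∀ η, 0 ≤ lam η) (hsymm : SymmetricActivities lam)
    (hχ : FiniteSusceptibility lam z) {T : Set (Site d)} {σ : List (Site d)} (hσ : σ ≠ [])
    (hc : σ.IsChain Adj) (hn : σ.Nodup) (hT : ∀ x ∈ σ, x ∈ T) :
    Summable ((loopsMeeting T σ).indicator (loopNu lam z)) ∧
    (erasureSum Adj (lamList lam) z T σ).toReal = (z : ℝ) ^ (σ.length - 1) *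
      Real.exp (∑' X, (loopsMeeting T σ).indicator (loopNu lam z) X) := by
  obtain ⟨h1, h2⟩ := erasureSum_eq_exp not_adj_self (lamList_rotationInvariant hsymm)
    (headSum_ne_top hnonneg hsymm hχ) hσ hc hn hT
  have h3 : (fun l => loopMass Adj (lamList lam) z T σ l) ∘ (fun X : Loop d => X.1.verts) =
      (loopsMeeting T σ).indicator (loopNu lam z) := funext (loopMass_verts hnonneg T σ)
  have h4 := loopVerts_injective.hasSum_iff (loopMass_eq_zero (lamList lam) T σ (z := z))
    (a := ∑' l, loopMass Adj (lamList lam) z T σ l)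
  have h5 := h4.2 h1.hasSum
  rw [show loopMass Adj (lamList lam) z T σ ∘ (fun X : Loop d => X.1.verts) = _ from h3] at h5
  refine ⟨h5.summable, ?_⟩
  rw [h5.tsum_eq, h2]

theorem summable_through (hnonneg : ∀ η, 0 ≤ lam η) (hsymm : SymmetricActivities lam)
    (hχ : FiniteSusceptibility lam z) (v : Site d) :
    Summable ((through v).indicator (loopNu lam z)) := by
  have h := (summable_loopsMeeting hnonneg hsymm hχ (T := Set.univ) (σ := [v]) (by simp)
    (by simp) (by simp) (by simp)).1
  convert h using 2
  ext X; simp [through, loopsMeeting]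

theorem summable_of_subset_through (hnonneg : ∀ η, 0 ≤ lam η) (hsymm : SymmetricActivities lam)
    (hχ : FiniteSusceptibility lam z) {v : Site d} {P : Set (Loop d)} (hP : P ⊆ through v) :
    Summable (P.indicator (loopNu lam z)) := by
  refine (summable_through hnonneg hsymm hχ v).of_nonneg_of_le
    (fun X => Set.indicator_nonneg (fun X _ => loopNu_nonneg hnonneg z X) X) (fun X => ?_)
  exact Set.indicator_le_indicator_of_subset hP (fun X => loopNu_nonneg hnonneg z X) X

/-- A convergent product of the factors `1 + α_X`. -/
theorem hasProd_one_add_act {P : Set (Loop d)} (hP : Summable (P.indicator (loopNu lam z))) :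
    HasProd (fun X => if X ∈ P then 1 + act lam z X else 1)
      (Real.exp (∑' X, P.indicator (loopNu lam z) X)) := by
  have h := hP.hasSum.rexp
  convert h using 1
  ext X
  by_cases hX : X ∈ P <;> simp [hX, one_add_act]

/-- A convergent product of the factors `1 - α_X / (1 + α_X)`. -/
theorem hasProd_one_sub_act_div {P : Set (Loop d)}
    (hP : Summable (P.indicator (loopNu lam z))) :
    HasProd (fun X => if X ∈ P then 1 - act lam z X / (1 + act lam z X) else 1)
      (Real.exp (-∑' X, P.indicator (loopNu lam z) X)) := by
  have h := hP.hasSum.neg.rexp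
  convert h using 1
  ext X
  by_cases hX : X ∈ P <;> simp [hX, one_sub_act_div]

theorem loopMeasureTerm_eq (lam : SAP d → ℝ) (z : ℝ) (v : Site d) (B : Set (Site d)) :
    loopMeasureTerm lam z {v} B =
      {X : Loop d | v ∈ X.1.range ∧ X.1.range ∩ B = ∅}.indicator (loopNu lam z) := by
  ext X
  rw [loopMeasureTerm, Set.indicator_apply]
  simp [loopNu]

theorem tprod_subtype_one_add_act {P : Set (Loop d)}
    (hP : Summable (P.indicator (loopNu lam z))) :
    ∏' X : P, (1 + act lam z X.1) = Real.exp (∑' X, P.indicator (loopNu lam z) X) := by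
  rw [tprod_subtype P (fun X => 1 + act lam z X), ← (hasProd_one_add_act hP).tprod_eq]
  apply tprod_congr
  intro X
  rw [Set.mulIndicator_apply]

theorem alphaZero_eq_exp (hnonneg : ∀ η, 0 ≤ lam η) (hsymm : SymmetricActivities lam)
    (hχ : FiniteSusceptibility lam z) :
    alphaZero lam z = Real.exp (∑' X, (through 0).indicator (loopNu lam z) X) :=
  tprod_subtype_one_add_act (summable_through hnonneg hsymm hχ 0)

theorem alphaOne_eq_exp (hnonneg : ∀ η, 0 ≤ lam η) (hsymm : SymmetricActivities lam)
    (hχ : FiniteSusceptibility lam z) (y : Site d) :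
    alphaOne lam z y = Real.exp (∑' X, (through 0 \ through y).indicator (loopNu lam z) X) :=
  tprod_subtype_one_add_act (P := through 0 \ through y)
    (summable_of_subset_through hnonneg hsymm hχ Set.sdiff_subset)

theorem loopMeasure_constants (hnonneg : ∀ η, 0 ≤ lam η) (hsymm : SymmetricActivities lam)
    (hχ : FiniteSusceptibility lam z) (y : Site d) :
    Summable (loopMeasureTerm lam z {0} ∅) ∧
      alphaZero lam z = Real.exp (loopMeasure lam z {0} ∅) ∧
      alphaOne lam z y = Real.exp (loopMeasure lam z {0} {y}) := by
  have h1 : {X : Loop d | (0 : Site d) ∈ X.1.range ∧ X.1.range ∩ ∅ = ∅} = through 0 := by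
    ext X; simp [through]
  have h2 : {X : Loop d | (0 : Site d) ∈ X.1.range ∧ X.1.range ∩ {y} = ∅} =
      through 0 \ through y := by
    ext X; simp [through]
  refine ⟨?_, ?_, ?_⟩
  · rw [loopMeasureTerm_eq, h1]; exact summable_through hnonneg hsymm hχ 0
  · rw [alphaZero_eq_exp hnonneg hsymm hχ, loopMeasure, loopMeasureTerm_eq, h1]
  · rw [alphaOne_eq_exp hnonneg hsymm hχ, loopMeasure, loopMeasureTerm_eq, h2]

theorem range_eq_mem_verts (ω : Walk d) (X : Loop d) :
    (X.1.range ∩ ω.range).Nonempty ↔ X ∈ loopsMeeting Set.univ ω.verts := by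
  simp only [loopsMeeting, Set.mem_univ, implies_true, and_true]
  constructor
  · rintro ⟨x, h1, h2⟩; exact ⟨x, h2, h1⟩
  · rintro ⟨x, h1, h2⟩; exact ⟨x, h2, h1⟩

/-- The weight in `sawCount` as a sum over the walks with a given loop erasure. -/
theorem saw_term_eq (hnonneg : ∀ η, 0 ≤ lam η) (hsymm : SymmetricActivities lam)
    (hχ : FiniteSusceptibility lam z) (ω : Walk d) :
    (z : ℝ) ^ ω.length * (if ω.SelfAvoiding then
      ∏' X : Loop d, (if (X.1.range ∩ ω.range).Nonempty then 1 + act lam z X else 1) else 0) =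
    (erasureSum Adj (lamList lam) z Set.univ ω.verts).toReal := by
  by_cases h : ω.SelfAvoiding
  · obtain ⟨h1, h2⟩ := summable_loopsMeeting hnonneg hsymm hχ (T := Set.univ) ω.ne_nil ω.chain
      (ω.selfAvoiding_iff_nodup.1 h) (by simp)
    rw [if_pos h, h2, ← (hasProd_one_add_act h1).tprod_eq]
    simp only [range_eq_mem_verts]
    rfl
  · rw [if_neg h, erasureSum_eq_zero (fun H => h (ω.selfAvoiding_iff_nodup.2 H.2.1))]
    simp

theorem summable_weight_walkBetween {lam : SAP d → ℝ} {z : ℝ} (hχ : FiniteSusceptibility lam z)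
    (x : Site d) : Summable fun ω : WalkBetween (0 : Site d) x => weight lam z ω.1 := by
  let i : WalkBetween (0 : Site d) x → {ω : Walk d // ω.start = 0} := fun ω => ⟨ω.1, ω.2.1⟩
  have hi : Function.Injective i := fun ω ω' h => Subtype.ext (congrArg (fun w => w.1) h)
  have h : Summable ((fun ω : {ω : Walk d // ω.start = 0} => weight lam z ω.1) ∘ i) :=
    Summable.comp_injective hχ hi
  exact h

/-- The loop expansion of the two-point function. -/
theorem hasSum_sawCount (hnonneg : ∀ η, 0 ≤ lam η) (hsymm : SymmetricActivities lam)
    (hχ : FiniteSusceptibility lam z) (x : Site d) :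
    HasSum (fun n : ℕ => (z : ℝ) ^ n * sawCount lam z n x) (twoPoint lam z 0 x) := by
  have hfin := headSum_ne_top hnonneg hsymm hχ
  let E : List (Site d) → ℝ≥0∞ := erasureSum Adj (lamList lam) z Set.univ
  have h1 : ∀ n : ℕ, (z : ℝ) ^ n * sawCount lam z n x =
      (∑' ω : WalkOfLength n (0 : Site d) x, E ω.1.verts).toReal := by
    intro n
    rw [ENNReal.tsum_toReal_eq (fun ω => erasureSum_ne_top hfin _ ω.1.ne_nil), sawCount,
      ← tsum_mul_left]
    apply tsum_congr
    intro ω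
    rw [← saw_term_eq hnonneg hsymm hχ, ω.2.2.2]
  -- The condition sees only the two ends, hence holds for a walk exactly when it holds for its loop
  -- erasure.
  let P : List (Site d) → Prop := fun l => l.head? = some 0 ∧ l.getLast? = some x
  have h2 : ∑' n : ℕ, ∑' ω : WalkOfLength n (0 : Site d) x, E ω.1.verts =
      ∑' σ, if P σ then E σ else 0 := by
    rw [← ENNReal.tsum_sigma' (fun p : Σ n : ℕ, WalkOfLength n (0 : Site d) x => E p.2.1.verts)]
    let g : (Σ n : ℕ, WalkOfLength n (0 : Site d) x) → List (Site d) := fun p => p.2.1.verts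
    have hg : Function.Injective g := by
      rintro ⟨n, ω, hω⟩ ⟨n', ω', hω'⟩ h
      have : ω = ω' := Walk.ext_verts h
      subst this
      have : n = n' := by rw [← hω.2.2, ← hω'.2.2]
      subst this
      rfl
    rw [← hg.tsum_eq]
    · apply tsum_congr
      rintro ⟨n, ω, hω⟩
      have : P ω.verts := ⟨by rw [ω.head?_verts, hω.1], by rw [ω.getLast?_verts, hω.2.1]⟩
      simp only [g]
      rw [if_pos this]
    · intro l hl
      simp only [Function.mem_support, ne_eq, ite_eq_right_iff, Classical.not_imp] at hl
      have hc : l.IsChain Adj := by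
        by_contra hc
        exact hl.2 (erasureSum_eq_zero fun h => hc h.1)
      have hne : l ≠ [] := by rintro rfl; simp [P] at hl
      have hs := Walk.head?_verts ⟨l, hne, hc⟩
      have hf := Walk.getLast?_verts ⟨l, hne, hc⟩
      rw [hl.1.1] at hs
      rw [hl.1.2] at hf
      exact ⟨⟨_, ⟨⟨l, hne, hc⟩, (Option.some.inj hs).symm, (Option.some.inj hf).symm, rfl⟩⟩, rfl⟩
  -- After the sums are exchanged, each walk contributes only at its own loop erasure.
  have h3 : (∑' σ, if P σ then E σ else 0) =
      ∑' l, if P l then (chainWeight Adj (lamList lam) z l : ℝ≥0∞) else 0 := by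
    have : ∀ σ, (if P σ then E σ else 0) = ∑' l, if P σ then
        erasureTerm Adj (lamList lam) z Set.univ σ l else 0 := by
      intro σ
      split_ifs
      · rfl
      · simp
    rw [tsum_congr this, ENNReal.tsum_comm]
    apply tsum_congr
    intro l
    have hP : P (loopErase l) ↔ P l := by
      simp only [P, head?_loopErase, getLast?_loopErase]
    rw [tsum_eq_single (loopErase l)]
    · simp only [hP, erasureTerm]
      simp
    · intro σ hσ
      have : erasureTerm Adj (lamList lam) z Set.univ σ l = 0 := if_neg fun H => hσ H.1.symm
      rw [this, ite_self]
  have h4 : ∑' l, (if P l then (chainWeight Adj (lamList lam) z l : ℝ≥0∞) else 0) =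
      ∑' ω : WalkBetween (0 : Site d) x, ENNReal.ofReal (weight lam z ω.1) := by
    have hinj : Function.Injective (fun ω : WalkBetween (0 : Site d) x => ω.1.verts) :=
      fun ω ω' h => Subtype.ext (Walk.ext_verts h)
    rw [← hinj.tsum_eq]
    · apply tsum_congr
      intro ω
      have : P ω.1.verts := ⟨by rw [ω.1.head?_verts, ω.2.1], by rw [ω.1.getLast?_verts, ω.2.2]⟩
      rw [weight_eq_chainWeight hnonneg, if_pos this, ENNReal.ofReal_coe_nnreal]
    · intro l hl
      simp only [Function.mem_support, ne_eq, ite_eq_right_iff, Classical.not_imp] at hl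
      have hcw : l.IsChain Adj ∧ l ≠ [] := by
        by_contra hcon
        exact hl.2 (by rw [chainWeight, if_neg hcon]; rfl)
      have hs := Walk.head?_verts ⟨l, hcw.2, hcw.1⟩
      have hf := Walk.getLast?_verts ⟨l, hcw.2, hcw.1⟩
      rw [hl.1.1] at hs
      rw [hl.1.2] at hf
      exact ⟨⟨⟨l, hcw.2, hcw.1⟩, (Option.some.inj hs).symm, (Option.some.inj hf).symm⟩, rfl⟩
  have hsum := summable_weight_walkBetween hχ x
  have h5 := (h2.trans h3).trans h4
  have hne : ∑' n : ℕ, ∑' ω : WalkOfLength n (0 : Site d) x, E ω.1.verts ≠ ∞ := by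
    rw [h5]; exact hsum.tsum_ofReal_ne_top
  have h6 := ENNReal.hasSum_toReal (f := fun n : ℕ =>
    ∑' ω : WalkOfLength n (0 : Site d) x, E ω.1.verts) hne
  have h7 : (fun n : ℕ => (z : ℝ) ^ n * sawCount lam z n x) = fun n : ℕ =>
    (∑' ω : WalkOfLength n (0 : Site d) x, E ω.1.verts).toReal := funext h1
  rw [h7]
  have h8 : twoPoint lam z 0 x =
      ∑' n : ℕ, (∑' ω : WalkOfLength n (0 : Site d) x, E ω.1.verts).toReal := by
    rw [← ENNReal.tsum_toReal_eq (fun n => ENNReal.ne_top_of_tsum_ne_top hne n), h5,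
      ← ENNReal.ofReal_tsum_of_nonneg (fun ω => weight_nonneg hnonneg z _) hsum,
      ENNReal.toReal_ofReal (tsum_nonneg fun ω => weight_nonneg hnonneg z _)]
    rfl
  rw [h8]
  exact h6

end LoopGas

end LWW

end

noncomputable section

namespace LWW

/-! ### Laces and the lace algorithm -/

section LaceTheory

open scoped Classical

variable {m : ℕ} {Γ : Finset (ℕ × ℕ)}

theorem mem_edgesOn {e : ℕ × ℕ} : e ∈ edgesOn m ↔ e.1 < e.2 ∧ e.2 ≤ m := by
  simp only [edgesOn, Finset.mem_filter, Finset.mem_product, Finset.mem_range]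
  omega

theorem LaceConnected.mono {Γ' : Finset (ℕ × ℕ)} (h : LaceConnected m Γ) (hs : Γ ⊆ Γ')
    (h' : Γ' ⊆ edgesOn m) : LaceConnected m Γ' := by
  obtain ⟨-, h2, h3, ⟨a, ha⟩, b, hb⟩ := h
  refine ⟨h', h2, fun j h0 hj => ?_, ⟨a, hs ha⟩, b, hs hb⟩
  obtain ⟨e, he, h⟩ := h3 j h0 hj
  exact ⟨e, hs he, h⟩

theorem LaceConnected.lt (h : LaceConnected m Γ) {e : ℕ × ℕ} (he : e ∈ Γ) : e.1 < e.2 :=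
  (mem_edgesOn.1 (h.1 he)).1

theorem LaceConnected.le (h : LaceConnected m Γ) {e : ℕ × ℕ} (he : e ∈ Γ) : e.2 ≤ m :=
  (mem_edgesOn.1 (h.1 he)).2

theorem le_laceRight_zero {t : ℕ} (h : (0, t) ∈ Γ) : t ≤ laceRight Γ 0 :=
  Finset.le_sup (f := Prod.snd) (b := (0, t)) (Finset.mem_filter.2 ⟨h, rfl⟩)

theorem le_laceRight_succ {s t i : ℕ} (h : (s, t) ∈ Γ) (hs : s < laceRight Γ i) :
    t ≤ laceRight Γ (i + 1) :=
  Finset.le_sup (f := Prod.snd) (b := (s, t)) (Finset.mem_filter.2 ⟨h, hs⟩)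

theorem LaceConnected.zero_mem (h : LaceConnected m Γ) : (0, laceRight Γ 0) ∈ Γ := by
  obtain ⟨a, ha⟩ := h.2.2.2.1
  obtain ⟨e, he, hsup⟩ := Finset.exists_mem_eq_sup (Γ.filter fun e => e.1 = 0)
    ⟨(0, a), Finset.mem_filter.2 ⟨ha, rfl⟩⟩ Prod.snd
  rw [Finset.mem_filter] at he
  rw [laceRight, hsup, ← he.2]
  exact he.1

theorem LaceConnected.laceRight_pos (h : LaceConnected m Γ) (i : ℕ) : 0 < laceRight Γ i := by
  have h0 : 0 < laceRight Γ 0 := h.lt h.zero_mem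
  cases i with
  | zero => exact h0
  | succ i =>
    induction i with
    | zero => exact h0.trans_le (le_laceRight_succ h.zero_mem h0)
    | succ i ih => exact h0.trans_le (le_laceRight_succ h.zero_mem ih)

theorem LaceConnected.exists_succ (h : LaceConnected m Γ) (i : ℕ) :
    ∃ s < laceRight Γ i, (s, laceRight Γ (i + 1)) ∈ Γ := by
  obtain ⟨e, he, hsup⟩ := Finset.exists_mem_eq_sup (Γ.filter fun e => e.1 < laceRight Γ i)
    ⟨(0, laceRight Γ 0), Finset.mem_filter.2 ⟨h.zero_mem, h.laceRight_pos i⟩⟩ Prod.snd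
  rw [Finset.mem_filter] at he
  refine ⟨e.1, he.2, ?_⟩
  rw [laceRight, hsup]
  exact he.1

theorem LaceConnected.mem (h : LaceConnected m Γ) (i : ℕ) : (laceLeft Γ i, laceRight Γ i) ∈ Γ := by
  cases i with
  | zero => exact h.zero_mem
  | succ i =>
    obtain ⟨s, -, hs⟩ := h.exists_succ i
    exact Nat.sInf_mem (s := {s | (s, laceRight Γ (i + 1)) ∈ Γ}) ⟨s, hs⟩

theorem LaceConnected.laceLeft_succ_lt (h : LaceConnected m Γ) (i : ℕ) :
    laceLeft Γ (i + 1) < laceRight Γ i := by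
  obtain ⟨s, hs, hs'⟩ := h.exists_succ i
  exact (Nat.sInf_le (m := s) hs').trans_lt hs

theorem LaceConnected.laceRight_le (h : LaceConnected m Γ) (i : ℕ) : laceRight Γ i ≤ m :=
  h.le (h.mem i)

theorem LaceConnected.laceRight_mono (h : LaceConnected m Γ) : Monotone (laceRight Γ) :=
  monotone_nat_of_le_succ fun i => le_laceRight_succ (h.mem i) (h.lt (h.mem i))

/-- The interior point `t_i` is covered by some edge; this edge starts before `t_i`, so it is a
candidate for the next choice. -/
theorem LaceConnected.laceRight_lt_succ (h : LaceConnected m Γ) {i : ℕ} (hi : laceRight Γ i ≠ m) :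
    laceRight Γ i < laceRight Γ (i + 1) := by
  obtain ⟨e, he, h1, h2⟩ := h.2.2.1 (laceRight Γ i) (h.laceRight_pos i)
    (lt_of_le_of_ne (h.laceRight_le i) hi)
  exact h2.trans_le (le_laceRight_succ (s := e.1) he h1)

/-- The right endpoints begin at `1` or later and grow strictly until `m`; with indices from zero,
`m - 1` is late enough. -/
theorem LaceConnected.laceRight_last (h : LaceConnected m Γ) : laceRight Γ (m - 1) = m := by
  have h1 : ∀ i, min m (i + 1) ≤ laceRight Γ i := by
    intro i
    induction i with
    | zero => have := h.laceRight_pos 0; omega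
    | succ i ih =>
      by_cases hi : laceRight Γ i = m
      · have := h.laceRight_mono (Nat.le_succ i)
        simp only [Nat.succ_eq_add_one] at this
        omega
      · have := h.laceRight_lt_succ hi
        omega
  have := h1 (m - 1)
  have := h.laceRight_le (m - 1)
  omega

/-- Edges selected by the lace algorithm with the same right endpoint coincide. -/
theorem LaceConnected.laceLeft_eq (h : LaceConnected m Γ) {i j : ℕ}
    (hij : laceRight Γ i = laceRight Γ j) : laceLeft Γ i = laceLeft Γ j := by
  have key : ∀ j, laceRight Γ 0 = laceRight Γ j → laceLeft Γ j = 0 := by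
    intro j hj
    cases j with
    | zero => rfl
    | succ j =>
      have : laceLeft Γ (j + 1) ≤ 0 := by
        refine Nat.sInf_le (m := 0) ?_
        rw [Set.mem_ofPred_eq, ← hj]
        exact h.zero_mem
      omega
  cases i with
  | zero => exact (key j hij).symm
  | succ i =>
    cases j with
    | zero => exact key _ hij.symm
    | succ j => rw [laceLeft, laceLeft, hij]

/-- Once `m` is reached the algorithm repeats the same edge, so the stopping rule in `laceOf` may be
forgotten. -/
theorem LaceConnected.mem_laceOf (h : LaceConnected m Γ) {e : ℕ × ℕ} :
    e ∈ laceOf m Γ ↔ ∃ i, (laceLeft Γ i, laceRight Γ i) = e := by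
  simp only [laceOf, Finset.mem_image, Finset.mem_filter, Finset.mem_range]
  constructor
  · rintro ⟨i, -, hi⟩; exact ⟨i, hi⟩
  · rintro ⟨i, rfl⟩
    have hex : ∃ j, laceRight Γ j = m := ⟨_, h.laceRight_last⟩
    have hj := Nat.find_spec hex
    have hjm : Nat.find hex ≤ m - 1 := Nat.find_min' hex h.laceRight_last
    have hm := h.2.1
    rcases le_or_gt i (Nat.find hex) with hi | hi
    · exact ⟨i, ⟨by omega, fun j hji => Nat.find_min hex (by omega)⟩, rfl⟩
    · have h1 : laceRight Γ i = m :=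
        le_antisymm (h.laceRight_le i) (hj ▸ h.laceRight_mono hi.le)
      refine ⟨Nat.find hex, ⟨by omega, fun j hji => Nat.find_min hex hji⟩, ?_⟩
      rw [h.laceLeft_eq (hj.trans h1.symm), hj, h1]

theorem LaceConnected.laceOf_subset (h : LaceConnected m Γ) : laceOf m Γ ⊆ Γ := by
  intro e he
  obtain ⟨i, rfl⟩ := h.mem_laceOf.1 he
  exact h.mem i

/-- A point `j` is covered by the first selected edge that ends beyond it: its left end lies before
the previous right endpoint, which is at most `j`. -/
theorem LaceConnected.laceOf_connected (h : LaceConnected m Γ) : LaceConnected m (laceOf m Γ) := by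
  refine ⟨h.laceOf_subset.trans h.1, h.2.1, fun j h0 hj => ?_, ?_, ?_⟩
  · have hex : ∃ i, j < laceRight Γ i := ⟨m - 1, by rw [h.laceRight_last]; exact hj⟩
    have hlt := Nat.find_spec hex
    refine ⟨_, h.mem_laceOf.2 ⟨Nat.find hex, rfl⟩, ?_, hlt⟩
    rcases hi : Nat.find hex with _ | k
    · exact h0
    · have h1 := Nat.find_min hex (m := k) (by omega)
      have h2 := h.laceLeft_succ_lt k
      simp only
      omega
  · exact ⟨laceRight Γ 0, h.mem_laceOf.2 ⟨0, rfl⟩⟩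
  · exact ⟨laceLeft Γ (m - 1), h.mem_laceOf.2 ⟨m - 1, by rw [h.laceRight_last]⟩⟩

/-- No selected edge is redundant. The first is the only one that starts at `0`, and a later one is
the only one covering the right endpoint before it: an edge starting before `t_k` ends by `t_{k+1}`,
and one ending beyond `t_k` comes later than step `k`. -/
theorem LaceConnected.isLace_laceOf (h : LaceConnected m Γ) : IsLace m (laceOf m Γ) := by
  refine ⟨h.laceOf_connected, fun e he hcon => ?_⟩
  have hex : ∃ i, (laceLeft Γ i, laceRight Γ i) = e := h.mem_laceOf.1 he
  have hi := Nat.find_spec hex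
  rcases hk : Nat.find hex with _ | k
  · rw [hk] at hi
    obtain ⟨t, ht⟩ := hcon.2.2.2.1
    rw [Finset.mem_erase] at ht
    obtain ⟨j, hj⟩ := h.mem_laceOf.1 ht.2
    apply ht.1
    have h1 : laceRight Γ j = t := congrArg Prod.snd hj
    have h2 : t ≤ laceRight Γ 0 := le_laceRight_zero (h.laceOf_subset ht.2)
    have h3 : laceRight Γ 0 ≤ t := h1 ▸ h.laceRight_mono (Nat.zero_le j)
    rw [← hi, le_antisymm h2 h3]
    rfl
  · rw [hk] at hi
    have hlt : laceRight Γ k ≠ m := by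
      intro hm
      apply Nat.find_min hex (m := k) (by omega)
      have h1 : laceRight Γ (k + 1) = m :=
        le_antisymm (h.laceRight_le _) (hm ▸ h.laceRight_mono (Nat.le_succ k))
      rw [← hi, h.laceLeft_eq (hm.trans h1.symm), hm, h1]
    obtain ⟨e', he', h1, h2⟩ := hcon.2.2.1 (laceRight Γ k) (h.laceRight_pos k)
      (lt_of_le_of_ne (h.laceRight_le k) hlt)
    rw [Finset.mem_erase] at he'
    obtain ⟨j, rfl⟩ := h.mem_laceOf.1 he'.2
    apply he'.1
    have h3 : laceRight Γ j ≤ laceRight Γ (k + 1) := le_laceRight_succ (h.mem j) h1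
    have h4 : k < j := by
      by_contra hjk
      have := h.laceRight_mono (not_lt.1 hjk)
      simp only at h2
      omega
    have h5 : laceRight Γ (k + 1) ≤ laceRight Γ j := h.laceRight_mono h4
    have h6 := le_antisymm h3 h5
    rw [← hi, h.laceLeft_eq h6, h6]

/-- An edge of `L` that is not selected could be removed without loss of connectedness, against
minimality. -/
theorem IsLace.laceOf_eq {L : Finset (ℕ × ℕ)} (h : IsLace m L) : laceOf m L = L := by
  refine le_antisymm h.1.laceOf_subset fun e he => ?_
  by_contra hne
  refine h.2 e he (h.1.laceOf_connected.mono (fun f hf => ?_) ((Finset.erase_subset _ _).trans h.1.1))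
  exact Finset.mem_erase.2 ⟨fun heq => hne (heq ▸ hf), h.1.laceOf_subset hf⟩

/-- The lace algorithm gives the same result on every graph between `Γ` and its lace. -/
theorem LaceConnected.sandwich (h : LaceConnected m Γ) {Γ' : Finset (ℕ × ℕ)} (hs : Γ' ⊆ Γ)
    (hl : laceOf m Γ ⊆ Γ') (i : ℕ) :
    laceRight Γ' i = laceRight Γ i ∧ laceLeft Γ' i = laceLeft Γ i := by
  have hmem : ∀ i, (laceLeft Γ i, laceRight Γ i) ∈ Γ' := fun i => hl (h.mem_laceOf.2 ⟨i, rfl⟩)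
  induction i with
  | zero =>
    refine ⟨le_antisymm ?_ (le_laceRight_zero (hmem 0)), rfl⟩
    exact Finset.sup_mono (Finset.filter_subset_filter _ hs)
  | succ i ih =>
    have h1 : laceRight Γ' (i + 1) = laceRight Γ (i + 1) := by
      refine le_antisymm ?_ (le_laceRight_succ (hmem (i + 1)) ?_)
      · rw [laceRight, laceRight, ih.1]
        exact Finset.sup_mono (Finset.filter_subset_filter _ hs)
      · rw [ih.1]; exact h.laceLeft_succ_lt i
    refine ⟨h1, le_antisymm ?_ ?_⟩
    · refine Nat.sInf_le (m := laceLeft Γ (i + 1)) ?_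
      rw [Set.mem_ofPred_eq, h1]
      exact hmem (i + 1)
    · have h2 : (laceLeft Γ' (i + 1), laceRight Γ' (i + 1)) ∈ Γ' :=
        Nat.sInf_mem (s := {s | (s, laceRight Γ' (i + 1)) ∈ Γ'})
          ⟨_, by rw [Set.mem_ofPred_eq, h1]; exact hmem (i + 1)⟩
      refine Nat.sInf_le (m := laceLeft Γ' (i + 1)) ?_
      rw [Set.mem_ofPred_eq, ← h1]
      exact hs h2

theorem LaceConnected.laceOf_congr {Γ' : Finset (ℕ × ℕ)} (h : LaceConnected m Γ)
    (h' : LaceConnected m Γ')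
    (heq : ∀ i, laceRight Γ' i = laceRight Γ i ∧ laceLeft Γ' i = laceLeft Γ i) :
    laceOf m Γ' = laceOf m Γ := by
  ext e
  rw [h.mem_laceOf, h'.mem_laceOf]
  simp only [(heq _).1, (heq _).2]

/-- Compatibility is a condition on single edges, yet it passes to sets: each step of the algorithm
is a maximum or minimum over edges, so a changed choice would already be caused by one edge of `T`.
-/
theorem IsLace.laceOf_union {L T : Finset (ℕ × ℕ)} (h : IsLace m L) (hT : T ⊆ compatible m L) :
    LaceConnected m (L ∪ T) ∧ laceOf m (L ∪ T) = L := by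
  have hE : L ∪ T ⊆ edgesOn m :=
    Finset.union_subset h.1.1 (hT.trans (Finset.filter_subset _ _))
  have hc : LaceConnected m (L ∪ T) := h.1.mono Finset.subset_union_left hE
  refine ⟨hc, ?_⟩
  have hins : ∀ e ∈ T, LaceConnected m (insert e L) ∧
      ∀ i, laceRight L i = laceRight (insert e L) i ∧ laceLeft L i = laceLeft (insert e L) i := by
    intro e he
    have hcomp := hT he
    rw [compatible, Finset.mem_filter] at hcomp
    have hci : LaceConnected m (insert e L) := h.1.mono (Finset.subset_insert _ _)
      (Finset.insert_subset hcomp.1 h.1.1)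
    exact ⟨hci, hci.sandwich (Finset.subset_insert _ _) (by rw [hcomp.2.2])⟩
  have hseq : ∀ i, laceRight (L ∪ T) i = laceRight L i ∧ laceLeft (L ∪ T) i = laceLeft L i := by
    intro i
    induction i with
    | zero =>
      refine ⟨le_antisymm ?_ ?_, rfl⟩
      · refine Finset.sup_le fun e he => ?_
        rw [Finset.mem_filter, Finset.mem_union] at he
        obtain ⟨s, t⟩ := e
        obtain ⟨he | he, h0⟩ := he
        · simp only at h0; subst h0; exact le_laceRight_zero he
        · rw [((hins _ he).2 0).1]
          simp only at h0; subst h0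
          exact le_laceRight_zero (Finset.mem_insert_self _ _)
      · exact Finset.sup_mono (Finset.filter_subset_filter _ Finset.subset_union_left)
    | succ i ih =>
      have h1 : laceRight (L ∪ T) (i + 1) = laceRight L (i + 1) := by
        apply le_antisymm
        · refine Finset.sup_le fun e he => ?_
          rw [Finset.mem_filter, Finset.mem_union, ih.1] at he
          obtain ⟨s, t⟩ := e
          obtain ⟨he | he, h0⟩ := he
          · exact le_laceRight_succ he h0
          · rw [((hins _ he).2 i).1] at h0
            rw [((hins _ he).2 (i + 1)).1]
            exact le_laceRight_succ (Finset.mem_insert_self _ _) h0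
        · rw [laceRight, laceRight, ih.1]
          exact Finset.sup_mono (Finset.filter_subset_filter _ Finset.subset_union_left)
      refine ⟨h1, le_antisymm ?_ ?_⟩
      · refine Nat.sInf_le (m := laceLeft L (i + 1)) ?_
        rw [Set.mem_ofPred_eq, h1]
        exact Finset.mem_union_left _ (h.1.mem (i + 1))
      · have h2 := hc.mem (i + 1)
        rcases Finset.mem_union.1 h2 with h2 | h2
        · refine Nat.sInf_le (m := laceLeft (L ∪ T) (i + 1)) ?_
          rw [Set.mem_ofPred_eq, ← h1]
          exact h2
        · rw [((hins _ h2).2 (i + 1)).2]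
          refine Nat.sInf_le (m := laceLeft (L ∪ T) (i + 1)) ?_
          rw [Set.mem_ofPred_eq, ← ((hins _ h2).2 (i + 1)).1, ← h1]
          exact Finset.mem_insert_self _ _
  rw [h.1.laceOf_congr hc hseq, h.laceOf_eq]

/-- Adding one edge of `Γ` to the lace of `Γ` gives a graph between the two, to which `sandwich`
applies. -/
theorem LaceConnected.sdiff_subset_compatible (h : LaceConnected m Γ) :
    Γ \ laceOf m Γ ⊆ compatible m (laceOf m Γ) := by
  intro e he
  rw [Finset.mem_sdiff] at he
  rw [compatible, Finset.mem_filter]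
  have hsub : insert e (laceOf m Γ) ⊆ Γ := Finset.insert_subset he.1 h.laceOf_subset
  have hc : LaceConnected m (insert e (laceOf m Γ)) :=
    h.laceOf_connected.mono (Finset.subset_insert _ _) (hsub.trans h.1)
  exact ⟨h.1 he.1, he.2, h.laceOf_congr hc (h.sandwich hsub (Finset.subset_insert _ _))⟩

theorem disjoint_compatible (L : Finset (ℕ × ℕ)) : Disjoint L (compatible m L) := by
  rw [Finset.disjoint_left]
  intro e he he'
  rw [compatible, Finset.mem_filter] at he'
  exact he'.2.1 he

/-- The connected graphs on `{0, …, m}`. -/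
def connectedGraphs (m : ℕ) : Finset (Finset (ℕ × ℕ)) :=
  (edgesOn m).powerset.filter (LaceConnected m)

/-- Resummation of connected graphs into laces and compatible edges. -/
theorem sum_connectedGraphs {A : Type*} [CommRing A] (m : ℕ) (U : ℕ × ℕ → A) :
    ∑ Γ ∈ connectedGraphs m, ∏ e ∈ Γ, U e =
      ∑ L ∈ (edgesOn m).powerset.filter (IsLace m),
        (∏ e ∈ L, U e) * ∏ e ∈ compatible m L, (1 + U e) := by
  rw [← Finset.sum_fiberwise_of_maps_to (s := connectedGraphs m) (g := laceOf m)
    (t := (edgesOn m).powerset.filter (IsLace m))]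
  · refine Finset.sum_congr rfl fun L hL => ?_
    rw [Finset.mem_filter] at hL
    have hlace := hL.2
    rw [Finset.prod_one_add, Finset.mul_sum]
    -- The graphs with lace `L` are exactly the sets `L ∪ T` with `T ⊆ compatible m L`.
    refine Finset.sum_bij' (fun Γ _ => Γ \ L) (fun T _ => L ∪ T) ?_ ?_ ?_ ?_ ?_
    · intro Γ hΓ
      simp only [connectedGraphs, Finset.mem_filter] at hΓ
      rw [Finset.mem_powerset, ← hΓ.2]
      exact hΓ.1.2.sdiff_subset_compatible
    · intro T hT
      rw [Finset.mem_powerset] at hT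
      have := hlace.laceOf_union hT
      simp only [connectedGraphs, Finset.mem_filter, Finset.mem_powerset]
      exact ⟨⟨this.1.1, this.1⟩, this.2⟩
    · intro Γ hΓ
      simp only [connectedGraphs, Finset.mem_filter] at hΓ
      have hsub : L ⊆ Γ := by
        rw [← hΓ.2]; exact hΓ.1.2.laceOf_subset
      exact Finset.union_sdiff_of_subset hsub
    · intro T hT
      rw [Finset.mem_powerset] at hT
      exact Finset.union_sdiff_cancel_left ((disjoint_compatible L).mono_right hT)
    · intro Γ hΓ
      simp only [connectedGraphs, Finset.mem_filter] at hΓ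
      have hsub : L ⊆ Γ := by
        rw [← hΓ.2]; exact hΓ.1.2.laceOf_subset
      rw [mul_comm, Finset.prod_sdiff hsub]
  · intro Γ hΓ
    simp only [connectedGraphs, Finset.mem_filter, Finset.mem_powerset] at hΓ ⊢
    exact ⟨hΓ.2.laceOf_subset.trans hΓ.1, hΓ.2.isLace_laceOf⟩

theorem IsLace.card_mem_Icc {L : Finset (ℕ × ℕ)} (h : IsLace m L) : L.card ∈ Finset.Icc 1 m := by
  rw [Finset.mem_Icc]
  constructor
  · obtain ⟨a, ha⟩ := h.1.2.2.2.1
    exact Finset.card_pos.2 ⟨_, ha⟩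
  · rw [← h.laceOf_eq, laceOf]
    exact Finset.card_image_le.trans ((Finset.card_filter_le _ _).trans (by simp))

theorem sum_laces {A : Type*} [AddCommMonoid A] (m : ℕ) (f : ℕ → Finset (ℕ × ℕ) → A) :
    ∑ N ∈ Finset.Icc 1 m, ∑ L ∈ laces N m, f N L =
      ∑ L ∈ (edgesOn m).powerset.filter (IsLace m), f L.card L := by
  rw [← Finset.sum_fiberwise_of_maps_to (g := Finset.card) (t := Finset.Icc 1 m)]
  · refine Finset.sum_congr rfl fun N _ => ?_
    have : laces N m = ((edgesOn m).powerset.filter (IsLace m)).filter (fun L => L.card = N) := by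
      ext L; simp [laces, and_assoc]
    rw [this]
    refine Finset.sum_congr rfl fun L hL => ?_
    rw [(Finset.mem_filter.1 hL).2]
  · intro L hL
    exact (Finset.mem_filter.1 hL).2.card_mem_Icc

end LaceTheory

end LWW

end

noncomputable section

namespace LWW

/-! ### Cutting graphs at the first uncovered point -/

section Breakpoints

open scoped Classical

variable {m n : ℕ} {A : Type*} [CommRing A]

/-- Every interior point of `{0, …, m}` is covered by an edge of `Γ`. -/
def Unbroken (m : ℕ) (Γ : Finset (ℕ × ℕ)) : Prop :=
  ∀ j, 0 < j → j < m → ∃ e ∈ Γ, e.1 < j ∧ j < e.2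

/-- For `m ≥ 2` the endpoint conditions are automatic: an edge covering `1` starts at `0`, and one
covering `m - 1` ends at `m`. -/
theorem laceConnected_iff_unbroken {Γ : Finset (ℕ × ℕ)} (hm : 2 ≤ m) (hΓ : Γ ⊆ edgesOn m) :
    LaceConnected m Γ ↔ Unbroken m Γ := by
  refine ⟨fun h => h.2.2.1, fun h => ⟨hΓ, by omega, h, ?_, ?_⟩⟩
  · obtain ⟨e, he, h1, h2⟩ := h 1 (by omega) (by omega)
    refine ⟨e.2, ?_⟩
    rw [show (0 : ℕ) = e.1 by omega]; exact he
  · obtain ⟨e, he, h1, h2⟩ := h (m - 1) (by omega) (by omega)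
    have := mem_edgesOn.1 (hΓ he)
    refine ⟨e.1, ?_⟩
    rw [show m = e.2 by omega]; exact he

/-- The sum over the graphs that cover `{0, …, m}`. -/
def unbrokenSum (m : ℕ) (U : ℕ × ℕ → A) : A :=
  ∑ Γ ∈ (edgesOn m).powerset.filter (Unbroken m), ∏ e ∈ Γ, U e

/-- There is no interior point to cover, so the empty graph counts as well. This is the source of
the nearest-neighbour term `zα`. -/
theorem unbrokenSum_one (U : ℕ × ℕ → A) : unbrokenSum 1 U = 1 + U (0, 1) := by
  have h1 : edgesOn 1 = {(0, 1)} := by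
    ext ⟨a, b⟩
    rw [mem_edgesOn, Finset.mem_singleton, Prod.mk.injEq]
    simp only; omega
  have h2 : (edgesOn 1).powerset.filter (Unbroken 1) = (edgesOn 1).powerset := by
    refine Finset.filter_true_of_mem fun Γ _ j h0 h => by omega
  rw [unbrokenSum, h2, ← Finset.prod_one_add, h1, Finset.prod_singleton]

theorem unbrokenSum_eq_connected (hm : 2 ≤ m) (U : ℕ × ℕ → A) :
    unbrokenSum m U = ∑ Γ ∈ connectedGraphs m, ∏ e ∈ Γ, U e := by
  rw [unbrokenSum, connectedGraphs]
  refine Finset.sum_congr (Finset.filter_congr fun Γ hΓ => ?_) fun _ _ => rfl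
  exact (laceConnected_iff_unbroken hm (Finset.mem_powerset.1 hΓ)).symm

theorem exists_breakpoint (Γ : Finset (ℕ × ℕ)) :
    ∃ m, 0 < m ∧ ∀ e ∈ Γ, ¬ (e.1 < m ∧ m < e.2) := by
  refine ⟨Γ.sup Prod.snd + 1, by omega, fun e he h => ?_⟩
  have := Finset.le_sup (f := Prod.snd) he
  omega

/-- The first point, after `0`, that is not covered by an edge. -/
def breakpoint (Γ : Finset (ℕ × ℕ)) : ℕ := Nat.find (exists_breakpoint Γ)

theorem breakpoint_eq_iff (Γ : Finset (ℕ × ℕ)) :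
    breakpoint Γ = m ↔ (0 < m ∧ ∀ e ∈ Γ, ¬ (e.1 < m ∧ m < e.2)) ∧ Unbroken m Γ := by
  rw [breakpoint, Nat.find_eq_iff]
  refine and_congr_right fun _ => ?_
  constructor
  · intro h j h0 hj
    have := h j hj
    push Not at this
    obtain ⟨e, he, h1, h2⟩ := this h0
    exact ⟨e, he, h1, h2⟩
  · intro h j hj ⟨h0, hcon⟩
    obtain ⟨e, he, h1⟩ := h j h0 hj
    exact hcon e he h1

theorem prod_edgesOn_filter_le (hmn : m ≤ n) (f : ℕ × ℕ → A) :
    ∏ e ∈ (edgesOn n).filter (fun e => m ≤ e.1), f e =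
      ∏ e ∈ edgesOn (n - m), f (e.1 + m, e.2 + m) := by
  symm
  refine Finset.prod_nbij' (fun e => (e.1 + m, e.2 + m)) (fun e => (e.1 - m, e.2 - m)) ?_ ?_ ?_ ?_ ?_
  · rintro ⟨s, t⟩ h
    rw [mem_edgesOn] at h
    rw [Finset.mem_filter, mem_edgesOn]
    simp only at h ⊢; omega
  · rintro ⟨s, t⟩ h
    rw [Finset.mem_filter, mem_edgesOn] at h
    rw [mem_edgesOn]
    simp only at h ⊢; omega
  · rintro ⟨s, t⟩ _; simp
  · rintro ⟨s, t⟩ h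
    rw [Finset.mem_filter, mem_edgesOn] at h
    simp only at h
    ext <;> simp <;> omega
  · rintro ⟨s, t⟩ _; rfl

/-- Decomposition of a product over edges according to the first uncovered point. -/
theorem prod_edgesOn_eq (hn : 1 ≤ n) (U : ℕ × ℕ → A) :
    ∏ e ∈ edgesOn n, (1 + U e) = ∑ m ∈ Finset.Icc 1 n,
      unbrokenSum m U * ∏ e ∈ edgesOn (n - m), (1 + U (e.1 + m, e.2 + m)) := by
  rw [Finset.prod_one_add, ← Finset.sum_fiberwise_of_maps_to (g := breakpoint)
    (t := Finset.Icc 1 n)]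
  · refine Finset.sum_congr rfl fun m hm => ?_
    rw [Finset.mem_Icc] at hm
    rw [← prod_edgesOn_filter_le hm.2 (fun e => 1 + U e), Finset.prod_one_add, unbrokenSum,
      Finset.sum_mul_sum, ← Finset.sum_product']
    -- No edge straddles the first uncovered point `m`, so a graph is a covering graph on `{0, …,
    -- m}` together with an arbitrary one on `{m, …, n}`.
    refine Finset.sum_bij' (fun Γ _ => (Γ.filter (fun e => e.2 ≤ m), Γ.filter (fun e => m ≤ e.1)))
      (fun p _ => p.1 ∪ p.2) ?_ ?_ ?_ ?_ ?_
    · intro Γ hΓ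
      rw [Finset.mem_filter, breakpoint_eq_iff, Finset.mem_powerset] at hΓ
      obtain ⟨hE, ⟨h0, hb⟩, hu⟩ := hΓ
      rw [Finset.mem_product, Finset.mem_filter, Finset.mem_powerset, Finset.mem_powerset]
      refine ⟨⟨fun e he => ?_, fun j h0 hj => ?_⟩, Finset.filter_subset_filter _ hE⟩
      · rw [Finset.mem_filter] at he
        have := mem_edgesOn.1 (hE he.1)
        exact mem_edgesOn.2 ⟨this.1, he.2⟩
      · obtain ⟨e, he, h1, h2⟩ := hu j h0 hj
        refine ⟨e, Finset.mem_filter.2 ⟨he, ?_⟩, h1, h2⟩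
        have := hb e he
        omega
    · rintro ⟨Γ₁, Γ₂⟩ hp
      rw [Finset.mem_product, Finset.mem_filter, Finset.mem_powerset, Finset.mem_powerset] at hp
      simp only at hp ⊢
      obtain ⟨⟨h1, hu⟩, h2⟩ := hp
      rw [Finset.mem_filter, breakpoint_eq_iff, Finset.mem_powerset]
      refine ⟨fun e he => ?_, ⟨hm.1, fun e he => ?_⟩, fun j h0 hj => ?_⟩
      · rcases Finset.mem_union.1 he with he | he
        · have := mem_edgesOn.1 (h1 he)
          exact mem_edgesOn.2 ⟨this.1, by omega⟩
        · exact (Finset.mem_filter.1 (h2 he)).1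
      · rcases Finset.mem_union.1 he with he | he
        · have := mem_edgesOn.1 (h1 he); omega
        · have := (Finset.mem_filter.1 (h2 he)).2; omega
      · obtain ⟨e, he, h⟩ := hu j h0 hj
        exact ⟨e, Finset.mem_union_left _ he, h⟩
    · intro Γ hΓ
      rw [Finset.mem_filter, breakpoint_eq_iff, Finset.mem_powerset] at hΓ
      obtain ⟨hE, ⟨h0, hb⟩, hu⟩ := hΓ
      simp only
      rw [← Finset.filter_or]
      refine Finset.filter_true_of_mem fun e he => ?_
      have := hb e he
      omega
    · rintro ⟨Γ₁, Γ₂⟩ hp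
      rw [Finset.mem_product, Finset.mem_filter, Finset.mem_powerset, Finset.mem_powerset] at hp
      simp only at hp ⊢
      obtain ⟨⟨h1, hu⟩, h2⟩ := hp
      have hE1 : ∀ e ∈ Γ₁, e.1 < e.2 ∧ e.2 ≤ m := fun e he => mem_edgesOn.1 (h1 he)
      have hE2 : ∀ e ∈ Γ₂, e.1 < e.2 ∧ m ≤ e.1 := fun e he =>
        ⟨(mem_edgesOn.1 (Finset.mem_filter.1 (h2 he)).1).1, (Finset.mem_filter.1 (h2 he)).2⟩
      ext e
      · simp only [Finset.mem_filter, Finset.mem_union]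
        refine ⟨?_, fun h => ⟨Or.inl h, (hE1 e h).2⟩⟩
        rintro ⟨h | h, h'⟩
        · exact h
        · have := hE2 e h; omega
      · simp only [Finset.mem_filter, Finset.mem_union]
        refine ⟨?_, fun h => ⟨Or.inr h, (hE2 e h).2⟩⟩
        rintro ⟨h | h, h'⟩
        · have := hE1 e h; omega
        · exact h
    · intro Γ hΓ
      rw [Finset.mem_filter, breakpoint_eq_iff, Finset.mem_powerset] at hΓ
      obtain ⟨hE, ⟨h0, hb⟩, hu⟩ := hΓ
      simp only
      rw [← Finset.prod_union]
      · rw [← Finset.filter_or]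
        congr 1
        symm
        refine Finset.filter_true_of_mem fun e he => ?_
        have := hb e he
        omega
      · rw [Finset.disjoint_left]
        intro e h1 h2
        rw [Finset.mem_filter] at h1 h2
        have := mem_edgesOn.1 (hE h1.1)
        omega
  · intro Γ hΓ
    rw [Finset.mem_powerset] at hΓ
    have hb := Nat.find_min' (exists_breakpoint Γ) (m := n) ⟨hn, fun e he h => by
      have := mem_edgesOn.1 (hΓ he); omega⟩
    have hp := (Nat.find_spec (exists_breakpoint Γ)).1
    rw [Finset.mem_Icc]
    exact ⟨hp, hb⟩

end Breakpoints

end LWW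

end

noncomputable section

namespace LWW

/-! ### Unconditional products -/

section Products

open scoped Classical

/-- Fibrewise convergence suffices here because only finitely many fibres are nontrivial: `f` is a
finite product of functions, each supported on one fibre. -/
theorem hasProd_of_fibers {ι β : Type*} {f : ι × β → ℝ} {s : Finset ι} {a : ι → ℝ}
    (h : ∀ i ∈ s, HasProd (fun b => f (i, b)) (a i)) (h1 : ∀ i ∉ s, ∀ b, f (i, b) = 1) :
    HasProd f (∏ i ∈ s, a i) := by
  have h2 : f = fun p => ∏ i ∈ s, if p.1 = i then f p else 1 := by
    ext ⟨j, b⟩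
    rw [Finset.prod_ite_eq]
    split_ifs with hj
    · rfl
    · exact h1 j hj b
  rw [h2]
  refine hasProd_prod fun i hi => ?_
  have hinj : Function.Injective (fun b : β => (i, b)) := fun b b' h => (Prod.ext_iff.1 h).2
  refine (hinj.hasProd_iff ?_).1 ?_
  · rintro ⟨j, b⟩ hj
    refine if_neg fun hji => hj ⟨b, ?_⟩
    simp only at hji
    rw [hji]
  · convert h i hi using 1
    ext b
    simp

theorem hasProd_option {β : Type*} {g : Option β → ℝ} {a : ℝ}
    (h : HasProd (fun b => g (some b)) a) : HasProd g (g none * a) := by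
  have h1 : g = fun o => (if o = none then g none else 1) * (if o = none then 1 else g o) := by
    ext o; cases o <;> simp
  rw [h1]
  refine HasProd.mul ?_ ?_
  · convert hasProd_ite_eq (none : Option β) (g none) using 1
    simp
  · refine ((Option.some_injective β).hasProd_iff ?_).1 ?_
    · intro o ho
      cases o with
      | none => simp
      | some b => exact absurd ⟨b, rfl⟩ ho
    · have h2 : (fun o => if o = none then 1 else g o) ∘ some = fun b => g (some b) := by
        ext b; simp
      rw [h2]
      exact h

end Products

/-! ### From loops met by a path to interactions of pairs -/

section Interaction

open scoped NNReal Classical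

variable {d : ℕ} {lam : SAP d → ℝ} {z : ℝ≥0}

/-- The closed walk obtained from `X` by an isometry. -/
def mapLoop (f : Site d ≃ Site d) (hf : IsIsometry f) (X : Loop d) : Loop d :=
  ⟨⟨X.1.verts.map f, by simpa using X.1.ne_nil, (isChain_map_isometry hf _).2 X.1.chain⟩, by
    have h1 : (⟨X.1.verts.map f, by simpa using X.1.ne_nil,
      (isChain_map_isometry hf _).2 X.1.chain⟩ : Walk d).length = X.1.length := by
      simp [Walk.length]
    refine ⟨?_, by rw [h1]; exact X.2.2⟩
    have hs := Walk.head?_verts (⟨X.1.verts.map f, by simpa using X.1.ne_nil,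
      (isChain_map_isometry hf _).2 X.1.chain⟩ : Walk d)
    have ht := Walk.getLast?_verts (⟨X.1.verts.map f, by simpa using X.1.ne_nil,
      (isChain_map_isometry hf _).2 X.1.chain⟩ : Walk d)
    simp only [List.head?_map, List.getLast?_map, X.1.head?_verts, X.1.getLast?_verts,
      Option.map_some, Option.some.injEq] at hs ht
    rw [Walk.Closed, ← hs, ← ht, X.2.1]⟩

theorem mem_range_mapLoop (f : Site d ≃ Site d) (hf : IsIsometry f) (X : Loop d) (v : Site d) :
    f v ∈ (mapLoop f hf X).1.range ↔ v ∈ X.1.range := by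
  simp [mapLoop, Walk.range]

theorem isIsometry_symm {f : Site d ≃ Site d} (hf : IsIsometry f) : IsIsometry f.symm := by
  intro x y
  rw [← hf]; simp

/-- The action of an isometry on closed walks. -/
def loopEquiv (f : Site d ≃ Site d) (hf : IsIsometry f) : Loop d ≃ Loop d where
  toFun := mapLoop f hf
  invFun := mapLoop f.symm (isIsometry_symm hf)
  left_inv X := by
    apply Subtype.ext; apply Walk.ext_verts; simp [mapLoop]
  right_inv X := by
    apply Subtype.ext; apply Walk.ext_verts; simp [mapLoop]

theorem loopNu_mapLoop (hnonneg : ∀ η, 0 ≤ lam η) (hsymm : SymmetricActivities lam)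
    (f : Site d ≃ Site d) (hf : IsIsometry f) (X : Loop d) :
    loopNu lam z (mapLoop f hf X) = loopNu lam z X := by
  have h1 : (mapLoop f hf X).1.length = X.1.length := by simp [mapLoop, Walk.length]
  rw [loopNu, loopNu, h1, weight_eq_chainWeight hnonneg, weight_eq_chainWeight hnonneg]
  congr 2
  exact chainWeight_map_isometry hsymm z hf X.1.verts

theorem tsum_loopNu_isometry (hnonneg : ∀ η, 0 ≤ lam η) (hsymm : SymmetricActivities lam)
    {f : Site d ≃ Site d} (hf : IsIsometry f) {P Q : Set (Loop d)}
    (h : ∀ X, mapLoop f hf X ∈ Q ↔ X ∈ P) :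
    ∑' X, Q.indicator (loopNu lam z) X = ∑' X, P.indicator (loopNu lam z) X := by
  rw [← (loopEquiv f hf).tsum_eq]
  apply tsum_congr
  intro X
  change Q.indicator (loopNu lam z) (mapLoop f hf X) = _
  rw [Set.indicator_apply, Set.indicator_apply, loopNu_mapLoop hnonneg hsymm]
  simp only [h]

theorem tsum_through_eq (hnonneg : ∀ η, 0 ≤ lam η) (hsymm : SymmetricActivities lam)
    (v : Site d) : ∑' X, (through v).indicator (loopNu lam z) X =
      ∑' X, (through 0).indicator (loopNu lam z) X := by
  refine tsum_loopNu_isometry hnonneg hsymm (isIsometry_translate v) fun X => ?_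
  have := mem_range_mapLoop (Equiv.addRight v) (isIsometry_translate v) X 0
  simpa [through] using this

/-- The closed walks that visit `p s` and `p t`, and none of the `p j` with `s < j < t`. -/
def consecutive (p : ℕ → Site d) (s t : ℕ) : Set (Loop d) :=
  {X | p s ∈ X.1.range ∧ p t ∈ X.1.range ∧ ∀ j, s < j → j < t → p j ∉ X.1.range}

/-- The factor `1 - I(s, t)` for a path `p`. -/
def pairFactor (lam : SAP d → ℝ) (z : ℝ) (p : ℕ → Site d) (e : ℕ × ℕ) : ℝ :=
  if p e.1 = p e.2 then 0
  else Real.exp (-∑' X, (consecutive p e.1 e.2).indicator (loopNu lam z) X)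

theorem summable_consecutive (hnonneg : ∀ η, 0 ≤ lam η) (hsymm : SymmetricActivities lam)
    (hχ : FiniteSusceptibility lam z) (p : ℕ → Site d) (s t : ℕ) :
    Summable ((consecutive p s t).indicator (loopNu lam z)) :=
  summable_of_subset_through hnonneg hsymm hχ (v := p s) fun _ h => h.1

theorem laceInteraction_eq (hnonneg : ∀ η, 0 ≤ lam η) (hsymm : SymmetricActivities lam)
    (hχ : FiniteSusceptibility lam z) (ω : Walk d) (s t : ℕ) :
    laceInteraction lam z ω s t = 1 - pairFactor lam z ω.vert (s, t) := by
  rw [laceInteraction, pairFactor]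
  by_cases h : ω.vert s = ω.vert t
  · simp [h]
  · rw [if_neg h, if_neg h,
      ← (hasProd_one_sub_act_div (summable_consecutive hnonneg hsymm hχ ω.vert s t)).tprod_eq]
    congr 1
    apply tprod_congr
    intro X
    by_cases hX : X ∈ consecutive ω.vert s t
    · rw [if_pos hX, if_pos (show _ ∧ _ from hX), mul_one]
    · rw [if_neg hX, if_neg (show ¬ (_ ∧ _) from hX), mul_zero, sub_zero]

/-- If there is a visit up to time `n`, exactly one of the visits is the last. -/
theorem sum_last_visit (v : ℕ → Prop) (n : ℕ) :
    ∑ s ∈ Finset.range (n + 1), (if v s ∧ ∀ j, s < j → j < n + 1 → ¬ v j then 1 else 0) =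
      if ∃ j ≤ n, v j then 1 else 0 := by
  induction n with
  | zero =>
    simp only [zero_add, Finset.range_one, Finset.sum_singleton, nonpos_iff_eq_zero,
      exists_eq_left]
    have : (v 0 ∧ ∀ j, 0 < j → j < 1 → ¬ v j) ↔ v 0 := ⟨fun h => h.1, fun h => ⟨h, by omega⟩⟩
    simp only [this]
  | succ n ih =>
    rw [Finset.sum_range_succ]
    by_cases hv : v (n + 1)
    · rw [if_pos ⟨hv, by omega⟩, if_pos ⟨n + 1, le_rfl, hv⟩, Finset.sum_eq_zero]
      intro s hs
      rw [Finset.mem_range] at hs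
      exact if_neg fun h => h.2 (n + 1) (by omega) (by omega) hv
    · rw [if_neg (fun h => hv h.1), add_zero]
      have h1 : (∃ j ≤ n + 1, v j) ↔ ∃ j ≤ n, v j := by
        constructor
        · rintro ⟨j, hj, h⟩
          refine ⟨j, ?_, h⟩
          rcases Nat.lt_or_ge n j with h' | h'
          · rw [show j = n + 1 by omega] at h; exact absurd h hv
          · exact h'
        · rintro ⟨j, hj, h⟩; exact ⟨j, by omega, h⟩
      simp only [h1]
      rw [← ih]
      refine Finset.sum_congr rfl fun s hs => ?_
      have h2 : (v s ∧ ∀ j, s < j → j < n + 1 + 1 → ¬ v j) ↔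
          (v s ∧ ∀ j, s < j → j < n + 1 → ¬ v j) := by
        refine and_congr_right fun _ => ⟨fun h j h1 h2 => h j h1 (by omega), fun h j h1 h2 => ?_⟩
        rcases Nat.lt_or_ge j (n + 1) with h' | h'
        · exact h j h1 h'
        · rw [show j = n + 1 by omega]; exact hv
      simp only [h2]

theorem edgesOn_succ (n : ℕ) : edgesOn (n + 1) =
    edgesOn n ∪ (Finset.range (n + 1)).image (fun s => (s, n + 1)) := by
  ext ⟨s, t⟩
  simp only [Finset.mem_union, mem_edgesOn, Finset.mem_image, Finset.mem_range, Prod.mk.injEq]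
  constructor
  · rintro ⟨h1, h2⟩
    rcases Nat.lt_or_ge n t with h | h
    · exact Or.inr ⟨s, by omega, rfl, by omega⟩
    · exact Or.inl ⟨h1, h⟩
  · rintro (h | ⟨a, h1, rfl, rfl⟩) <;> omega

theorem sum_edgesOn_succ {A : Type*} [AddCommMonoid A] (f : ℕ × ℕ → A) (n : ℕ) :
    ∑ e ∈ edgesOn (n + 1), f e = ∑ e ∈ edgesOn n, f e + ∑ s ∈ Finset.range (n + 1), f (s, n + 1) := by
  rw [edgesOn_succ, Finset.sum_union, Finset.sum_image]
  · intro a _ b _ h; exact (Prod.ext_iff.1 h).1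
  · rw [Finset.disjoint_left]
    intro e h1 h2
    rw [mem_edgesOn] at h1
    obtain ⟨s, -, rfl⟩ := Finset.mem_image.1 h2
    simp only at h1; omega

/-- The number of visits exceeds the number of pairs of consecutive visits by one. -/
theorem visits_eq (v : ℕ → Prop) (n : ℕ) :
    (∑ e ∈ edgesOn n, if v e.1 ∧ v e.2 ∧ ∀ j, e.1 < j → j < e.2 → ¬ v j then 1 else 0) +
      (if ∃ j ≤ n, v j then 1 else 0) = ∑ j ∈ Finset.range (n + 1), if v j then 1 else 0 := by
  induction n with
  | zero =>
    have : edgesOn 0 = ∅ := by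
      ext e; rw [mem_edgesOn]; simp; omega
    rw [this, Finset.sum_empty, zero_add, zero_add, Finset.range_one, Finset.sum_singleton]
    simp
  | succ n ih =>
    -- A visit at `n + 1` adds one consecutive pair, with the last earlier visit, unless it is the
    -- very first visit.
    rw [sum_edgesOn_succ, Finset.sum_range_succ _ (n + 1), ← ih, ← sum_last_visit v n]
    by_cases hv : v (n + 1)
    · rw [if_pos hv, if_pos ⟨n + 1, le_rfl, hv⟩]
      simp only [hv, true_and]
    · have h1 : (∃ j ≤ n + 1, v j) ↔ ∃ j ≤ n, v j := by
        constructor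
        · rintro ⟨j, hj, h⟩
          refine ⟨j, ?_, h⟩
          rcases Nat.lt_or_ge n j with h' | h'
          · rw [show j = n + 1 by omega] at h; exact absurd h hv
          · exact h'
        · rintro ⟨j, hj, h⟩; exact ⟨j, by omega, h⟩
      simp only [hv, h1, false_and, and_false, if_false, Finset.sum_const_zero, add_zero]
      rw [sum_last_visit]

theorem indicator_visits (p : ℕ → Site d) (n : ℕ) (X : Loop d) :
    {X : Loop d | ∃ j ≤ n, p j ∈ X.1.range}.indicator (loopNu lam z) X +
      ∑ e ∈ edgesOn n, (consecutive p e.1 e.2).indicator (loopNu lam z) X =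
      ∑ j ∈ Finset.range (n + 1), (through (p j)).indicator (loopNu lam z) X := by
  have h := congrArg (fun k : ℕ => (k : ℝ) * loopNu lam z X)
    (visits_eq (fun j => p j ∈ X.1.range) n)
  simp only [Nat.cast_add, Nat.cast_sum, Nat.cast_ite, Nat.cast_one, Nat.cast_zero, add_mul,
    Finset.sum_mul, ite_mul, one_mul, zero_mul] at h
  have e1 : ∀ e : ℕ × ℕ, X ∈ consecutive p e.1 e.2 ↔ p e.1 ∈ X.1.range ∧ p e.2 ∈ X.1.range ∧
    ∀ j, e.1 < j → j < e.2 → p j ∉ X.1.range := fun _ => Iff.rfl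
  have e2 : ∀ j, X ∈ through (p j) ↔ p j ∈ X.1.range := fun _ => Iff.rfl
  have e3 : X ∈ {X : Loop d | ∃ j ≤ n, p j ∈ X.1.range} ↔ ∃ j ≤ n, p j ∈ X.1.range := Iff.rfl
  simp only [Set.indicator_apply, e1, e2, e3]
  rw [add_comm]
  exact h

theorem tsum_visits (hnonneg : ∀ η, 0 ≤ lam η) (hsymm : SymmetricActivities lam)
    (hχ : FiniteSusceptibility lam z) (p : ℕ → Site d) (n : ℕ) :
    ∑' X, {X : Loop d | ∃ j ≤ n, p j ∈ X.1.range}.indicator (loopNu lam z) X +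
      ∑ e ∈ edgesOn n, ∑' X, (consecutive p e.1 e.2).indicator (loopNu lam z) X =
      ((n + 1 : ℕ) : ℝ) * ∑' X, (through 0).indicator (loopNu lam z) X := by
  have hpt := indicator_visits (lam := lam) (z := z) p n
  have ht : HasSum (fun X => ∑ j ∈ Finset.range (n + 1),
      (through (p j)).indicator (loopNu lam z) X)
      (((n + 1 : ℕ) : ℝ) * ∑' X, (through 0).indicator (loopNu lam z) X) := by
    have h1 : ((n + 1 : ℕ) : ℝ) * ∑' X, (through 0).indicator (loopNu lam z) X =
        ∑ j ∈ Finset.range (n + 1), ∑' X, (through (p j)).indicator (loopNu lam z) X := by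
      rw [Finset.sum_congr rfl (fun j _ => tsum_through_eq hnonneg hsymm (p j)), Finset.sum_const,
        Finset.card_range, nsmul_eq_mul]
    rw [h1]
    exact hasSum_sum fun j _ => (summable_through hnonneg hsymm hχ (p j)).hasSum
  have hc : HasSum (fun X => ∑ e ∈ edgesOn n,
      (consecutive p e.1 e.2).indicator (loopNu lam z) X)
      (∑ e ∈ edgesOn n, ∑' X, (consecutive p e.1 e.2).indicator (loopNu lam z) X) :=
    hasSum_sum fun e _ => (summable_consecutive hnonneg hsymm hχ p e.1 e.2).hasSum
  have hs := ht.sub hc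
  have h2 : (fun X => ∑ j ∈ Finset.range (n + 1), (through (p j)).indicator (loopNu lam z) X -
      ∑ e ∈ edgesOn n, (consecutive p e.1 e.2).indicator (loopNu lam z) X) =
      {X : Loop d | ∃ j ≤ n, p j ∈ X.1.range}.indicator (loopNu lam z) := by
    ext X
    rw [← hpt X, add_sub_cancel_right]
  rw [h2] at hs
  rw [hs.tsum_eq, sub_add_cancel]

/-- The weight of a self-avoiding path in terms of the interaction of pairs. -/
theorem prod_pairFactor (hnonneg : ∀ η, 0 ≤ lam η) (hsymm : SymmetricActivities lam)
    (hχ : FiniteSusceptibility lam z) (p : ℕ → Site d) (n : ℕ)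
    (hp : ∀ i j, i ≤ n → j ≤ n → p i = p j → i = j) :
    Real.exp (∑' X, {X : Loop d | ∃ j ≤ n, p j ∈ X.1.range}.indicator (loopNu lam z) X) =
      alphaZero lam z ^ (n + 1) * ∏ e ∈ edgesOn n, pairFactor lam z p e := by
  have h1 : ∀ e ∈ edgesOn n, pairFactor lam z p e =
      Real.exp (-∑' X, (consecutive p e.1 e.2).indicator (loopNu lam z) X) := by
    intro e he
    rw [mem_edgesOn] at he
    refine if_neg fun h => ?_
    have := hp _ _ (by omega) (by omega) h
    omega
  rw [Finset.prod_congr rfl h1, ← Real.exp_sum, alphaZero_eq_exp hnonneg hsymm hχ,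
    ← Real.exp_nat_mul, ← tsum_visits hnonneg hsymm hχ p n, ← Real.exp_add,
    Finset.sum_neg_distrib, add_neg_cancel_right]

/-- A coincidence kills one of the factors, so the product over pairs itself enforces
self-avoidance. -/
theorem prod_pairFactor_eq_zero (lam : SAP d → ℝ) (z : ℝ) (p : ℕ → Site d) (n : ℕ)
    (hp : ¬ ∀ i j, i ≤ n → j ≤ n → p i = p j → i = j) :
    ∏ e ∈ edgesOn n, pairFactor lam z p e = 0 := by
  push Not at hp
  obtain ⟨i, j, hi, hj, h, hne⟩ := hp
  rcases lt_or_gt_of_ne hne with hij | hij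
  · exact Finset.prod_eq_zero (i := (i, j)) (mem_edgesOn.2 ⟨hij, hj⟩) (if_pos h)
  · exact Finset.prod_eq_zero (i := (j, i)) (mem_edgesOn.2 ⟨hij, hi⟩) (if_pos h.symm)

end Interaction

end LWW

end

noncomputable section

namespace LWW

/-! ### Resummation of the hyperedges with a given span -/

section Hyperedges

open scoped NNReal Classical

variable {d : ℕ} {lam : SAP d → ℝ} {z : ℝ≥0}

/-- The closed walks that visit `p j` for all `j ∈ J`. -/
def allThrough (p : ℕ → Site d) (J : Finset ℕ) : Set (Loop d) := {X | ∀ j ∈ J, p j ∈ X.1.range}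

theorem summable_allThrough (hnonneg : ∀ η, 0 ≤ lam η) (hsymm : SymmetricActivities lam)
    (hχ : FiniteSusceptibility lam z) (p : ℕ → Site d) {J : Finset ℕ} (hJ : J.Nonempty) :
    Summable ((allThrough p J).indicator (loopNu lam z)) := by
  obtain ⟨j, hj⟩ := hJ
  exact summable_of_subset_through hnonneg hsymm hχ (v := p j) fun X h => h j hj

/-- The two cases in the weights are arranged so that `1 + F` is the exponential of `loopNu` for odd
and of `-loopNu` for even cardinality. -/
theorem hasProd_hyperWeight (hnonneg : ∀ η, 0 ≤ lam η) (hsymm : SymmetricActivities lam)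
    (hχ : FiniteSusceptibility lam z) (ω : Walk d) {J : Finset ℕ} (hJ : J.Nonempty) :
    HasProd (fun X => 1 + hyperWeight lam z ω (J, some X))
      (Real.exp (-(-1) ^ J.card * ∑' X, (allThrough ω.vert J).indicator (loopNu lam z) X)) := by
  have hs := summable_allThrough hnonneg hsymm hχ ω.vert hJ
  by_cases h : Odd J.card
  · have h1 := hasProd_one_add_act hs
    rw [h.neg_one_pow, neg_neg, one_mul]
    convert h1 using 1
    ext X
    by_cases hX : X ∈ allThrough ω.vert J
    · have hX' : ∀ j ∈ J, ω.vert j ∈ X.1.range := hX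
      simp only [hyperWeight]
      rw [if_pos h, if_pos hX', if_pos hX, mul_one]
    · have hX' : ¬ ∀ j ∈ J, ω.vert j ∈ X.1.range := hX
      simp only [hyperWeight]
      rw [if_neg hX', if_neg hX, mul_zero, add_zero]
  · have h1 := hasProd_one_sub_act_div hs
    rw [(Nat.not_odd_iff_even.1 h).neg_one_pow, neg_one_mul]
    convert h1 using 1
    ext X
    by_cases hX : X ∈ allThrough ω.vert J
    · have hX' : ∀ j ∈ J, ω.vert j ∈ X.1.range := hX
      simp only [hyperWeight]
      rw [if_neg h, if_pos hX', if_pos hX, mul_one, sub_eq_add_neg]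
    · have hX' : ¬ ∀ j ∈ J, ω.vert j ∈ X.1.range := hX
      simp only [hyperWeight]
      rw [if_neg hX', if_neg hX, mul_zero, add_zero]

/-- The set with minimum `e.1`, maximum `e.2` and remaining elements `J`. -/
def spanned (e : ℕ × ℕ) (J : Finset ℕ) : Finset ℕ := insert e.1 (insert e.2 J)

theorem hyperSpan_spanned {e : ℕ × ℕ} (he : e.1 < e.2) {J : Finset ℕ}
    (hJ : J ⊆ Finset.Ioo e.1 e.2) (o : Option (Loop d)) : hyperSpan (spanned e J, o) = e := by
  have hmem : ∀ x ∈ spanned e J, e.1 ≤ x ∧ x ≤ e.2 := by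
    intro x hx
    simp only [spanned, Finset.mem_insert] at hx
    rcases hx with rfl | rfl | hx
    · omega
    · omega
    · have := Finset.mem_Ioo.1 (hJ hx); omega
  have h1 : e.1 ∈ spanned e J := by simp [spanned]
  have h2 : e.2 ∈ spanned e J := by simp [spanned]
  ext
  · exact IsLeast.csInf_eq ⟨h1, fun x hx => (hmem x hx).1⟩
  · exact IsGreatest.csSup_eq ⟨h2, fun x hx => (hmem x hx).2⟩

theorem exists_spanned {K : Finset ℕ} (hK : K.Nonempty) {e : ℕ × ℕ}
    {o : Option (Loop d)} (h : hyperSpan (K, o) = e) :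
    K \ {e.1, e.2} ⊆ Finset.Ioo e.1 e.2 ∧ spanned e (K \ {e.1, e.2}) = K := by
  subst h
  have h1 : (hyperSpan (K, o)).1 ∈ K := Nat.sInf_mem (s := (K : Set ℕ)) hK
  have h2 : (hyperSpan (K, o)).2 ∈ K := Nat.sSup_mem (s := (K : Set ℕ)) hK K.bddAbove
  have h3 : ∀ x ∈ K, (hyperSpan (K, o)).1 ≤ x := fun x hx => Nat.sInf_le (s := (K : Set ℕ)) hx
  have h4 : ∀ x ∈ K, x ≤ (hyperSpan (K, o)).2 := fun x hx => le_csSup K.bddAbove hx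
  generalize hyperSpan (K, o) = e at *
  constructor
  · intro x hx
    simp only [Finset.mem_sdiff, Finset.mem_insert, Finset.mem_singleton] at hx
    have := h3 x hx.1
    have := h4 x hx.1
    rw [Finset.mem_Ioo]; omega
  · ext x
    simp only [spanned, Finset.mem_insert, Finset.mem_sdiff, Finset.mem_singleton]
    constructor
    · rintro (rfl | rfl | h)
      · exact h1
      · exact h2
      · exact h.1
    · intro hx; tauto

theorem spanned_sdiff {e : ℕ × ℕ} {J : Finset ℕ} (hJ : J ⊆ Finset.Ioo e.1 e.2) :
    spanned e J \ {e.1, e.2} = J := by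
  ext x
  simp only [spanned, Finset.mem_insert, Finset.mem_sdiff, Finset.mem_singleton]
  constructor
  · tauto
  · intro hx
    have := Finset.mem_Ioo.1 (hJ hx)
    refine ⟨by tauto, by omega⟩

theorem card_spanned {e : ℕ × ℕ} (he : e.1 < e.2) {J : Finset ℕ}
    (hJ : J ⊆ Finset.Ioo e.1 e.2) : (spanned e J).card = J.card + 2 := by
  have h2 : e.2 ∉ J := fun h => by have := Finset.mem_Ioo.1 (hJ h); omega
  have h1 : e.1 ∉ insert e.2 J := by
    rw [Finset.mem_insert]
    rintro (h | h)
    · omega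
    · have := Finset.mem_Ioo.1 (hJ h); omega
  rw [spanned, Finset.card_insert_of_notMem h1, Finset.card_insert_of_notMem h2]

/-- Inclusion-exclusion: for a loop through both end vertices, the alternating sum runs over the
subsets of its visited interior times and vanishes unless there are none. -/
theorem sum_indicator_spanned (p : ℕ → Site d) {e : ℕ × ℕ} (X : Loop d) :
    ∑ J ∈ (Finset.Ioo e.1 e.2).powerset,
      (-1) ^ J.card * (allThrough p (spanned e J)).indicator (loopNu lam z) X =
      (consecutive p e.1 e.2).indicator (loopNu lam z) X := by
  by_cases h : p e.1 ∈ X.1.range ∧ p e.2 ∈ X.1.range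
  · let W := (Finset.Ioo e.1 e.2).filter fun j => p j ∈ X.1.range
    have h1 : ∀ J ∈ (Finset.Ioo e.1 e.2).powerset,
        (-1) ^ J.card * (allThrough p (spanned e J)).indicator (loopNu lam z) X =
        if J ⊆ W then (-1) ^ J.card * loopNu lam z X else 0 := by
      intro J hJ
      rw [Finset.mem_powerset] at hJ
      have h2 : X ∈ allThrough p (spanned e J) ↔ J ⊆ W := by
        constructor
        · intro hX j hj
          exact Finset.mem_filter.2 ⟨hJ hj, hX j (by simp [spanned, hj])⟩
        · intro hX j hj
          simp only [spanned, Finset.mem_insert] at hj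
          rcases hj with rfl | rfl | hj
          · exact h.1
          · exact h.2
          · exact (Finset.mem_filter.1 (hX hj)).2
      by_cases hJW : J ⊆ W
      · rw [if_pos hJW, Set.indicator_of_mem (h2.2 hJW)]
      · rw [if_neg hJW, Set.indicator_of_notMem (fun H => hJW (h2.1 H)), mul_zero]
    rw [Finset.sum_congr rfl h1, ← Finset.sum_filter]
    have h3 : (Finset.Ioo e.1 e.2).powerset.filter (fun J => J ⊆ W) = W.powerset := by
      ext J
      simp only [Finset.mem_filter, Finset.mem_powerset, and_iff_right_iff_imp]
      exact fun hJ => hJ.trans (Finset.filter_subset _ _)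
    rw [h3, ← Finset.sum_mul]
    have h4 : ∑ J ∈ W.powerset, (-1 : ℝ) ^ J.card = if W = ∅ then 1 else 0 := by
      have := congrArg (fun k : ℤ => (k : ℝ)) (Finset.sum_powerset_neg_one_pow_card (x := W))
      simpa using this
    rw [h4]
    by_cases hW : W = ∅
    · have hX : X ∈ consecutive p e.1 e.2 := by
        refine ⟨h.1, h.2, fun j h5 h6 h7 => ?_⟩
        have : j ∈ W := Finset.mem_filter.2 ⟨Finset.mem_Ioo.2 ⟨h5, h6⟩, h7⟩
        rw [hW] at this; simp at this
      rw [if_pos hW, Set.indicator_of_mem hX, one_mul]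
    · have hX : X ∉ consecutive p e.1 e.2 := by
        rintro ⟨-, -, H⟩
        obtain ⟨j, hj⟩ := Finset.nonempty_iff_ne_empty.2 hW
        have hj' := Finset.mem_filter.1 hj
        have := Finset.mem_Ioo.1 hj'.1
        exact H j this.1 this.2 hj'.2
      rw [if_neg hW, Set.indicator_of_notMem hX, zero_mul]
  · rw [Set.indicator_of_notMem (fun H => h ⟨H.1, H.2.1⟩)]
    refine Finset.sum_eq_zero fun J _ => ?_
    rw [Set.indicator_of_notMem, mul_zero]
    intro H
    exact h ⟨H _ (by simp [spanned]), H _ (by simp [spanned])⟩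

variable (lam z) in
/-- The product of the factors `1 + F_{K,X}` for a given `K`. -/
def setFactor (ω : Walk d) (K : Finset ℕ) : ℝ :=
  (if K.card = 2 then 1 + hyperWeight lam z ω (K, none) else 1) *
    Real.exp (-(-1) ^ K.card * ∑' X, (allThrough ω.vert K).indicator (loopNu lam z) X)

theorem prod_setFactor (hnonneg : ∀ η, 0 ≤ lam η) (hsymm : SymmetricActivities lam)
    (hχ : FiniteSusceptibility lam z) (ω : Walk d) {e : ℕ × ℕ} (he : e.1 < e.2) :
    ∏ J ∈ (Finset.Ioo e.1 e.2).powerset, setFactor lam z ω (spanned e J) =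
      pairFactor lam z ω.vert e := by
  simp only [setFactor]
  rw [Finset.prod_mul_distrib, ← Real.exp_sum]
  have h1 : ∏ J ∈ (Finset.Ioo e.1 e.2).powerset, (if (spanned e J).card = 2 then
      1 + hyperWeight lam z ω (spanned e J, none) else 1) =
      if ω.vert e.1 = ω.vert e.2 then 0 else 1 := by
    -- Timelike hyperedges have two elements, so only the empty interior contributes one; it
    -- supplies the hard core factor.
    rw [Finset.prod_eq_single ∅]
    · rw [if_pos (by rw [card_spanned he (by simp)]; rfl)]
      simp only [hyperWeight, spanned, Finset.mem_insert, Finset.notMem_empty, or_false,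
        forall_eq_or_imp, forall_eq, true_and, and_true]
      by_cases h : ω.vert e.1 = ω.vert e.2
      · rw [if_pos ⟨h, h.symm⟩, if_pos h]; ring
      · rw [if_neg (fun H => h H.1), if_neg h]; ring
    · intro J hJ hne
      rw [Finset.mem_powerset] at hJ
      rw [if_neg]
      rw [card_spanned he hJ]
      have := Finset.card_pos.2 (Finset.nonempty_iff_ne_empty.2 hne)
      omega
    · simp
  have h2 : ∑ J ∈ (Finset.Ioo e.1 e.2).powerset, -(-1) ^ (spanned e J).card *
      ∑' X, (allThrough ω.vert (spanned e J)).indicator (loopNu lam z) X =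
      -∑' X, (consecutive ω.vert e.1 e.2).indicator (loopNu lam z) X := by
    have hs : HasSum (fun X => ∑ J ∈ (Finset.Ioo e.1 e.2).powerset, (-1) ^ J.card *
        (allThrough ω.vert (spanned e J)).indicator (loopNu lam z) X)
        (∑ J ∈ (Finset.Ioo e.1 e.2).powerset, (-1) ^ J.card *
          ∑' X, (allThrough ω.vert (spanned e J)).indicator (loopNu lam z) X) :=
      hasSum_sum fun J _ => ((summable_allThrough hnonneg hsymm hχ ω.vert
        ⟨e.1, by simp [spanned]⟩).hasSum).mul_left _
    simp only [sum_indicator_spanned] at hs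
    rw [hs.tsum_eq, ← Finset.sum_neg_distrib]
    refine Finset.sum_congr rfl fun J hJ => ?_
    rw [card_spanned he (Finset.mem_powerset.1 hJ), pow_add]
    ring
  rw [h1, h2, pairFactor]
  by_cases h : ω.vert e.1 = ω.vert e.2
  · rw [if_pos h, if_pos h, zero_mul]
  · rw [if_neg h, if_neg h, one_mul]

/-- The product over the hyperedges with span in `C`. -/
theorem tprod_hyperedges (hnonneg : ∀ η, 0 ≤ lam η) (hsymm : SymmetricActivities lam)
    (hχ : FiniteSusceptibility lam z) (ω : Walk d) {m : ℕ} {C : Finset (ℕ × ℕ)}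
    (hC : C ⊆ edgesOn m) :
    ∏' h : {h : HyperPair d // IsHyperedge m h ∧ hyperSpan h ∈ C},
        (1 + hyperWeight lam z ω h.1) = ∏ e ∈ C, pairFactor lam z ω.vert e := by
  let 𝒥 : Finset (Finset ℕ) := (Finset.range (m + 1)).powerset.filter fun K =>
    K.Nonempty ∧ hyperSpan (d := d) (K, none) ∈ C
  let P : Set (HyperPair d) := {h | IsHyperedge m h ∧ hyperSpan h ∈ C}
  have hmem : ∀ K o, (K, o) ∈ P ↔ K ∈ 𝒥 ∧ (o = none → K.card = 2) := by
    intro K o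
    simp only [P, 𝒥, IsHyperedge, Finset.mem_filter, Finset.mem_powerset, Set.mem_ofPred_eq]
    have : hyperSpan (K, o) = hyperSpan (d := d) (K, none) := rfl
    rw [this]
    tauto
  have hprod : HasProd (P.mulIndicator fun h => 1 + hyperWeight lam z ω h)
      (∏ K ∈ 𝒥, setFactor lam z ω K) := by
    refine hasProd_of_fibers (fun K hK => ?_) (fun K hK o => ?_)
    · have hne : K.Nonempty := (Finset.mem_filter.1 hK).2.1
      have h1 : HasProd (fun X => P.mulIndicator (fun h => 1 + hyperWeight lam z ω h) (K, some X))
          (Real.exp (-(-1) ^ K.card * ∑' X, (allThrough ω.vert K).indicator (loopNu lam z) X)) := by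
        convert hasProd_hyperWeight hnonneg hsymm hχ ω hne using 1
        ext X
        exact Set.mulIndicator_of_mem ((hmem K (some X)).2 ⟨hK, by simp⟩) _
      have h2 := hasProd_option
        (g := fun o => P.mulIndicator (fun h => 1 + hyperWeight lam z ω h) (K, o)) h1
      have h3 : P.mulIndicator (fun h => 1 + hyperWeight lam z ω h) (K, none) =
          if K.card = 2 then 1 + hyperWeight lam z ω (K, none) else 1 := by
        by_cases h : K.card = 2
        · rw [if_pos h, Set.mulIndicator_of_mem ((hmem K none).2 ⟨hK, fun _ => h⟩)]
        · rw [if_neg h, Set.mulIndicator_of_notMem (fun H => h (((hmem K none).1 H).2 rfl))]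
      rw [h3] at h2
      exact h2
    · exact Set.mulIndicator_of_notMem (fun H => hK ((hmem K o).1 H).1) _
  have h1 : ∏' h : {h : HyperPair d // IsHyperedge m h ∧ hyperSpan h ∈ C},
        (1 + hyperWeight lam z ω h.1) = ∏ K ∈ 𝒥, setFactor lam z ω K := by
    rw [← hprod.tprod_eq]
    exact tprod_subtype P (fun h => 1 + hyperWeight lam z ω h)
  rw [h1, ← Finset.prod_fiberwise_of_maps_to (s := 𝒥) (t := C)
    (g := fun K => hyperSpan (d := d) (K, none))]
  · refine Finset.prod_congr rfl fun e he => ?_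
    have hlt := mem_edgesOn.1 (hC he)
    rw [← prod_setFactor hnonneg hsymm hχ ω hlt.1]
    -- The sets of span `e` correspond to the subsets of the open interval between its ends.
    refine Finset.prod_bij' (fun K _ => K \ {e.1, e.2}) (fun J _ => spanned e J) ?_ ?_ ?_ ?_ ?_
    · intro K hK
      simp only [𝒥, Finset.mem_filter, Finset.mem_powerset] at hK ⊢
      exact (exists_spanned hK.1.2.1 hK.2).1
    · intro J hJ
      rw [Finset.mem_powerset] at hJ
      have hsp := hyperSpan_spanned (d := d) hlt.1 hJ none
      simp only [𝒥, Finset.mem_filter, Finset.mem_powerset]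
      refine ⟨⟨fun x hx => ?_, ⟨e.1, by simp [spanned]⟩, by rw [hsp]; exact he⟩, hsp⟩
      simp only [spanned, Finset.mem_insert] at hx
      rw [Finset.mem_range]
      rcases hx with rfl | rfl | hx
      · omega
      · omega
      · have := Finset.mem_Ioo.1 (hJ hx); omega
    · intro K hK
      simp only [𝒥, Finset.mem_filter, Finset.mem_powerset] at hK
      exact (exists_spanned hK.1.2.1 hK.2).2
    · intro J hJ
      exact spanned_sdiff (Finset.mem_powerset.1 hJ)
    · intro K hK
      simp only [𝒥, Finset.mem_filter, Finset.mem_powerset] at hK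
      rw [(exists_spanned hK.1.2.1 hK.2).2]
  · intro K hK
    exact (Finset.mem_filter.1 hK).2.2

/-- The product over the hyperedges with one vertex. -/
theorem tprod_singletons (hnonneg : ∀ η, 0 ≤ lam η) (hsymm : SymmetricActivities lam)
    (hχ : FiniteSusceptibility lam z) (ω : Walk d) (m : ℕ) :
    ∏' p : Fin (m + 1) × Loop d, (1 + hyperWeight lam z ω ({(p.1 : ℕ)}, some p.2)) =
      alphaZero lam z ^ (m + 1) := by
  have h1 : HasProd (fun p : Fin (m + 1) × Loop d =>
      1 + hyperWeight lam z ω ({(p.1 : ℕ)}, some p.2))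
      (∏ _j : Fin (m + 1), alphaZero lam z) := by
    refine hasProd_of_fibers (fun j _ => ?_) (fun j hj => absurd (Finset.mem_univ j) hj)
    have h2 := hasProd_hyperWeight hnonneg hsymm hχ ω (Finset.singleton_nonempty (j : ℕ))
    have h3 : allThrough ω.vert {(j : ℕ)} = through (ω.vert j) := by
      ext X; simp [allThrough, through]
    rw [h3, Finset.card_singleton, pow_one, neg_neg, one_mul,
      tsum_through_eq hnonneg hsymm, ← alphaZero_eq_exp hnonneg hsymm hχ] at h2
    exact h2
  rw [h1.tprod_eq]
  simp

end Hyperedges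

end LWW

end

noncomputable section

namespace LWW

/-! ### Walks as words of steps and the group algebra of the lattice -/

section Words

open scoped NNReal Classical

variable {d : ℕ}

/-- The steps of a nearest-neighbour walk. -/
abbrev Step (d : ℕ) := {x : Site d // Adj x 0}

instance : Finite (Step d) := by
  refine Set.Finite.subset (Set.finite_Icc (-1 : Site d) 1) (fun x hx => ?_)
  have h : ∀ i, |x i| ≤ 1 := by
    intro i
    have h1 : dist1 x 0 = 1 := hx
    rw [← h1, dist1]
    have := Finset.single_le_sum (f := fun i => |x i - (0 : Site d) i|)
      (fun j _ => abs_nonneg _) (Finset.mem_univ i)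
    simpa using this
  exact ⟨fun i => (abs_le.1 (h i)).1, fun i => (abs_le.1 (h i)).2⟩

instance : Fintype (Step d) := Fintype.ofFinite _

/-- The path from the origin with the given steps. -/
def path {n : ℕ} (w : Fin n → Step d) (j : ℕ) : Site d :=
  ∑ i : Fin n, if (i : ℕ) < j then (w i).1 else 0

@[simp] theorem path_zero {n : ℕ} (w : Fin n → Step d) : path w 0 = 0 := by simp [path]

theorem path_succ {n : ℕ} (w : Fin n → Step d) (j : Fin n) :
    path w (j + 1) = path w j + (w j).1 := by
  have h : (w j).1 = ∑ i : Fin n, if i = j then (w i).1 else 0 := by simp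
  rw [h, path, path, ← Finset.sum_add_distrib]
  refine Finset.sum_congr rfl fun i _ => ?_
  rcases lt_trichotomy i j with hij | rfl | hij
  · have h1 : (i : ℕ) < j := hij
    have h2 : (i : ℕ) < j + 1 := by omega
    rw [if_pos h2, if_pos h1, if_neg hij.ne, add_zero]
  · simp
  · have h1 : (j : ℕ) < i := hij
    have h2 : ¬ (i : ℕ) < j + 1 := by omega
    have h3 : ¬ (i : ℕ) < j := by omega
    rw [if_neg h2, if_neg h3, if_neg hij.ne', add_zero]

theorem path_append_left {m n : ℕ} (u : Fin m → Step d) (v : Fin n → Step d) {j : ℕ}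
    (hj : j ≤ m) : path (Fin.append u v) j = path u j := by
  rw [path, Fin.sum_univ_add, path]
  simp only [Fin.val_castAdd, Fin.append_left, add_eq_left]
  refine Finset.sum_eq_zero fun i _ => if_neg ?_
  rw [Fin.val_natAdd]; omega

theorem path_append_right {m n : ℕ} (u : Fin m → Step d) (v : Fin n → Step d) (j : ℕ) :
    path (Fin.append u v) (m + j) = path u m + path v j := by
  rw [path, Fin.sum_univ_add, path, path]
  congr 1
  · refine Finset.sum_congr rfl fun i _ => ?_
    have h1 : (Fin.castAdd n i : ℕ) < m + j := by rw [Fin.val_castAdd]; omega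
    rw [if_pos h1, if_pos i.2, Fin.append_left]
  · refine Finset.sum_congr rfl fun i _ => ?_
    simp only [Fin.val_natAdd, Fin.append_right, add_lt_add_iff_left]

theorem adj_iff_sub (x y : Site d) : Adj x y ↔ Adj (x - y) 0 := by simp [Adj, dist1]

theorem adj_symm {x y : Site d} (h : Adj x y) : Adj y x := by
  rw [Adj, dist1] at *
  rw [← h]
  exact Finset.sum_congr rfl fun i _ => abs_sub_comm _ _

/-- The walk from the origin with the given steps. -/
def wordWalk {n : ℕ} (w : Fin n → Step d) : Walk d where
  verts := List.ofFn fun j : Fin (n + 1) => path w j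
  ne_nil := by simp
  chain := by
    rw [List.isChain_ofFn]
    intro i hi
    have h := path_succ w ⟨i, by omega⟩
    simp only at h ⊢
    apply adj_symm
    rw [adj_iff_sub, h, add_sub_cancel_left]
    exact (w _).2

@[simp] theorem length_wordWalk {n : ℕ} (w : Fin n → Step d) : (wordWalk w).length = n := by
  simp [wordWalk, Walk.length]

theorem vert_wordWalk {n : ℕ} (w : Fin n → Step d) {j : ℕ} (hj : j ≤ n) :
    (wordWalk w).vert j = path w j := by
  rw [Walk.vert, wordWalk, List.getD_eq_getElem?_getD, List.getElem?_ofFn,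
    dif_pos (Nat.lt_succ_of_le hj), Option.getD_some]

/-- Words with endpoint `x` as walks. -/
def wordToWalk (n : ℕ) (x : Site d) (w : {w : Fin n → Step d // path w n = x}) :
    WalkOfLength n (0 : Site d) x :=
  ⟨wordWalk w.1, by rw [Walk.start, vert_wordWalk _ (Nat.zero_le n), path_zero],
    by rw [Walk.finish, length_wordWalk, vert_wordWalk _ le_rfl, w.2], length_wordWalk _⟩

theorem Walk.adj_vert (ω : Walk d) {j : ℕ} (hj : j < ω.length) :
    Adj (ω.vert (j + 1)) (ω.vert j) := by
  have h := List.isChain_iff_getElem.1 ω.chain j (by rw [Walk.length] at hj; omega)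
  have h1 := ω.getElem?_verts (j := j) hj.le
  have h2 := ω.getElem?_verts (j := j + 1) hj
  rw [List.getElem?_eq_some_iff] at h1 h2
  obtain ⟨_, h1⟩ := h1
  obtain ⟨_, h2⟩ := h2
  rw [h1, h2] at h
  exact adj_symm h

theorem bijective_wordToWalk (n : ℕ) (x : Site d) : Function.Bijective (wordToWalk n x) := by
  constructor
  · rintro ⟨w, hw⟩ ⟨w', hw'⟩ h
    apply Subtype.ext
    have h1 : wordWalk w = wordWalk w' := congrArg Subtype.val h
    funext j
    apply Subtype.ext
    have h2 : ∀ i ≤ n, path w i = path w' i := fun i hi => by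
      rw [← vert_wordWalk w hi, h1, vert_wordWalk w' hi]
    have h3 := h2 (j + 1) j.2
    rw [path_succ, path_succ, h2 j j.2.le] at h3
    exact add_left_cancel h3
  · rintro ⟨ω, h0, hx, hn⟩
    let w : Fin n → Step d := fun i => ⟨ω.vert (i + 1) - ω.vert i, by
      rw [← adj_iff_sub]; exact ω.adj_vert (by rw [hn]; exact i.2)⟩
    have h1 : ∀ j ≤ n, path w j = ω.vert j := by
      intro j hj
      induction j with
      | zero => rw [path_zero, ← h0]; rfl
      | succ j ih =>
        have := path_succ w ⟨j, hj⟩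
        simp only at this
        rw [this, ih (by omega)]
        simp [w]
    refine ⟨⟨w, by rw [h1 n le_rfl, ← hx, Walk.finish, hn]⟩, ?_⟩
    apply Subtype.ext
    apply Walk.ext_verts
    apply List.ext_getElem?
    intro j
    change (wordWalk w).verts[j]? = ω.verts[j]?
    have hl : (wordWalk w).verts.length = n + 1 := by simp [wordWalk]
    have hl' : ω.verts.length = n + 1 := by rw [Walk.length_verts, hn]
    rcases Nat.lt_or_ge n j with hj | hj
    · rw [List.getElem?_eq_none (by omega), List.getElem?_eq_none (by omega)]
    · rw [Walk.getElem?_verts _ (by simpa using hj), Walk.getElem?_verts _ (by omega),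
        vert_wordWalk w hj, h1 j hj]

/-- There are finitely many words of `n` steps, so the sums over walks of fixed length raise no
question of convergence. -/
theorem tsum_walkOfLength (n : ℕ) (x : Site d) (f : Walk d → ℝ) :
    ∑' ω : WalkOfLength n (0 : Site d) x, f ω.1 =
      ∑ w : Fin n → Step d, if path w n = x then f (wordWalk w) else 0 := by
  rw [← (Equiv.ofBijective _ (bijective_wordToWalk n x)).tsum_eq, tsum_fintype]
  rw [← Finset.sum_filter, ← Finset.sum_subtype_eq_sum_filter]
  refine Finset.sum_bij' (fun w _ => ⟨w.1, w.2⟩) (fun w _ => ⟨w.1, w.2⟩) ?_ ?_ ?_ ?_ ?_ <;>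
    simp [wordToWalk]

variable {lam : SAP d → ℝ} {z : ℝ≥0}

/-- The interaction of a pair sees the path only between its two times. With invariance under shifts
and isometries, this is what makes weights factorise at a breakpoint. -/
theorem pairFactor_congr {p q : ℕ → Site d} {e : ℕ × ℕ} (he : e.1 < e.2)
    (h : ∀ j, e.1 ≤ j → j ≤ e.2 → p j = q j) : pairFactor lam z p e = pairFactor lam z q e := by
  have h1 : consecutive p e.1 e.2 = consecutive q e.1 e.2 := by
    ext X
    simp only [consecutive]
    constructor
    · rintro ⟨h1, h2, h3⟩
      refine ⟨h _ le_rfl he.le ▸ h1, h _ he.le le_rfl ▸ h2, fun j hj hj' => ?_⟩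
      rw [← h j hj.le hj'.le]; exact h3 j hj hj'
    · rintro ⟨h1, h2, h3⟩
      refine ⟨h _ le_rfl he.le ▸ h1, h _ he.le le_rfl ▸ h2, fun j hj hj' => ?_⟩
      rw [h j hj.le hj'.le]; exact h3 j hj hj'
  rw [pairFactor, pairFactor, h1, h _ le_rfl he.le, h _ he.le le_rfl]

theorem pairFactor_shift (p : ℕ → Site d) (m : ℕ) (e : ℕ × ℕ) :
    pairFactor lam z p (e.1 + m, e.2 + m) = pairFactor lam z (fun j => p (j + m)) e := by
  have h1 : consecutive p (e.1 + m) (e.2 + m) = consecutive (fun j => p (j + m)) e.1 e.2 := by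
    ext X
    simp only [consecutive]
    refine and_congr_right fun _ => and_congr_right fun _ => ?_
    constructor
    · intro h j hj hj'; exact h _ (by omega) (by omega)
    · intro h j hj hj'
      have := h (j - m) (by omega) (by omega)
      rwa [Nat.sub_add_cancel (by omega)] at this
  simp only [pairFactor, h1]

theorem pairFactor_isometry (hnonneg : ∀ η, 0 ≤ lam η) (hsymm : SymmetricActivities lam)
    {f : Site d ≃ Site d} (hf : IsIsometry f) (p : ℕ → Site d) (e : ℕ × ℕ) :
    pairFactor lam z (fun j => f (p j)) e = pairFactor lam z p e := by
  have h1 : ∑' X, (consecutive (fun j => f (p j)) e.1 e.2).indicator (loopNu lam z) X =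
      ∑' X, (consecutive p e.1 e.2).indicator (loopNu lam z) X := by
    refine tsum_loopNu_isometry hnonneg hsymm hf fun X => ?_
    simp only [consecutive, Set.mem_ofPred_eq, mem_range_mapLoop]
  simp only [pairFactor, h1, EmbeddingLike.apply_eq_iff_eq]

/-- `z ^ n c_n` as a finitely supported function on the lattice. -/
def sawElem (lam : SAP d → ℝ) (z : ℝ) (n : ℕ) : AddMonoidAlgebra ℝ (Site d) :=
  ∑ w : Fin n → Step d, AddMonoidAlgebra.single (path w n)
    (z ^ n * alphaZero lam z ^ (n + 1) * ∏ e ∈ edgesOn n, pairFactor lam z (path w) e)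

/-- The step kernel of the renewal equation for `sawElem`. -/
def stepElem (lam : SAP d → ℝ) (z : ℝ) (m : ℕ) : AddMonoidAlgebra ℝ (Site d) :=
  ∑ w : Fin m → Step d, AddMonoidAlgebra.single (path w m)
    (z ^ m * alphaZero lam z ^ m * unbrokenSum m (fun e => pairFactor lam z (path w) e - 1))

theorem coeff_sum_single {n : ℕ} (g : (Fin n → Step d) → ℝ) (x : Site d) :
    (∑ w : Fin n → Step d, AddMonoidAlgebra.single (path w n) (g w)).coeff x =
      ∑ w : Fin n → Step d, if path w n = x then g w else 0 := by
  rw [AddMonoidAlgebra.coeff_sum, Finset.sum_apply']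
  refine Finset.sum_congr rfl fun w _ => ?_
  rw [AddMonoidAlgebra.coeff_single, Finsupp.single_apply]

/-- On self-avoiding words this is `prod_pairFactor`; on all others both sides vanish. -/
theorem coeff_sawElem (hnonneg : ∀ η, 0 ≤ lam η) (hsymm : SymmetricActivities lam)
    (hχ : FiniteSusceptibility lam z) (n : ℕ) (x : Site d) :
    (sawElem lam z n).coeff x = (z : ℝ) ^ n * sawCount lam z n x := by
  rw [sawElem, coeff_sum_single, sawCount, tsum_walkOfLength n x fun ω =>
    if ω.SelfAvoiding then
      ∏' X : Loop d, (if (X.1.range ∩ ω.range).Nonempty then 1 + act lam z X else 1)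
    else 0, Finset.mul_sum]
  refine Finset.sum_congr rfl fun w _ => ?_
  rw [mul_ite, mul_zero]
  congr 1
  rw [mul_assoc]
  congr 1
  have hsa : (wordWalk w).SelfAvoiding ↔ ∀ i j, i ≤ n → j ≤ n → path w i = path w j → i = j := by
    simp only [Walk.SelfAvoiding, length_wordWalk]
    refine forall_congr' fun i => forall_congr' fun j => forall_congr' fun hi =>
      forall_congr' fun hj => ?_
    rw [vert_wordWalk w hi, vert_wordWalk w hj]
  by_cases h : (wordWalk w).SelfAvoiding
  · rw [if_pos h, ← prod_pairFactor hnonneg hsymm hχ _ n (hsa.1 h)]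
    obtain ⟨h1, -⟩ := summable_loopsMeeting hnonneg hsymm hχ (T := Set.univ) (wordWalk w).ne_nil
      (wordWalk w).chain ((wordWalk w).selfAvoiding_iff_nodup.1 h) (by simp)
    have h2 : loopsMeeting Set.univ (wordWalk w).verts =
        {X : Loop d | ∃ j ≤ n, path w j ∈ X.1.range} := by
      ext X
      simp only [loopsMeeting, wordWalk, Set.mem_univ, implies_true, and_true, List.mem_ofFn,
        Set.mem_ofPred_eq, exists_exists_eq_and]
      constructor
      · rintro ⟨j, hj⟩; exact ⟨j, Nat.le_of_lt_succ j.2, hj⟩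
      · rintro ⟨j, hj, hX⟩; exact ⟨⟨j, Nat.lt_succ_of_le hj⟩, hX⟩
    simp only [range_eq_mem_verts]
    rw [← h2, ← (hasProd_one_add_act h1).tprod_eq]
  · rw [if_neg h, prod_pairFactor_eq_zero _ _ _ _ (fun H => h (hsa.2 H)), mul_zero]

end Words

end LWW

end

noncomputable section

namespace LWW

/-! ### The renewal equation and its kernel -/

section Renewal

open scoped NNReal Classical

variable {d : ℕ} {lam : SAP d → ℝ} {z : ℝ≥0}

theorem unbrokenSum_congr {A : Type*} [CommRing A] {m : ℕ} {U V : ℕ × ℕ → A}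
    (h : ∀ e ∈ edgesOn m, U e = V e) : unbrokenSum m U = unbrokenSum m V := by
  refine Finset.sum_congr rfl fun Γ hΓ => Finset.prod_congr rfl fun e he => h e ?_
  rw [Finset.mem_filter, Finset.mem_powerset] at hΓ
  exact hΓ.1 he

theorem pairFactor_wordWalk {n : ℕ} (w : Fin n → Step d) {e : ℕ × ℕ} (he : e ∈ edgesOn n) :
    pairFactor lam z (wordWalk w).vert e = pairFactor lam z (path w) e := by
  rw [mem_edgesOn] at he
  exact pairFactor_congr he.1 fun j _ hj => vert_wordWalk w (hj.trans he.2)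

/-- Multiplication in the group algebra concatenates words. The second word starts at the end of the
first, and translation invariance removes the displacement. -/
theorem stepElem_mul_sawElem (hnonneg : ∀ η, 0 ≤ lam η) (hsymm : SymmetricActivities lam)
    (m k : ℕ) : stepElem lam z m * sawElem lam z k =
      ∑ w : Fin (m + k) → Step d, AddMonoidAlgebra.single (path w (m + k))
        (z ^ (m + k) * alphaZero lam z ^ (m + k + 1) *
          (unbrokenSum m (fun e => pairFactor lam z (path w) e - 1) *
            ∏ e ∈ edgesOn k, (1 + (pairFactor lam z (path w) (e.1 + m, e.2 + m) - 1)))) := by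
  rw [stepElem, sawElem, Finset.sum_mul_sum, ← Finset.sum_product', Finset.univ_product_univ,
    ← (Fin.appendEquiv m k).sum_comp]
  refine Finset.sum_congr rfl fun ⟨u, v⟩ _ => ?_
  have happ : Fin.appendEquiv m k (u, v) = Fin.append u v := rfl
  rw [AddMonoidAlgebra.single_mul_single, happ, path_append_right]
  congr 1
  have h1 : unbrokenSum m (fun e => pairFactor lam z (path (Fin.append u v)) e - 1) =
      unbrokenSum m (fun e => pairFactor lam z (path u) e - 1) := by
    refine unbrokenSum_congr fun e he => ?_
    rw [mem_edgesOn] at he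
    rw [pairFactor_congr he.1 fun j _ hj => path_append_left u v (hj.trans he.2)]
  have h2 : ∀ e : ℕ × ℕ, pairFactor lam z (path (Fin.append u v)) (e.1 + m, e.2 + m) =
      pairFactor lam z (path v) e := by
    intro e
    rw [pairFactor_shift,
      ← pairFactor_isometry hnonneg hsymm (isIsometry_translate (path u m)) (path v)]
    congr 1
    funext j
    rw [add_comm j m, path_append_right, Equiv.coe_addRight, add_comm]
  simp only [h1, h2, add_sub_cancel]
  ring

/-- The renewal equation for weighted self-avoiding walks. -/
theorem sawElem_eq_sum (hnonneg : ∀ η, 0 ≤ lam η) (hsymm : SymmetricActivities lam) {n : ℕ}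
    (hn : 1 ≤ n) :
    sawElem lam z n = ∑ m ∈ Finset.Icc 1 n, stepElem lam z m * sawElem lam z (n - m) := by
  have h1 : ∀ m ∈ Finset.Icc 1 n, stepElem lam z m * sawElem lam z (n - m) =
      ∑ w : Fin n → Step d, AddMonoidAlgebra.single (path w n)
        (z ^ n * alphaZero lam z ^ (n + 1) *
          (unbrokenSum m (fun e => pairFactor lam z (path w) e - 1) *
            ∏ e ∈ edgesOn (n - m), (1 + (pairFactor lam z (path w) (e.1 + m, e.2 + m) - 1)))) := by
    intro m hm
    obtain ⟨k, rfl⟩ := Nat.exists_eq_add_of_le (Finset.mem_Icc.1 hm).2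
    rw [Nat.add_sub_cancel_left, stepElem_mul_sawElem hnonneg hsymm]
  rw [Finset.sum_congr rfl h1, Finset.sum_comm, sawElem]
  refine Finset.sum_congr rfl fun w _ => ?_
  simp only [← AddMonoidAlgebra.ofCoeff_single]
  rw [← AddMonoidAlgebra.ofCoeff_sum, ← Finsupp.single_finsetSum, ← Finset.mul_sum,
    ← prod_edgesOn_eq hn (fun e => pairFactor lam z (path w) e - 1)]
  simp only [add_sub_cancel]

theorem sawElem_zero (lam : SAP d → ℝ) (z : ℝ) :
    sawElem lam z 0 = AddMonoidAlgebra.single 0 (alphaZero lam z) := by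
  have : edgesOn 0 = ∅ := by
    ext e; rw [mem_edgesOn]; simp; omega
  simp [sawElem, this]

theorem alphaZero_pos (hnonneg : ∀ η, 0 ≤ lam η) (hsymm : SymmetricActivities lam)
    (hχ : FiniteSusceptibility lam z) : 0 < alphaZero lam z := by
  rw [alphaZero_eq_exp hnonneg hsymm hχ]
  exact Real.exp_pos _

/-- Covering graphs are resummed into laces: lace edges carry `-I`, which yields the sign `(-1) ^
N`, and compatible edges carry `1 - I`, the product of the hyperedges of that span. The singletons
give `α₀ ^ (m + 1)`, and the prefactor `α₀⁻¹` leaves `α₀ ^ m`. -/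
theorem coeff_stepElem (hnonneg : ∀ η, 0 ≤ lam η) (hsymm : SymmetricActivities lam)
    (hχ : FiniteSusceptibility lam z) {m : ℕ} (hm : 2 ≤ m) (x : Site d) :
    (stepElem lam z m).coeff x = piCoeff lam z m x := by
  have h0 := alphaZero_pos hnonneg hsymm hχ
  let g : ℕ → Finset (ℕ × ℕ) → (Fin m → Step d) → ℝ := fun N L w =>
    if path w m = x then (-1) ^ N * ((z : ℝ) ^ m * (alphaZero lam z)⁻¹ *
      ((∏ e ∈ L, (1 - pairFactor lam z (path w) e)) *
        (∏ e ∈ compatible m L, pairFactor lam z (path w) e) * alphaZero lam z ^ (m + 1))) else 0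
  have h1 : ∀ N, (-1) ^ N * piN lam z N m x = ∑ L ∈ laces N m, ∑ w, g N L w := by
    intro N
    rw [piN, tsum_walkOfLength m x fun ω => ∑ L ∈ laces N m,
      (∏ e ∈ L, laceInteraction lam z ω e.1 e.2) *
      (∏' h : {h : HyperPair d // IsHyperedge m h ∧ hyperSpan h ∈ compatible m L},
        (1 + hyperWeight lam z ω h.1)) *
      ∏' p : Fin (m + 1) × Loop d, (1 + hyperWeight lam z ω ({(p.1 : ℕ)}, some p.2)),
      Finset.sum_comm, Finset.mul_sum, Finset.mul_sum]
    refine Finset.sum_congr rfl fun w _ => ?_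
    by_cases hw : path w m = x
    · simp only [g, if_pos hw]
      rw [Finset.mul_sum, Finset.mul_sum]
      refine Finset.sum_congr rfl fun L hL => ?_
      have hL' : L ⊆ edgesOn m := by
        rw [laces, Finset.mem_filter, Finset.mem_powerset] at hL; exact hL.1
      have hC : compatible m L ⊆ edgesOn m := Finset.filter_subset _ _
      rw [tprod_hyperedges hnonneg hsymm hχ _ hC, tprod_singletons hnonneg hsymm hχ,
        Finset.prod_congr rfl fun e he => pairFactor_wordWalk w (hC he),
        Finset.prod_congr rfl fun e he => (laceInteraction_eq hnonneg hsymm hχ _ e.1 e.2).trans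
          (congrArg (1 - ·) (pairFactor_wordWalk w (hL' he)))]
    · simp only [g, if_neg hw, mul_zero, Finset.sum_const_zero]
  rw [piCoeff, Finset.sum_congr rfl fun N _ => h1 N, sum_laces m fun N L => ∑ w, g N L w,
    Finset.sum_comm, stepElem, coeff_sum_single]
  refine Finset.sum_congr rfl fun w _ => ?_
  by_cases hw : path w m = x
  · simp only [g, if_pos hw]
    rw [unbrokenSum_eq_connected hm, sum_connectedGraphs, Finset.mul_sum]
    refine Finset.sum_congr rfl fun L _ => ?_
    have h2 : ∏ e ∈ L, (pairFactor lam z (path w) e - 1) =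
        (-1) ^ L.card * ∏ e ∈ L, (1 - pairFactor lam z (path w) e) := by
      rw [← Finset.prod_const, ← Finset.prod_mul_distrib]
      exact Finset.prod_congr rfl fun e _ => by ring
    rw [h2]
    simp only [add_sub_cancel]
    field_simp
    ring
  · simp only [g, if_neg hw, Finset.sum_const_zero]

theorem piCoeff_of_lt_two {m : ℕ} (hm : m < 2) (x : Site d) : piCoeff lam z m x = 0 := by
  have h : ∀ N, laces N m = ∅ := by
    intro N
    refine Finset.filter_eq_empty_iff.2 fun L _ h => ?_
    have := h.1.1.2.1
    omega
  simp [piCoeff, piN, h]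

theorem exists_eq_single {y : Site d} (hy : Adj y 0) :
    ∃ i, ∃ ε : ℤ, |ε| = 1 ∧ y = Pi.single i ε := by
  have h1 : ∑ i, |y i| = 1 := by simpa [Adj, dist1] using hy
  have h2 : ∃ i, y i ≠ 0 := by
    by_contra! h
    simp [h] at h1
  obtain ⟨i, hi⟩ := h2
  rw [← Finset.add_sum_erase _ _ (Finset.mem_univ i)] at h1
  have h3 := Int.one_le_abs hi
  have h4 : 0 ≤ ∑ j ∈ Finset.univ.erase i, |y j| := Finset.sum_nonneg fun _ _ => abs_nonneg _
  have h5 : ∑ j ∈ Finset.univ.erase i, |y j| = 0 := by omega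
  refine ⟨i, y i, by omega, ?_⟩
  rw [Finset.sum_eq_zero_iff_of_nonneg fun _ _ => abs_nonneg _] at h5
  funext j
  by_cases hj : j = i
  · subst hj; simp
  · rw [Pi.single_eq_of_ne hj, ← abs_eq_zero]
    exact h5 j (Finset.mem_erase.2 ⟨hj, Finset.mem_univ _⟩)

/-- The isometries of the lattice that fix the origin act transitively on its neighbours. -/
theorem exists_isometry {y v : Site d} (hy : Adj y 0) (hv : Adj v 0) :
    ∃ f : Site d ≃ Site d, IsIsometry f ∧ f 0 = 0 ∧ f y = v := by
  obtain ⟨i, ε, hε, rfl⟩ := exists_eq_single hy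
  obtain ⟨j, δ, hδ, rfl⟩ := exists_eq_single hv
  have hε2 : ε * ε = 1 := by rw [← abs_mul_abs_self, hε]; rfl
  have hδ2 : δ * δ = 1 := by rw [← abs_mul_abs_self, hδ]; rfl
  have hs : (ε * δ) * (ε * δ) = 1 := by rw [mul_mul_mul_comm, hε2, hδ2]; rfl
  -- Swapping two coordinates and changing all signs if `ε ≠ δ` is an isometry that is its own
  -- inverse.
  have hinv : Function.Involutive fun (x : Site d) k => (ε * δ) * x (Equiv.swap i j k) := by
    intro x
    funext k
    simp only [Equiv.swap_apply_self]
    rw [← mul_assoc, hs, one_mul]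
  refine ⟨hinv.toPerm, fun x x' => ?_, ?_, ?_⟩
  · simp only [dist1, Function.Involutive.coe_toPerm]
    rw [← Equiv.sum_comp (Equiv.swap i j) fun k => |x k - x' k|]
    refine Finset.sum_congr rfl fun k _ => ?_
    rw [← mul_sub, abs_mul, abs_mul, hε, hδ, one_mul, one_mul]
  · funext k; simp
  · funext k
    simp only [Function.Involutive.coe_toPerm]
    by_cases hk : k = j
    · subst hk
      rw [Equiv.swap_apply_right, Pi.single_eq_same, Pi.single_eq_same]
      rw [mul_right_comm, hε2, one_mul]
    · rw [Pi.single_eq_of_ne hk, Pi.single_eq_of_ne, mul_zero]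
      rw [Ne, Equiv.swap_apply_eq_iff, Equiv.swap_apply_left]
      exact hk

theorem alphaOne_eq_of_adj (hnonneg : ∀ η, 0 ≤ lam η) (hsymm : SymmetricActivities lam)
    (hχ : FiniteSusceptibility lam z) {y v : Site d} (hy : Adj y 0) (hv : Adj v 0) :
    alphaOne lam z v = alphaOne lam z y := by
  obtain ⟨f, hf, h0, h1⟩ := exists_isometry hy hv
  rw [alphaOne_eq_exp hnonneg hsymm hχ, alphaOne_eq_exp hnonneg hsymm hχ]
  congr 1
  refine tsum_loopNu_isometry hnonneg hsymm hf fun X => ?_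
  have h2 := mem_range_mapLoop f hf X 0
  have h3 := mem_range_mapLoop f hf X y
  rw [h0] at h2
  rw [h1] at h3
  exact and_congr h2 (not_congr h3)

/-- Removing from the loops through `0` those that also visit `p 1` leaves the loops through `0`
that avoid it. No time lies between `0` and `1`, so the pair sees all common loops. -/
theorem alphaZero_mul_pairFactor (hnonneg : ∀ η, 0 ≤ lam η) (hsymm : SymmetricActivities lam)
    (hχ : FiniteSusceptibility lam z) {p : ℕ → Site d} (h0 : p 0 = 0) (h1 : p 1 ≠ 0) :
    alphaZero lam z * pairFactor lam z p (0, 1) = alphaOne lam z (p 1) := by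
  rw [alphaOne_eq_exp hnonneg hsymm hχ, alphaZero_eq_exp hnonneg hsymm hχ, pairFactor,
    if_neg (by simp only [h0]; exact h1.symm), ← Real.exp_add]
  congr 1
  have h2 : consecutive p 0 1 = through 0 ∩ through (p 1) := by
    ext X
    simp only [consecutive, h0]
    constructor
    · rintro ⟨a, b, -⟩; exact ⟨a, b⟩
    · rintro ⟨a, b⟩; exact ⟨a, b, fun j hj hj' => by omega⟩
  simp only [h2]
  have h3 := summable_of_subset_through hnonneg hsymm hχ (v := 0)
    (Set.inter_subset_left (s := through 0) (t := through (p 1)))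
  have h4 := summable_of_subset_through hnonneg hsymm hχ (v := 0)
    (Set.sdiff_subset (s := through 0) (t := through (p 1)))
  rw [add_neg_eq_iff_eq_add, ← h4.tsum_add h3]
  refine tsum_congr fun X => ?_
  by_cases ha : X ∈ through 0 <;> by_cases hb : X ∈ through (p 1) <;> simp [ha, hb]

theorem coeff_stepElem_one (hnonneg : ∀ η, 0 ≤ lam η) (hsymm : SymmetricActivities lam)
    (hχ : FiniteSusceptibility lam z) {y : Site d} (hy : Adj y 0) (x : Site d) :
    (stepElem lam z 1).coeff x = z * alphaOne lam z y * (2 * d) * stepDist x := by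
  have h1 : ∀ w : Fin 1 → Step d, path w 1 = (w 0).1 := by
    intro w
    simp [path]
  have h2 : ∀ w : Fin 1 → Step d, (z : ℝ) ^ 1 * alphaZero lam z ^ 1 *
      unbrokenSum 1 (fun e => pairFactor lam z (path w) e - 1) = z * alphaOne lam z y := by
    intro w
    have hne : path w 1 ≠ 0 := by
      rw [h1]
      intro h
      have := (w 0).2
      rw [h] at this
      exact not_adj_self _ this
    rw [unbrokenSum_one, add_sub_cancel, pow_one, pow_one, mul_assoc,
      alphaZero_mul_pairFactor hnonneg hsymm hχ (path_zero w) hne, h1,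
      alphaOne_eq_of_adj hnonneg hsymm hχ hy (w 0).2]
  rw [stepElem, coeff_sum_single, stepDist]
  simp only [h1, h2]
  rw [← (Equiv.funUnique (Fin 1) (Step d)).symm.sum_comp]
  -- The origin has a neighbour, so `d ≥ 1` and the normalisation of `stepDist` can be cancelled.
  have hd : (d : ℝ) ≠ 0 := by
    obtain ⟨i, -⟩ := exists_eq_single hy
    exact_mod_cast (i.pos).ne'
  by_cases hx : Adj x 0
  · rw [if_pos hx, Finset.sum_eq_single (⟨x, hx⟩ : Step d)]
    · simp; field_simp
    · intro b _ hb
      refine if_neg fun h => hb (Subtype.ext h)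
    · simp
  · rw [if_neg hx, mul_zero]
    refine Finset.sum_eq_zero fun b _ => if_neg fun h => hx ?_
    have := b.2
    rwa [show b.1 = x from h] at this

end Renewal

end LWW

end

noncomputable section

namespace LWW

/-! ### Fourier transform and generating functions -/

section Fourier

open scoped NNReal Classical

variable {d : ℕ} {lam : SAP d → ℝ} {z : ℝ≥0}

/-- The character `x ↦ exp (i k · x)`. -/
def latticeChar (k : Fin d → ℝ) : Multiplicative (Site d) →* ℂ where
  toFun x := Complex.exp (Complex.I * ((∑ i, k i * (x.toAdd i : ℝ) : ℝ) : ℂ))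
  map_one' := by simp
  map_mul' x y := by
    rw [← Complex.exp_add, ← mul_add, ← Complex.ofReal_add, ← Finset.sum_add_distrib]
    congr 3
    refine Finset.sum_congr rfl fun i _ => ?_
    rw [toAdd_mul, Pi.add_apply, Int.cast_add, mul_add]

/-- The Fourier transform of finitely supported functions. -/
def fourierHom (k : Fin d → ℝ) : AddMonoidAlgebra ℝ (Site d) →ₐ[ℝ] ℂ :=
  AddMonoidAlgebra.lift ℝ ℂ (Site d) (latticeChar k)

theorem latticeFourier_coeff (a : AddMonoidAlgebra ℝ (Site d)) (k : Fin d → ℝ) :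
    latticeFourier (fun x => a.coeff x) k = fourierHom k a := by
  rw [fourierHom, AddMonoidAlgebra.lift_apply, latticeFourier, Finsupp.sum,
    tsum_eq_sum (s := a.coeff.support)]
  · refine Finset.sum_congr rfl fun x _ => ?_
    rw [Complex.real_smul, mul_comm]
    rfl
  · intro x hx
    rw [Finsupp.notMem_support_iff.1 hx, Complex.ofReal_zero, mul_zero]

theorem norm_latticeFourier_term (f : Site d → ℝ) (k : Fin d → ℝ) (x : Site d) :
    ‖Complex.exp (Complex.I * ((∑ i, k i * (x i : ℝ) : ℝ) : ℂ)) * (f x : ℂ)‖ = |f x| := by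
  rw [norm_mul, mul_comm Complex.I, Complex.norm_exp_ofReal_mul_I, one_mul, Complex.norm_real,
    Real.norm_eq_abs]

theorem summable_latticeFourier {f : ℕ × Site d → ℝ} (hf : Summable fun p => |f p|)
    (k : Fin d → ℝ) : Summable fun n => ‖latticeFourier (fun x => f (n, x)) k‖ := by
  have h1 := (summable_prod_of_nonneg fun p => abs_nonneg (f p)).1 hf
  refine Summable.of_nonneg_of_le (fun n => norm_nonneg _) (fun n => ?_) h1.2
  have h2 := norm_latticeFourier_term (fun x => f (n, x)) k
  refine (norm_tsum_le_tsum_norm ?_).trans (le_of_eq ?_)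
  · simp only [h2]; exact h1.1 n
  · simp only [h2]

theorem latticeFourier_tsum {f : ℕ × Site d → ℝ} (hf : Summable fun p => |f p|)
    (k : Fin d → ℝ) : latticeFourier (fun x => ∑' n, f (n, x)) k =
      ∑' n, latticeFourier (fun x => f (n, x)) k := by
  have h1 : Summable (Function.uncurry fun (n : ℕ) (x : Site d) =>
      Complex.exp (Complex.I * ((∑ i, k i * (x i : ℝ) : ℝ) : ℂ)) * (f (n, x) : ℂ)) := by
    apply Summable.of_norm
    refine hf.congr fun p => ?_
    exact (norm_latticeFourier_term (fun x => f (p.1, x)) k p.2).symm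
  simp only [latticeFourier]
  rw [← h1.tsum_comm]
  refine tsum_congr fun x => ?_
  rw [Complex.ofReal_tsum, tsum_mul_left]

theorem latticeFourier_sawCount (hnonneg : ∀ η, 0 ≤ lam η) (hsymm : SymmetricActivities lam)
    (hχ : FiniteSusceptibility lam z) (n : ℕ) (k : Fin d → ℝ) :
    latticeFourier (fun x => (z : ℝ) ^ n * sawCount lam z n x) k =
      fourierHom k (sawElem lam z n) := by
  rw [← latticeFourier_coeff]
  simp only [coeff_sawElem hnonneg hsymm hχ]

theorem latticeFourier_const_mul (c : ℝ) (f : Site d → ℝ) (k : Fin d → ℝ) :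
    latticeFourier (fun x => c * f x) k = c * latticeFourier f k := by
  rw [latticeFourier, latticeFourier, ← tsum_mul_left]
  refine tsum_congr fun x => ?_
  push_cast
  ring

theorem latticeFourier_zero (k : Fin d → ℝ) : latticeFourier (fun _ : Site d => 0) k = 0 := by
  simp [latticeFourier]

/-- The coefficients of the denominator in the lace expansion. -/
theorem coeff_denominator (hnonneg : ∀ η, 0 ≤ lam η) (hsymm : SymmetricActivities lam)
    (hχ : FiniteSusceptibility lam z) {y : Site d} (hy : Adj y 0) (k : Fin d → ℝ) :
    (1 - PowerSeries.C ((z : ℝ) * alphaOne lam z y * (2 * d) * latticeFourier stepDist k) *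
        PowerSeries.X - PowerSeries.mk (fun m => latticeFourier (piCoeff lam z m) k)) =
      1 - PowerSeries.mk fun m => if m = 0 then 0 else fourierHom k (stepElem lam z m) := by
  rw [sub_sub]
  congr 1
  ext m
  rw [map_add, PowerSeries.coeff_mk, PowerSeries.coeff_mk]
  rcases m with _ | _ | m
  · have : piCoeff lam z 0 = fun _ => 0 := funext fun x => piCoeff_of_lt_two (by omega) x
    rw [this, latticeFourier_zero]
    simp
  · have : piCoeff lam z 1 = fun _ => 0 := funext fun x => piCoeff_of_lt_two (by omega) x
    rw [zero_add, this, latticeFourier_zero, ← latticeFourier_coeff]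
    simp only [coeff_stepElem_one hnonneg hsymm hχ hy]
    rw [latticeFourier_const_mul, PowerSeries.coeff_C_mul, PowerSeries.coeff_one_X]
    simp
  · rw [if_neg (by omega), ← latticeFourier_coeff]
    simp only [coeff_stepElem hnonneg hsymm hχ (show 2 ≤ m + 1 + 1 by omega)]
    rw [PowerSeries.coeff_C_mul, PowerSeries.coeff_X, if_neg (by omega), mul_zero, zero_add]

/-- For each order `n ≥ 1` this is the image of the renewal equation under the algebra homomorphism
`fourierHom k`; order `0` is the one-point walk, of weight `α₀`. -/
theorem powerSeries_identity (hnonneg : ∀ η, 0 ≤ lam η) (hsymm : SymmetricActivities lam)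
    (hχ : FiniteSusceptibility lam z) {y : Site d} (hy : Adj y 0) (k : Fin d → ℝ) :
    PowerSeries.mk (fun n => latticeFourier (fun x => (z : ℝ) ^ n * sawCount lam z n x) k) *
      (1 - PowerSeries.C ((z : ℝ) * alphaOne lam z y * (2 * d) * latticeFourier stepDist k) *
        PowerSeries.X - PowerSeries.mk (fun m => latticeFourier (piCoeff lam z m) k)) =
      PowerSeries.C (alphaZero lam z : ℂ) := by
  rw [coeff_denominator hnonneg hsymm hχ hy]
  simp only [latticeFourier_sawCount hnonneg hsymm hχ]
  rw [mul_comm, sub_mul, one_mul]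
  ext n
  rw [map_sub, PowerSeries.coeff_mk, PowerSeries.coeff_mul,
    Finset.Nat.sum_antidiagonal_eq_sum_range_succ_mk, PowerSeries.coeff_C]
  simp only [PowerSeries.coeff_mk]
  rcases Nat.eq_zero_or_pos n with rfl | hn
  · simp [sawElem_zero, fourierHom, AddMonoidAlgebra.lift_single, latticeChar]
  · have h1 : ∑ m ∈ Finset.range (n + 1), (if m = 0 then 0 else fourierHom k (stepElem lam z m)) *
        fourierHom k (sawElem lam z (n - m)) =
        ∑ m ∈ Finset.Icc 1 n, fourierHom k (stepElem lam z m) *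
          fourierHom k (sawElem lam z (n - m)) := by
      symm
      apply Finset.sum_subset_zero_on_sdiff
      · intro m hm
        rw [Finset.mem_Icc] at hm
        exact Finset.mem_range.2 (by omega)
      · intro m hm
        rw [Finset.mem_sdiff, Finset.mem_range, Finset.mem_Icc] at hm
        rw [if_pos (by omega), zero_mul]
      · intro m hm
        rw [Finset.mem_Icc] at hm
        rw [if_neg (by omega)]
    rw [if_neg (by omega), h1, sawElem_eq_sum hnonneg hsymm hn, map_sum]
    simp only [map_mul, sub_self]

/-- Grouping the walks from the origin by their endpoint. -/
def walksFromZero (p : Σ x : Site d, WalkBetween (0 : Site d) x) : {ω : Walk d // ω.start = 0} :=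
  ⟨p.2.1, p.2.2.1⟩

theorem injective_walksFromZero : Function.Injective (walksFromZero (d := d)) := by
  rintro ⟨x, ω, h0, hx⟩ ⟨x', ω', h0', hx'⟩ h
  have h1 : ω = ω' := congrArg Subtype.val h
  subst h1
  have h2 : x = x' := hx.symm.trans hx'
  subst h2
  rfl

theorem summable_twoPoint (hχ : FiniteSusceptibility lam z) :
    Summable fun x => twoPoint lam z 0 x := by
  have h1 : Summable fun p : Σ x : Site d, WalkBetween (0 : Site d) x => weight lam z p.2.1 :=
    Summable.comp_injective (i := walksFromZero) hχ injective_walksFromZero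
  exact h1.sigma

theorem pairFactor_nonneg (lam : SAP d → ℝ) (z : ℝ) (p : ℕ → Site d) (e : ℕ × ℕ) :
    0 ≤ pairFactor lam z p e := by
  rw [pairFactor]
  split_ifs
  · exact le_rfl
  · exact (Real.exp_pos _).le

theorem sawCount_nonneg (hnonneg : ∀ η, 0 ≤ lam η) (hsymm : SymmetricActivities lam)
    (hχ : FiniteSusceptibility lam z) (n : ℕ) (x : Site d) :
    0 ≤ (z : ℝ) ^ n * sawCount lam z n x := by
  rw [← coeff_sawElem hnonneg hsymm hχ, sawElem, coeff_sum_single]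
  refine Finset.sum_nonneg fun w _ => ?_
  split_ifs
  · exact mul_nonneg (mul_nonneg (pow_nonneg z.coe_nonneg _)
      (pow_nonneg (alphaZero_pos hnonneg hsymm hχ).le _))
      (Finset.prod_nonneg fun e _ => pairFactor_nonneg _ _ _ _)
  · exact le_rfl

/-- The terms are nonnegative with total `∑_x G(x)`, which is finite. -/
theorem summable_sawCount (hnonneg : ∀ η, 0 ≤ lam η) (hsymm : SymmetricActivities lam)
    (hχ : FiniteSusceptibility lam z) :
    Summable fun p : ℕ × Site d => (z : ℝ) ^ p.1 * sawCount lam z p.1 p.2 := by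
  have h1 : Summable fun p : Site d × ℕ => (z : ℝ) ^ p.2 * sawCount lam z p.2 p.1 := by
    rw [summable_prod_of_nonneg]
    · refine ⟨fun x => (hasSum_sawCount hnonneg hsymm hχ x).summable, ?_⟩
      exact (summable_twoPoint hχ).congr fun x =>
        ((hasSum_sawCount hnonneg hsymm hχ x).tsum_eq).symm
    · intro p
      exact sawCount_nonneg hnonneg hsymm hχ _ _
  exact (Equiv.prodComm ℕ (Site d)).summable_iff.2 h1

/-- This is the power series identity at `t = 1`. Both coefficient sequences are absolutely
summable, so the product of their sums is the sum of the Cauchy product, of which only the constant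
term is nonzero. -/
theorem latticeFourier_twoPoint_mul (hnonneg : ∀ η, 0 ≤ lam η) (hsymm : SymmetricActivities lam)
    (hχ : FiniteSusceptibility lam z) {y : Site d} (hy : Adj y 0) (hπ : PiConverges lam z)
    (k : Fin d → ℝ) :
    latticeFourier (twoPoint lam z 0) k * laceDenominator lam z y k = alphaZero lam z := by
  have hsaw : Summable fun p : ℕ × Site d => |(z : ℝ) ^ p.1 * sawCount lam z p.1 p.2| :=
    (summable_sawCount hnonneg hsymm hχ).abs
  have hA := summable_latticeFourier hsaw k
  have hA' := latticeFourier_tsum hsaw k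
  have hP := summable_latticeFourier (f := fun p => piCoeff lam z p.1 p.2) hπ k
  have hP' := latticeFourier_tsum (f := fun p => piCoeff lam z p.1 p.2) hπ k
  simp only [(hasSum_sawCount hnonneg hsymm hχ _).tsum_eq] at hA'
  have hid := powerSeries_identity hnonneg hsymm hχ hy k
  set a : ℂ := (z : ℝ) * alphaOne lam z y * (2 * d) * latticeFourier stepDist k with ha
  let B : ℕ → ℂ := fun m => ((if m = 0 then 1 else 0) - if m = 1 then a else 0) -
    latticeFourier (piCoeff lam z m) k
  have hB : (1 - PowerSeries.C a * PowerSeries.X -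
      PowerSeries.mk (fun m => latticeFourier (piCoeff lam z m) k)) = PowerSeries.mk B := by
    ext m
    simp only [map_sub, PowerSeries.coeff_mk, PowerSeries.coeff_one, PowerSeries.coeff_C_mul,
      PowerSeries.coeff_X, B, mul_ite, mul_one, mul_zero]
  have h1 : HasSum (fun m : ℕ => if m = 0 then (1 : ℂ) else 0) 1 := hasSum_ite_eq 0 1
  have h2 : HasSum (fun m : ℕ => if m = 1 then a else 0) a := hasSum_ite_eq 1 a
  have hBs : HasSum B (laceDenominator lam z y k) := by
    have h3 := (h1.sub h2).sub (Summable.of_norm hP).hasSum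
    rw [← hP'] at h3
    exact h3
  have hBn : Summable fun m => ‖B m‖ := hBs.summable.norm
  rw [hB] at hid
  have hconv := tsum_mul_tsum_eq_tsum_sum_antidiagonal_of_summable_norm hA hBn
  rw [hBs.tsum_eq] at hconv
  have hG : latticeFourier (twoPoint lam z 0) k =
    ∑' n, latticeFourier (fun x => (z : ℝ) ^ n * sawCount lam z n x) k := hA'
  rw [hG, hconv]
  have h4 : ∀ n, ∑ kl ∈ Finset.HasAntidiagonal.antidiagonal n,
      latticeFourier (fun x => (z : ℝ) ^ kl.1 * sawCount lam z kl.1 x) k * B kl.2 =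
      if n = 0 then (alphaZero lam z : ℂ) else 0 := by
    intro n
    have := congrArg (PowerSeries.coeff n) hid
    rw [PowerSeries.coeff_mul, PowerSeries.coeff_C] at this
    simpa only [PowerSeries.coeff_mk] using this
  simp only [h4]
  exact tsum_ite_eq 0 _

end Fourier

end LWW

end

noncomputable section

namespace LWW

/-! ### Convergence for small `z` -/

section SmallActivity

open scoped NNReal Classical

variable {d : ℕ} {lam : SAP d → ℝ} {z : ℝ≥0}

/-- The `ℓ¹` norm of a finitely supported function. -/
def normOne (a : AddMonoidAlgebra ℝ (Site d)) : ℝ := ∑' x, |a.coeff x|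

theorem summable_abs_coeff (a : AddMonoidAlgebra ℝ (Site d)) : Summable fun x => |a.coeff x| :=
  summable_of_ne_finset_zero (s := a.coeff.support) fun x hx => by
    rw [Finsupp.notMem_support_iff.1 hx, abs_zero]

theorem normOne_nonneg (a : AddMonoidAlgebra ℝ (Site d)) : 0 ≤ normOne a :=
  tsum_nonneg fun _ => abs_nonneg _

theorem normOne_add_le (a b : AddMonoidAlgebra ℝ (Site d)) :
    normOne (a + b) ≤ normOne a + normOne b := by
  rw [normOne, normOne, normOne,
    ← (summable_abs_coeff a).tsum_add (summable_abs_coeff b)]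
  refine (summable_abs_coeff _).tsum_le_tsum (fun x => ?_)
    ((summable_abs_coeff a).add (summable_abs_coeff b))
  rw [AddMonoidAlgebra.coeff_add, Finsupp.add_apply]
  exact abs_add_le _ _

theorem normOne_sub_le (a b : AddMonoidAlgebra ℝ (Site d)) :
    normOne (a - b) ≤ normOne a + normOne b := by
  rw [sub_eq_add_neg]
  refine (normOne_add_le _ _).trans_eq ?_
  congr 1
  refine tsum_congr fun x => ?_
  rw [AddMonoidAlgebra.coeff_neg, Finsupp.neg_apply, abs_neg]

theorem normOne_zero : normOne (0 : AddMonoidAlgebra ℝ (Site d)) = 0 := by simp [normOne]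

theorem normOne_sum_le {ι : Type*} (s : Finset ι) (f : ι → AddMonoidAlgebra ℝ (Site d)) :
    normOne (∑ i ∈ s, f i) ≤ ∑ i ∈ s, normOne (f i) :=
  Finset.le_sum_of_subadditive _ normOne_zero.le normOne_add_le s f

theorem normOne_single_mul (x : Site d) (c : ℝ) (b : AddMonoidAlgebra ℝ (Site d)) :
    normOne (AddMonoidAlgebra.single x c * b) = |c| * normOne b := by
  rw [normOne, normOne, ← tsum_mul_left, ← (Equiv.addLeft x).tsum_eq]
  refine tsum_congr fun y => ?_
  rw [AddMonoidAlgebra.coeff_single_mul_apply, abs_mul]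
  simp

/-- Young's inequality for convolution in `ℓ¹`: `a` is a sum of point masses, each of which acts as
a translation times a scalar. -/
theorem normOne_mul_le (a b : AddMonoidAlgebra ℝ (Site d)) :
    normOne (a * b) ≤ normOne a * normOne b := by
  have h1 : a * b = ∑ x ∈ a.coeff.support, AddMonoidAlgebra.single x (a.coeff x) * b := by
    conv_lhs => rw [← AddMonoidAlgebra.sum_coeff_single a, Finsupp.sum, Finset.sum_mul]
  rw [h1]
  refine (normOne_sum_le _ _).trans_eq ?_
  simp only [normOne_single_mul]
  rw [← Finset.sum_mul]
  congr 1
  exact (tsum_eq_sum fun x hx => by rw [Finsupp.notMem_support_iff.1 hx, abs_zero]).symm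

/-- Summability of the kernel of a renewal inequality. -/
theorem summable_of_renewal {p C : ℕ → ℝ} {α S : ℝ} (hp : ∀ n, 0 ≤ p n)
    (hS : ∀ M, ∑ n ∈ Finset.Icc 1 M, C n ≤ S) (hα : S < α)
    (h : ∀ n, 1 ≤ n → α * p n ≤ C n + ∑ m ∈ Finset.Ico 1 n, p m * C (n - m)) : Summable p := by
  -- With `P` the partial sum, summing the inequality gives `α P ≤ S + P S`.
  have hkey : ∀ M, ∑ n ∈ Finset.Icc 1 M, p n ≤ S / (α - S) := by
    intro M
    have h1 : ∑ n ∈ Finset.Icc 1 M, ∑ m ∈ Finset.Ico 1 n, p m * C (n - m) ≤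
        (∑ m ∈ Finset.Icc 1 M, p m) * S := by
      rw [Finset.sum_sigma', Finset.sum_mul]
      calc ∑ x ∈ (Finset.Icc 1 M).sigma fun n => Finset.Ico 1 n, p x.2 * C (x.1 - x.2)
          = ∑ x ∈ (Finset.Icc 1 M).sigma fun m => Finset.Icc 1 (M - m), p x.1 * C x.2 := by
            refine Finset.sum_bij' (fun x _ => ⟨x.2, x.1 - x.2⟩) (fun x _ => ⟨x.1 + x.2, x.1⟩)
              ?_ ?_ ?_ ?_ ?_
            · rintro ⟨n, m⟩ hx
              simp only [Finset.mem_sigma, Finset.mem_Icc, Finset.mem_Ico] at hx ⊢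
              omega
            · rintro ⟨n, m⟩ hx
              simp only [Finset.mem_sigma, Finset.mem_Icc, Finset.mem_Ico] at hx ⊢
              omega
            · rintro ⟨n, m⟩ hx
              simp only [Finset.mem_sigma, Finset.mem_Icc, Finset.mem_Ico] at hx
              simp only [Sigma.mk.injEq, heq_eq_eq, and_true]
              omega
            · rintro ⟨n, m⟩ hx
              simp
            · rintro ⟨n, m⟩ hx
              rfl
        _ = ∑ m ∈ Finset.Icc 1 M, p m * ∑ j ∈ Finset.Icc 1 (M - m), C j := by
            rw [Finset.sum_sigma]
            simp only [Finset.mul_sum]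
        _ ≤ ∑ m ∈ Finset.Icc 1 M, p m * S :=
            Finset.sum_le_sum fun m _ => mul_le_mul_of_nonneg_left (hS _) (hp m)
    have h2 := Finset.sum_le_sum fun n (hn : n ∈ Finset.Icc 1 M) => h n (Finset.mem_Icc.1 hn).1
    rw [← Finset.mul_sum, Finset.sum_add_distrib] at h2
    rw [le_div_iff₀ (by linarith)]
    have h3 := hS M
    linarith
  refine summable_of_sum_range_le (c := p 0 + S / (α - S)) hp fun n => ?_
  refine (Finset.sum_le_sum_of_subset_of_nonneg (t := insert 0 (Finset.Icc 1 n)) ?_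
    fun i _ _ => hp i).trans ?_
  · intro i hi
    rw [Finset.mem_range] at hi
    rw [Finset.mem_insert, Finset.mem_Icc]
    omega
  · rw [Finset.sum_insert (by simp)]
    exact add_le_add_right (hkey n) _

/-- All walks from the origin, as words. -/
def wordToWalkFromZero (p : Σ n : ℕ, (Fin n → Step d)) : {ω : Walk d // ω.start = 0} :=
  ⟨wordWalk p.2, by rw [Walk.start, vert_wordWalk _ (Nat.zero_le _), path_zero]⟩

theorem bijective_wordToWalkFromZero : Function.Bijective (wordToWalkFromZero (d := d)) := by
  constructor
  · rintro ⟨n, w⟩ ⟨n', w'⟩ h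
    have h1 : wordWalk w = wordWalk w' := congrArg Subtype.val h
    have h2 : n = n' := by rw [← length_wordWalk w, h1, length_wordWalk]
    subst h2
    have h3 : path w' n = path w n := by
      rw [← vert_wordWalk w' le_rfl, ← h1, vert_wordWalk w le_rfl]
    have h4 := (bijective_wordToWalk n (path w n)).1 (a₁ := ⟨w, rfl⟩) (a₂ := ⟨w', h3⟩)
      (Subtype.ext h1)
    have h5 : w = w' := congrArg Subtype.val h4
    rw [h5]
  · rintro ⟨ω, hω⟩
    obtain ⟨w, hw⟩ := (bijective_wordToWalk ω.length ω.finish).2 ⟨ω, hω, rfl, rfl⟩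
    have h1 : wordWalk w.1 = ω := congrArg Subtype.val hw
    exact ⟨⟨ω.length, w.1⟩, Subtype.ext h1⟩

/-- There are at most `|ω|` removed loops, each with activity at most `K`; `K ≥ 1` allows their
number to be rounded up to `|ω|`. -/
theorem weight_le (hnonneg : ∀ η, 0 ≤ lam η) {K : ℝ≥0} (hK : 1 ≤ K) (hlam : ∀ η, lam η ≤ K)
    (ω : Walk d) : weight lam z ω ≤ ((z * K : ℝ≥0) : ℝ) ^ ω.length := by
  have h1 : ∀ l, lamList lam l ≤ K := by
    intro l
    rw [lamList]
    split_ifs with h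
    · exact Real.toNNReal_le_iff_le_coe.2 (hlam _)
    · exact hK
  have h2 : loopFactor (lamList lam) ω.verts ≤ K ^ ω.length := by
    rw [loopFactor]
    refine (List.prod_le_pow_card _ K ?_).trans ?_
    · intro x hx
      obtain ⟨l, -, rfl⟩ := List.mem_map.1 hx
      exact h1 l
    · rw [List.length_map]
      refine pow_le_pow_right₀ hK ?_
      have := length_removedLoops_lt ω.ne_nil
      rw [Walk.length]; omega
  rw [weight_eq_chainWeight hnonneg, chainWeight, if_pos ⟨ω.chain, ω.ne_nil⟩]
  have h3 : z ^ (ω.verts.length - 1) * loopFactor (lamList lam) ω.verts ≤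
      (z * K) ^ ω.length := by
    rw [mul_pow]
    exact mul_le_mul_right h2 _
  exact_mod_cast h3

theorem susceptibility_le (hnonneg : ∀ η, 0 ≤ lam η) {K : ℝ≥0} (hK : 1 ≤ K)
    (hlam : ∀ η, lam η ≤ K) {r : ℝ} (hr : r = Fintype.card (Step d) * (z * K : ℝ≥0))
    (hr1 : r < 1) : FiniteSusceptibility lam z ∧
      ∑' ω : {ω : Walk d // ω.start = 0}, weight lam z ω.1 ≤ (1 - r)⁻¹ := by
  let Φ := Equiv.ofBijective _ (bijective_wordToWalkFromZero (d := d))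
  have hr0 : 0 ≤ r := by rw [hr]; positivity
  have h0 : ∀ p : Σ n : ℕ, (Fin n → Step d), 0 ≤ weight lam z (wordWalk p.2) :=
    fun p => weight_nonneg hnonneg z _
  have h1 : ∀ n, ∑' w : Fin n → Step d, weight lam z (wordWalk w) ≤ r ^ n := by
    intro n
    rw [tsum_fintype]
    refine (Finset.sum_le_card_nsmul _ _ (((z * K : ℝ≥0) : ℝ) ^ n) fun w _ => ?_).trans_eq ?_
    · have := weight_le (z := z) hnonneg hK hlam (wordWalk w)
      rwa [length_wordWalk] at this
    · rw [Finset.card_univ, Fintype.card_fun, Fintype.card_fin, nsmul_eq_mul, hr, mul_pow]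
      push_cast
      rfl
  have h2 : Summable fun n => ∑' w : Fin n → Step d, weight lam z (wordWalk w) :=
    Summable.of_nonneg_of_le (fun n => tsum_nonneg fun w => h0 ⟨n, w⟩) h1
      (summable_geometric_of_lt_one hr0 hr1)
  have h3 : Summable fun p : Σ n : ℕ, (Fin n → Step d) => weight lam z (wordWalk p.2) :=
    (summable_sigma_of_nonneg h0).2 ⟨fun n => (hasSum_fintype _).summable, h2⟩
  refine ⟨Φ.summable_iff.1 h3, ?_⟩
  rw [← Φ.tsum_eq, ← tsum_geometric_of_lt_one hr0 hr1]
  refine (h3.tsum_sigma).trans_le ?_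
  exact h2.tsum_le_tsum h1 (summable_geometric_of_lt_one hr0 hr1)

theorem normOne_sawElem (hnonneg : ∀ η, 0 ≤ lam η) (hsymm : SymmetricActivities lam)
    (hχ : FiniteSusceptibility lam z) (n : ℕ) :
    normOne (sawElem lam z n) = ∑' x, (z : ℝ) ^ n * sawCount lam z n x := by
  refine tsum_congr fun x => ?_
  rw [coeff_sawElem hnonneg hsymm hχ, abs_of_nonneg (sawCount_nonneg hnonneg hsymm hχ n x)]

theorem sum_normOne_sawElem_le (hnonneg : ∀ η, 0 ≤ lam η) (hsymm : SymmetricActivities lam)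
    (hχ : FiniteSusceptibility lam z) (s : Finset ℕ) :
    ∑ n ∈ s, normOne (sawElem lam z n) ≤
      ∑' ω : {ω : Walk d // ω.start = 0}, weight lam z ω.1 := by
  have hs := summable_sawCount hnonneg hsymm hχ
  have h1 : Summable fun n => normOne (sawElem lam z n) := by
    simp only [normOne_sawElem hnonneg hsymm hχ]
    exact hs.prod
  refine (h1.sum_le_tsum s fun n _ => normOne_nonneg _).trans ?_
  simp only [normOne_sawElem hnonneg hsymm hχ]
  have h2 : Summable (Function.uncurry fun (n : ℕ) (x : Site d) =>
    (z : ℝ) ^ n * sawCount lam z n x) := hs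
  rw [← h2.tsum_comm]
  simp only [(hasSum_sawCount hnonneg hsymm hχ _).tsum_eq]
  have h3 : Summable fun p : Σ x : Site d, WalkBetween (0 : Site d) x => weight lam z p.2.1 :=
    Summable.comp_injective (i := walksFromZero) hχ injective_walksFromZero
  have h4 : ∑' x, twoPoint lam z 0 x =
      ∑' p : Σ x : Site d, WalkBetween (0 : Site d) x, weight lam z p.2.1 := h3.tsum_sigma.symm
  rw [h4]
  exact tsum_comp_le_tsum_of_inj hχ (fun ω => weight_nonneg hnonneg z _) injective_walksFromZero

theorem one_le_alphaZero (hnonneg : ∀ η, 0 ≤ lam η) (hsymm : SymmetricActivities lam)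
    (hχ : FiniteSusceptibility lam z) : 1 ≤ alphaZero lam z := by
  rw [alphaZero_eq_exp hnonneg hsymm hχ]
  exact Real.one_le_exp (tsum_nonneg fun X => Set.indicator_nonneg
    (fun X _ => loopNu_nonneg hnonneg z X) X)

/-- In the renewal equation the term `m = n` is `stepElem n` times a point mass `α₀` at the origin;
solving for it and taking norms gives the bound. -/
theorem normOne_stepElem_le (hnonneg : ∀ η, 0 ≤ lam η) (hsymm : SymmetricActivities lam)
    (hχ : FiniteSusceptibility lam z) {n : ℕ} (hn : 1 ≤ n) :
    alphaZero lam z * normOne (stepElem lam z n) ≤ normOne (sawElem lam z n) +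
      ∑ m ∈ Finset.Ico 1 n, normOne (stepElem lam z m) * normOne (sawElem lam z (n - m)) := by
  have h1 := sawElem_eq_sum (z := z) hnonneg hsymm hn
  rw [← Finset.sum_Ico_add_eq_sum_Icc hn, Nat.sub_self, sawElem_zero, mul_comm (stepElem lam z n)]
    at h1
  rw [← abs_of_pos (alphaZero_pos hnonneg hsymm hχ), ← normOne_single_mul 0,
    ← sub_eq_of_eq_add' h1]
  refine (normOne_sub_le _ _).trans (add_le_add_right ?_ _)
  refine (normOne_sum_le _ _).trans (Finset.sum_le_sum fun m _ => normOne_mul_le _ _)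

/-- The norms of `sawElem` have total at most `χ`, and order zero takes `α₀` of it. What remains is
at most `χ - α₀`, which is below `α₀` because `χ < 2` and `α₀ ≥ 1`; this is the gap that
`summable_of_renewal` needs. -/
theorem piConverges_of_susceptibility_lt (hnonneg : ∀ η, 0 ≤ lam η)
    (hsymm : SymmetricActivities lam) (hχ : FiniteSusceptibility lam z)
    (h2 : ∑' ω : {ω : Walk d // ω.start = 0}, weight lam z ω.1 < 2) : PiConverges lam z := by
  set χ := ∑' ω : {ω : Walk d // ω.start = 0}, weight lam z ω.1 with hχdef
  have hα := one_le_alphaZero hnonneg hsymm hχ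
  have hsum : Summable fun n => normOne (stepElem lam z n) := by
    refine summable_of_renewal (S := χ - alphaZero lam z) (α := alphaZero lam z)
      (C := fun n => normOne (sawElem lam z n)) (fun n => normOne_nonneg _) (fun M => ?_) (by linarith)
      (fun n hn => normOne_stepElem_le hnonneg hsymm hχ hn)
    have h3 := sum_normOne_sawElem_le hnonneg hsymm hχ (insert 0 (Finset.Icc 1 M))
    rw [Finset.sum_insert (by simp), sawElem_zero] at h3
    have h4 : normOne (AddMonoidAlgebra.single (0 : Site d) (alphaZero lam z)) =
        alphaZero lam z := by
      rw [normOne, tsum_eq_single 0]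
      · simp [abs_of_pos (alphaZero_pos hnonneg hsymm hχ)]
      · intro x hx
        rw [AddMonoidAlgebra.coeff_single, Finsupp.single_eq_of_ne hx, abs_zero]
    rw [h4] at h3
    linarith
  have hfib : ∀ n, (Summable fun x => |piCoeff lam z n x|) ∧
      ∑' x, |piCoeff lam z n x| ≤ normOne (stepElem lam z n) := by
    intro n
    rcases Nat.lt_or_ge n 2 with hn | hn
    · simp only [piCoeff_of_lt_two hn, abs_zero, tsum_zero]
      exact ⟨summable_zero, normOne_nonneg _⟩
    · simp only [← coeff_stepElem hnonneg hsymm hχ hn]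
      exact ⟨summable_abs_coeff _, le_rfl⟩
  refine (summable_prod_of_nonneg fun p => abs_nonneg _).2 ⟨fun n => (hfib n).1, ?_⟩
  exact Summable.of_nonneg_of_le (fun n => tsum_nonneg fun _ => abs_nonneg _)
    (fun n => (hfib n).2) hsum

theorem exists_convergence_radius (hnonneg : ∀ η, 0 ≤ lam η) (hsymm : SymmetricActivities lam)
    (hbdd : BddAbove (Set.range lam)) :
    ∃ z₀ : ℝ, 0 < z₀ ∧ ∀ z : ℝ, 0 ≤ z → z < z₀ →
      FiniteSusceptibility lam z ∧ PiConverges lam z := by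
  obtain ⟨Λ, hΛ⟩ := hbdd
  let K : ℝ≥0 := max 1 Λ.toNNReal
  have hK : 1 ≤ K := le_max_left _ _
  have hlam : ∀ η, lam η ≤ K := fun η =>
    (hΛ ⟨η, rfl⟩).trans ((Real.le_coe_toNNReal Λ).trans (NNReal.coe_le_coe.2 (le_max_right _ _)))
  have hK0 : (0 : ℝ) < K := lt_of_lt_of_le one_pos (by exact_mod_cast hK)
  set B : ℝ := Fintype.card (Step d) + 1 with hB
  have hB0 : 0 < B := by positivity
  -- Below this radius the ratio of the dominating geometric series is less than `1/2`, so `χ < 2`.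
  -- The summand `1` in `B` ensures positivity.
  refine ⟨(2 * (B * K))⁻¹, by positivity, fun z hz hz0 => ?_⟩
  lift z to ℝ≥0 using hz
  have h1 : (Fintype.card (Step d) : ℝ) * (z * K : ℝ≥0) < 1 / 2 := by
    have h2 : (z : ℝ) * (2 * (B * K)) < 1 := by
      rwa [← one_div, lt_div_iff₀ (by positivity)] at hz0
    push_cast
    nlinarith [mul_nonneg z.coe_nonneg hK0.le]
  obtain ⟨h3, h4⟩ := susceptibility_le hnonneg hK hlam rfl (h1.trans (by norm_num))
  refine ⟨h3, piConverges_of_susceptibility_lt hnonneg hsymm h3 (h4.trans_lt ?_)⟩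
  rw [inv_lt_comm₀ (by linarith) (by norm_num)]
  linarith

end SmallActivity

end LWW

end

theorem mainTheorem4 {d : ℕ} (lam : SAP d → ℝ) (hnonneg : ∀ η, 0 ≤ lam η)
    (hsymm : SymmetricActivities lam) (hbdd : BddAbove (Set.range lam))
    (y : Site d) (hy : Adj y 0) :
    (∀ z : ℝ, 0 ≤ z → FiniteSusceptibility lam z →
      -- the constants, in terms of the loop measure
      (Summable (loopMeasureTerm lam z {0} ∅) ∧
        alphaZero lam z = Real.exp (loopMeasure lam z {0} ∅) ∧
        alphaOne lam z y = Real.exp (loopMeasure lam z {0} {y})) ∧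
      -- the identity order by order in the length
      ((∀ x, HasSum (fun n : ℕ => z ^ n * sawCount lam z n x) (twoPoint lam z 0 x)) ∧
        ∀ k : Fin d → ℝ,
          PowerSeries.mk (fun n => latticeFourier (fun x => z ^ n * sawCount lam z n x) k) *
            (1 - PowerSeries.C (z * alphaOne lam z y * (2 * d) * latticeFourier stepDist k) *
                PowerSeries.X
              - PowerSeries.mk (fun m => latticeFourier (piCoeff lam z m) k)) =
          PowerSeries.C (alphaZero lam z : ℂ)) ∧
      -- the identity between convergent series
      (PiConverges lam z → ∀ k : Fin d → ℝ,
        laceDenominator lam z y k ≠ 0 ∧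
        latticeFourier (twoPoint lam z 0) k = alphaZero lam z / laceDenominator lam z y k)) ∧
    -- convergence for small activities
    ∃ z₀ : ℝ, 0 < z₀ ∧ ∀ z : ℝ, 0 ≤ z → z < z₀ →
      FiniteSusceptibility lam z ∧ PiConverges lam z := by
  refine ⟨fun z hz hχ => ?_, exists_convergence_radius hnonneg hsymm hbdd⟩
  lift z to NNReal using hz
  refine ⟨loopMeasure_constants hnonneg hsymm hχ y,
    ⟨fun x => hasSum_sawCount hnonneg hsymm hχ x,
      fun k => powerSeries_identity hnonneg hsymm hχ hy k⟩, fun hπ k => ?_⟩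
  have h1 := latticeFourier_twoPoint_mul hnonneg hsymm hχ hy hπ k
  have h2 : (alphaZero lam z : ℂ) ≠ 0 :=
    Complex.ofReal_ne_zero.2 (alphaZero_pos hnonneg hsymm hχ).ne'
  -- The product with the denominator equals `α₀`, an exponential and hence nonzero.
  have h3 : laceDenominator lam z y k ≠ 0 := right_ne_zero_of_mul (h1.trans_ne h2)
  exact ⟨h3, eq_div_of_mul_eq h3 h1⟩
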